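/- Let $dA$ be Lebesgue measure on $\mathbb C$, and let a weight be a non-negative locally integrable function $w$ on $\mathbb C$ that is not almost everywhere zero. For $1<p<\infty$ and $1/p+1/p'=1$, write $w\in A_p^{\mathrm{res}}$ if for some $r>0$ $$\sup_{Q}\Big(\frac1{A(Q)}\int_Q w\,dA\Big)\Big(\frac1{A(Q)}\int_Q w^{-p'/p}\,dA\Big)^{p/p'}<\infty,$$ and $w\in A_1^{\mathrm{res}}$ if for some $r>0$ $$\sup_Q\Big(\frac1{A(Q)}\int_Q w\,dA\Big)\|w^{-1}\|_{L^\infty(Q)}<\infty,$$ where $Q$ runs over the squares of side length $r$ with sides parallel to the coordinate axes. Put $A_\infty^{\mathrm{res}}=\bigcup_{1\le p<\infty}A_p^{\mathrm{res}}$. Let $\alpha>0$ and $w\in A_\infty^{\mathrm{res}}$. Let $F^2_{\alpha,w}$ be the Hilbert space of entire functions $f$ with $\int_{\mathbb C}|f|^2e^{-\alpha|z|^2}w\,dA<\infty$, with inner product $\langle f,g\rangle=\int_{\mathbb C} f\overline g\,e^{-\alpha|z|^2}w\,dA$; let $B^w_z$ be its reproducing kernel at $z$ and $b^w_z=B^w_z/\|B^w_z\|$.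 For a positive Borel measure $\mu$ on $\mathbb C$ and $r>0$ let $$T_\mu f(z)=\int_{\mathbb C} f(\xi)\overline{B^w_z(\xi)}e^{-\alpha|\xi|^2}\,d\mu(\xi),\qquad \widetilde\mu(z)=\int_{\mathbb C}|b^w_z(\xi)|^2e^{-\alpha|\xi|^2}\,d\mu(\xi),\qquad \widehat\mu_{w,r}(z)=\frac{\mu(D(z,r))}{\int_{D(z,r)}w\,dA},$$ where $D(z,r)$ is the open disk with centre $z$ and radius $r$. A compact operator $T$ on a Hilbert space, with singular values $s_n(T)$, is in the Schatten class $\mathcal S_p$ if $\|T\|_{\mathcal S_p}^p=\sum_n s_n(T)^p<\infty$. The statement $T_\mu\in\mathcal S_p(F^2_{\alpha,w})$ means that the integral $T_\mu f(z)$ converges absolutely for all $f\in F^2_{\alpha,w}$ and $z\in\mathbb C$, and that $f\mapsto T_\mu f$ is an operator on $F^2_{\alpha,w}$ in the class $\mathcal S_p$; if it fails, put $\|T_\mu\|_{\mathcal S_p}=\infty$. Likewise the $L^p$ norms below may be infinite. Then there exists $\delta\in(0,1)$, depending only on $\alpha$ and $w$, such that for every real $p\ge1$ and every positive Borel measure $\mu$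 on $\mathbb C$ the following are equivalent: (a) $T_\mu\in\mathcal S_p(F^2_{\alpha,w})$; (b) $\widetilde\mu\in L^p(\mathbb C,dA)$; (c) $\widehat\mu_{w,r}\in L^p(\mathbb C,dA)$ for some $r\in(0,\delta)$; (c$'$) $\widehat\mu_{w,r}\in L^p(\mathbb C,dA)$ for every $r\in(0,\delta)$. Moreover, for every $p\ge1$ and $r\in(0,\delta)$, $$\|T_\mu\|_{\mathcal S_p(F^2_{\alpha,w})}\asymp\|\widetilde\mu\|_{L^p(\mathbb C,dA)}\asymp\|\widehat\mu_{w,r}\|_{L^p(\mathbb C,dA)},$$ where the constants of the first comparison depend only on $\alpha,w,p$, those of the second only on $\alpha,w,p,r$; in particular they do not depend on $\mu$. -/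

import Mathlib

open MeasureTheory
open scoped ENNReal NNReal ComplexConjugate

noncomputable section

namespace WeightedFock

/-! ### Weights on the complex plane (Lebesgue measure on `ℂ` is `volume`) -/

/-- A weight: a non-negative, locally integrable function on `ℂ`, not almost everywhere zero. -/
structure IsWeight (w : ℂ → ℝ) : Prop where
  nonneg : ∀ z, 0 ≤ w z
  locallyIntegrable : LocallyIntegrable w volume
  ne_zero : ¬ (w =ᵐ[volume] 0)

/-- The square with centre `c`, side length `r` and sides parallel to the coordinate axes. -/
def square (c : ℂ) (r : ℝ) : Set ℂ :=
  {z | |z.re - c.re| ≤ r / 2 ∧ |z.im - c.im| ≤ r / 2}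

/-- The average `A(Q)⁻¹ ∫_Q g dA` over the square `Q` with centre `c` and side length `r`. -/
def squareAverage (c : ℂ) (r : ℝ) (g : ℂ → ℝ≥0∞) : ℝ≥0∞ :=
  (∫⁻ z in square c r, g z) / volume (square c r)

/-- The class `A^res_p` for `1 < p < ∞`; here `p' = p / (p - 1)` is the conjugate exponent.  The
negative power of `w` takes the value `∞` where `w` vanishes. -/
def ARes (p : ℝ) : Set (ℂ → ℝ) :=
  {w | IsWeight w ∧ ∃ r : ℝ, 0 < r ∧
    ⨆ c : ℂ, squareAverage c r (fun z => ENNReal.ofReal (w z)) *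
      squareAverage c r (fun z => ENNReal.ofReal (w z) ^ (-(p.conjExponent / p))) ^
        (p / p.conjExponent) < ∞}

/-- The class `A^res_1`. -/
def AResOne : Set (ℂ → ℝ) :=
  {w | IsWeight w ∧ ∃ r : ℝ, 0 < r ∧
    ⨆ c : ℂ, squareAverage c r (fun z => ENNReal.ofReal (w z)) *
      essSup (fun z => (ENNReal.ofReal (w z))⁻¹) (volume.restrict (square c r)) < ∞}

/-- The class `A^res_∞`, the union of the classes `A^res_p` over `1 ≤ p < ∞`. -/
def AResInfty : Set (ℂ → ℝ) :=
  AResOne ∪ ⋃ (p : ℝ) (_ : 1 < p), ARes p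

/-- The measure `w dA`. -/
def weightMeasure (w : ℂ → ℝ) : Measure ℂ :=
  volume.withDensity fun z => ENNReal.ofReal (w z)

/-- The measure `e^{-α|z|²} w(z) dA(z)`. -/
def fockMeasure (α : ℝ) (w : ℂ → ℝ) : Measure ℂ :=
  volume.withDensity fun z => ENNReal.ofReal (Real.exp (-α * ‖z‖ ^ 2) * w z)

/-! ### The weighted Fock space `F²_{α,w}` -/

/-- The entire functions that are square integrable for `e^{-α|z|²} w(z) dA(z)`. -/
def fockSubmodule (α : ℝ) (w : ℂ → ℝ) : Submodule ℂ (ℂ → ℂ) where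
  carrier := {f | Differentiable ℂ f ∧ MemLp f 2 (fockMeasure α w)}
  add_mem' hf hg := ⟨hf.1.add hg.1, hf.2.add hg.2⟩
  zero_mem' := ⟨differentiable_const (0 : ℂ), MemLp.zero⟩
  smul_mem' c _ hf := ⟨hf.1.const_smul c, hf.2.const_smul c⟩

/-- The weighted Fock space `F²_{α,w}`, a space of entire functions. -/
def FockSpace (α : ℝ) (w : ℂ → ℝ) : Type := fockSubmodule α w

variable {α : ℝ} {w : ℂ → ℝ}

instance : AddCommGroup (FockSpace α w) := inferInstanceAs (AddCommGroup (fockSubmodule α w))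

instance : Module ℂ (FockSpace α w) := inferInstanceAs (Module ℂ (fockSubmodule α w))

instance : CoeFun (FockSpace α w) fun _ => ℂ → ℂ := ⟨fun f => f.1⟩

theorem FockSpace.integrable_inner (f g : FockSpace α w) :
    Integrable (fun ξ => g ξ * conj (f ξ)) (fockMeasure α w) :=
  MemLp.integrable_mul g.2.2 f.2.2.star

/-- The inner product `⟨g, f⟩ = ∫ g conj(f) e^{-α|ξ|²} w(ξ) dA(ξ)`; Mathlib's `inner ℂ f g` is
linear in its second argument `g`. -/
@[reducible]
def fockCore (α : ℝ) (w : ℂ → ℝ) : PreInnerProductSpace.Core ℂ (FockSpace α w) where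
  inner f g := ∫ ξ, g ξ * conj (f ξ) ∂(fockMeasure α w)
  conj_inner_symm f g := by
    rw [← integral_conj]
    congr 1
    ext ξ
    simp [mul_comm]
  re_inner_nonneg f := by
    have h : ∀ ξ, f ξ * conj (f ξ) = ((Complex.normSq (f ξ) : ℝ) : ℂ) :=
      fun ξ => Complex.mul_conj _
    simp only [h]
    rw [integral_complex_ofReal]
    exact integral_nonneg fun ξ => Complex.normSq_nonneg _
  add_left f g k := by
    rw [← integral_add (f.integrable_inner k) (g.integrable_inner k)]
    congr 1
    ext ξ
    change k ξ * conj (f ξ + g ξ) = _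
    rw [map_add, mul_add]
  smul_left f g c := by
    rw [← integral_const_mul]
    congr 1
    ext ξ
    change g ξ * conj (c * f ξ) = _
    rw [map_mul]
    ring

instance : SeminormedAddCommGroup (FockSpace α w) :=
  @InnerProductSpace.Core.toSeminormedAddCommGroup ℂ _ _ _ _ (fockCore α w)

instance : InnerProductSpace ℂ (FockSpace α w) := InnerProductSpace.ofCore (fockCore α w)

theorem FockSpace.inner_def (f g : FockSpace α w) :
    inner ℂ f g = ∫ ξ, g ξ * conj (f ξ) ∂(fockMeasure α w) := rfl

open Classical in
/-- The reproducing kernel `B^w_z` of `F²_{α,w}` at `z`: the element of `F²_{α,w}` such that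
`f z = ⟨f, B^w_z⟩` for all `f` in `F²_{α,w}`.  For `α > 0` and `w` in `A^res_∞` it exists and is
unique (in the remaining cases the value is `0`). -/
def kernel (α : ℝ) (w : ℂ → ℝ) (z : ℂ) : FockSpace α w :=
  if h : ∃ B : FockSpace α w, ∀ f : FockSpace α w, f z = inner ℂ B f then h.choose else 0

/-- The normalized reproducing kernel `b^w_z`. -/
def normKernel (α : ℝ) (w : ℂ → ℝ) (z : ℂ) : FockSpace α w :=
  ((‖kernel α w z‖⁻¹ : ℝ) : ℂ) • kernel α w z

/-! ### Toeplitz operators, Berezin transforms and averages of a positive Borel measure -/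

/-- The integrand `f(ξ) conj(B^w_z(ξ)) e^{-α|ξ|²}` in the definition of `T_μ f (z)`. -/
def toeplitzIntegrand (f : FockSpace α w) (z ξ : ℂ) : ℂ :=
  f ξ * conj (kernel α w z ξ) * (Real.exp (-α * ‖ξ‖ ^ 2) : ℂ)

/-- `T` is the Toeplitz operator `T_μ` as a bounded operator on `F²_{α,w}`: for every `f` in
`F²_{α,w}` and every `z`, the integral defining `T_μ f (z)` converges absolutely and its value
is `T f (z)`.  There is at most one such `T`, since elements of `F²_{α,w}` are functions. -/
def IsToeplitz (μ : Measure ℂ) (T : FockSpace α w →L[ℂ] FockSpace α w) : Prop :=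
  ∀ (f : FockSpace α w) (z : ℂ), Integrable (toeplitzIntegrand f z) μ ∧
    T f z = ∫ ξ, toeplitzIntegrand f z ξ ∂μ

/-- The Berezin transform `μ̃(z) = ∫ |b^w_z(ξ)|² e^{-α|ξ|²} dμ(ξ)`, with values in `[0, ∞]`. -/
def berezin (α : ℝ) (w : ℂ → ℝ) (μ : Measure ℂ) (z : ℂ) : ℝ≥0∞ :=
  ∫⁻ ξ, ENNReal.ofReal (‖normKernel α w z ξ‖ ^ 2 * Real.exp (-α * ‖ξ‖ ^ 2)) ∂μ

/-- The average `μ̂_{w,r}(z) = μ(D(z,r)) / w(D(z,r))`, with values in `[0, ∞]`. -/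
def average (w : ℂ → ℝ) (r : ℝ) (μ : Measure ℂ) (z : ℂ) : ℝ≥0∞ :=
  μ (Metric.ball z r) / weightMeasure w (Metric.ball z r)

/-! ### Schatten classes -/

section Schatten

variable {H : Type*} [SeminormedAddCommGroup H] [InnerProductSpace ℂ H]

/-- `s` is the singular value sequence in a canonical decomposition
`T x = ∑ s n ⟨x, e n⟩ σ n`, where `s` is non-increasing, non-negative and tends to `0`, and the
`e n`, as well as the `σ n`, with `s n ≠ 0` are orthonormal (the other terms vanish, so that the
orthonormal systems may be finite).  Such `T` are exactly the compact operators on a Hilbert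
space, and `s` is determined by `T`. -/
def IsSingularValueSeq (T : H →L[ℂ] H) (s : ℕ → ℝ) : Prop :=
  Antitone s ∧ (∀ n, 0 ≤ s n) ∧ Filter.Tendsto s Filter.atTop (nhds 0) ∧
    ∃ e σ : ℕ → H,
      Orthonormal ℂ (fun n : {n // s n ≠ 0} => e n) ∧
      Orthonormal ℂ (fun n : {n // s n ≠ 0} => σ n) ∧
      ∀ x, HasSum (fun n => ((s n : ℂ) * inner ℂ (e n) x) • σ n) (T x)

/-- Membership in the Schatten class `S_p(H)`. -/
def MemSchatten (p : ℝ) (T : H →L[ℂ] H) : Prop :=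
  ∃ s, IsSingularValueSeq T s ∧ Summable fun n => s n ^ p

/-- The Schatten norm `(∑ s n ^ p) ^ (1 / p)`, equal to `∞` if `T` is not compact or the sum
diverges.  The infimum runs over at most one sequence. -/
def schattenNorm (p : ℝ) (T : H →L[ℂ] H) : ℝ≥0∞ :=
  ⨅ (s : ℕ → ℝ) (_ : IsSingularValueSeq T s), (∑' n, ENNReal.ofReal (s n) ^ p) ^ (1 / p)

end Schatten

/-- `T_μ` belongs to the Schatten class `S_p(F²_{α,w})`. -/
def ToeplitzMemSchatten (α : ℝ) (w : ℂ → ℝ) (p : ℝ) (μ : Measure ℂ) : Prop :=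
  ∃ T : FockSpace α w →L[ℂ] FockSpace α w, IsToeplitz μ T ∧ MemSchatten p T

/-- The Schatten norm of `T_μ`, equal to `∞` if `T_μ` is not a bounded operator on `F²_{α,w}` or
is not in the Schatten class.  The infimum runs over at most one operator. -/
def toeplitzSchattenNorm (α : ℝ) (w : ℂ → ℝ) (p : ℝ) (μ : Measure ℂ) : ℝ≥0∞ :=
  ⨅ (T : FockSpace α w →L[ℂ] FockSpace α w) (_ : IsToeplitz μ T), schattenNorm p T

end WeightedFock

end

/-! The weight condition enters through one consequence: on squares of a fixed side `R`, `w(Q)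
A(E)^N ≤ C w(E)` for measurable `E ⊆ Q`. Chaining squares makes `m = w dA` locally doubling: the
masses of disks of fixed radii vary at most exponentially with the distance of the centres, and
shrinking a disk costs at most a power of the ratio of the radii.

For such `m`, the density `|f|² e^{-α|·|²}` of an entire function has a local mean value property.
Hence point evaluations are bounded, the Fock space is a Hilbert space, and `‖B_z‖² e^{-α|z|²} ≍ 1 /
w(D(z,r))`; the lower bound comes from testing with an entire function whose density is a Gaussian
centred at `z`. By the Schwarz lemma `|b_z|` stays large on a disk of a fixed radius `δ`, so
averages of radius `r < δ` are pointwise at most a multiple of the Berezin transform.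

The reverse estimate combines the Carleson inequality `∫ |f|² e^{-α|·|²} dμ ≤ D ∫ μ̂ |f|² e^{-α|·|²}
w dA`, Jensen's inequality for the probability density of a unit vector, and Tonelli
(`exists_lintegral_berezin_le`).

For the Schatten norm, `T_μ = J† J` with `J` the embedding into `L²(e^{-α|·|²} dμ)`. The same
Carleson and Jensen step, with Bessel's inequality in place of the kernel integral, bounds `∑ ‖J
e_i‖^{2p}` over orthonormal systems by `∫ μ̂^p` (`exists_sum_rpow_le`); this forces compactness and
bounds the eigenvalue sum (`DiagonalSumLE.exists_isSingularValueSeq`). Conversely `μ̃(z) = ⟨T_μ b_z,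
b_z⟩` is at most an average of the singular values with weights of total mass at most one, so Jensen
and `∫ |⟨f, b_z⟩|² dA(z) ≤ C ‖f‖²` bound `∫ μ̃^p` by `∑ s_n^p` (`exists_lintegral_berezin_le_tsum`).
-/

namespace WeightedFock

/-! ### Compactness and extremal eigenvectors of `J† J` -/

section Operators

variable {H K : Type*} [NormedAddCommGroup H] [InnerProductSpace ℂ H]
  [NormedAddCommGroup K] [InnerProductSpace ℂ K]

/-- The `p`-th powers of the diagonal entries of `J† J` have sums at most `M`, over all finite
orthonormal systems. -/
def DiagonalSumLE (J : H →L[ℂ] K) (p : ℝ) (M : ℝ≥0∞) : Prop :=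
  ∀ (ι : Type) [Fintype ι] (e : ι → H), Orthonormal ℂ e →
    ∑ i, ENNReal.ofReal (‖J (e i)‖ ^ 2) ^ p ≤ M

/-- Otherwise vectors can be chosen inductively, each orthogonal to the previous ones, to form an
orthonormal sequence with `‖J e_n‖ > ε`; its diagonal sums exceed any finite `M`. -/
theorem DiagonalSumLE.exists_finiteDimensional {J : H →L[ℂ] K} {p : ℝ} {M : ℝ≥0∞}
    (h : DiagonalSumLE J p M) (hp : 0 < p) (hM : M ≠ ∞) {ε : ℝ} (hε : 0 < ε) :
    ∃ V : Submodule ℂ H, FiniteDimensional ℂ V ∧ ∀ x ∈ Vᗮ, ‖J x‖ ≤ ε * ‖x‖ := by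
  by_contra! hcon
  obtain ⟨e, he, hee⟩ := exists_seq_of_forall_finset_exists
    (fun x : H => ‖x‖ = 1 ∧ ε < ‖J x‖) (fun x y => inner ℂ x y = 0) (by
      intro s _
      obtain ⟨x, hx, hJ⟩ := hcon (Submodule.span ℂ (s : Set H)) inferInstance
      have hx0 : ‖x‖ ≠ 0 := by
        intro h0
        rw [norm_eq_zero] at h0
        simp [h0] at hJ
      have hxp : 0 < ‖x‖ := lt_of_le_of_ne (norm_nonneg _) hx0.symm
      refine ⟨((‖x‖⁻¹ : ℝ) : ℂ) • x, ⟨?_, ?_⟩, ?_⟩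
      · rw [norm_smul]; simp [hx0]
      · rw [map_smul, norm_smul]
        simp only [Complex.norm_real, norm_inv, norm_norm]
        rw [lt_inv_mul_iff₀ hxp]
        linarith
      · intro y hy
        rw [inner_smul_right, (Submodule.mem_orthogonal _ _).1 hx y (Submodule.subset_span hy),
          mul_zero])
  have hon : Orthonormal ℂ e := by
    refine ⟨fun n => (he n).1, fun i j hij => ?_⟩
    rcases lt_or_gt_of_ne hij with h1 | h1
    · exact hee _ _ h1
    · exact inner_eq_zero_symm.1 (hee _ _ h1)
  have key : ∀ n : ℕ, (n : ℝ≥0∞) * ENNReal.ofReal (ε ^ 2) ^ p ≤ M := by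
    intro n
    have h1 := h (Fin n) (fun i => e i) (hon.comp _ Fin.val_injective)
    refine le_trans ?_ h1
    have h2 : ∀ i ∈ (Finset.univ : Finset (Fin n)), ENNReal.ofReal (ε ^ 2) ^ p ≤
        ENNReal.ofReal (‖J (e i)‖ ^ 2) ^ p := by
      intro i _
      have := (he i).2
      gcongr
    have := Finset.sum_le_sum h2
    simpa using this
  have hpos : ENNReal.ofReal (ε ^ 2) ^ p ≠ 0 := by
    have : 0 < ENNReal.ofReal (ε ^ 2) := by rw [ENNReal.ofReal_pos]; positivity
    exact (ENNReal.rpow_pos this ENNReal.ofReal_ne_top).ne'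
  have htop : ENNReal.ofReal (ε ^ 2) ^ p ≠ ∞ :=
    ENNReal.rpow_ne_top_of_nonneg hp.le ENNReal.ofReal_ne_top
  obtain ⟨n, hn⟩ := ENNReal.exists_nat_gt (ENNReal.div_ne_top hM hpos)
  rw [ENNReal.div_lt_iff (Or.inl hpos) (Or.inl htop)] at hn
  exact absurd (key n) (not_le.2 hn)

variable [CompleteSpace H] [CompleteSpace K]

/-- `J† J` is the norm limit of the finite rank operators `J† J P_V`, because `J` is small on `Vᗮ`.
-/
theorem DiagonalSumLE.isCompactOperator {J : H →L[ℂ] K} {p : ℝ} {M : ℝ≥0∞}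
    (h : DiagonalSumLE J p M) (hp : 0 < p) (hM : M ≠ ∞) :
    IsCompactOperator (J.adjoint ∘L J) := by
  have hcl : IsClosed {f : H →L[ℂ] H | IsCompactOperator f} := isClosed_setOfPred_isCompactOperator
  have hmem : J.adjoint ∘L J ∈ closure {f : H →L[ℂ] H | IsCompactOperator f} := by
    rw [Metric.mem_closure_iff]
    intro ε hε
    have hden : 0 < ‖J‖ + 1 := by positivity
    obtain ⟨V, hV, hVJ⟩ := h.exists_finiteDimensional hp hM (ε := ε / 2 / (‖J‖ + 1))
      (by positivity)
    refine ⟨(J.adjoint ∘L J) ∘L V.starProjection, ?_, ?_⟩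
    · have hP : IsCompactOperator (V.starProjection : H →L[ℂ] H) := by
        have : ProperSpace V := FiniteDimensional.proper ℂ V
        have h2 : IsCompactOperator (id : V → V) := isCompactOperator_id
        exact (h2.comp_clm V.orthogonalProjectionOnto).clm_comp V.subtypeL
      exact hP.clm_comp (J.adjoint ∘L J)
    · rw [dist_eq_norm]
      refine lt_of_le_of_lt (b := ε / 2) ?_ (by linarith)
      refine ContinuousLinearMap.opNorm_le_bound _ (by positivity) fun x => ?_
      have h1 : (J.adjoint ∘L J - (J.adjoint ∘L J) ∘L V.starProjection) x =
          J.adjoint (J (x - V.starProjection x)) := by simp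
      rw [h1]
      have h2 := hVJ _ (Submodule.sub_starProjection_mem_orthogonal (K := V) x)
      have h3 : ‖x - V.starProjection x‖ ≤ ‖x‖ := by
        have := V.norm_sq_eq_add_norm_sq_starProjection x
        have h4 : Vᗮ.starProjection x = x - V.starProjection x :=
          Submodule.starProjection_orthogonal_val x
        rw [h4] at this
        nlinarith [norm_nonneg x, norm_nonneg (x - V.starProjection x),
          sq_nonneg ‖V.starProjection x‖]
      calc ‖J.adjoint (J (x - V.starProjection x))‖
          ≤ ‖J.adjoint‖ * ‖J (x - V.starProjection x)‖ := ContinuousLinearMap.le_opNorm _ _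
        _ ≤ ‖J‖ * (ε / 2 / (‖J‖ + 1) * ‖x‖) := by
            rw [LinearIsometryEquiv.norm_map]
            gcongr
            exact h2.trans (by gcongr)
        _ = (‖J‖ / (‖J‖ + 1)) * (ε / 2 * ‖x‖) := by field_simp
        _ ≤ 1 * (ε / 2 * ‖x‖) := by
            gcongr
            rw [div_le_one hden]; linarith
        _ = ε / 2 * ‖x‖ := one_mul _
  rwa [hcl.closure_eq] at hmem


theorem inner_adjoint_comp_left (J : H →L[ℂ] K) (x y : H) :
    inner ℂ ((J.adjoint ∘L J) x) y = inner ℂ (J x) (J y) := by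
  simp [ContinuousLinearMap.adjoint_inner_left]

/-- A maximizing sequence for `‖J x‖` on the unit ball of `V` consists of approximate eigenvectors
for `t²`, where `t` is the norm of `J` on `V`, and compactness extracts a limit. If `J` vanishes on
`V`, the zero vector is returned, so that the deflation below can run forever, also in finite
dimension. -/
theorem exists_maximal_eigenvector {J : H →L[ℂ] K} (hJ : IsCompactOperator (J.adjoint ∘L J))
    (V : Submodule ℂ H) (hVc : IsClosed (V : Set H))
    (hV : ∀ x ∈ V, (J.adjoint ∘L J) x ∈ V) :
    ∃ x ∈ V, ∃ s : ℝ, 0 ≤ s ∧ (J.adjoint ∘L J) x = (s : ℂ) • x ∧ (s ≠ 0 → ‖x‖ = 1) ∧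
      (s = 0 → x = 0) ∧ ∀ y ∈ V, ‖J y‖ ^ 2 ≤ s * ‖y‖ ^ 2 := by
  set T := J.adjoint ∘L J with hT
  set t := ‖J ∘L V.subtypeL‖ with ht
  have hle : ∀ y ∈ V, ‖J y‖ ≤ t * ‖y‖ := fun y hy => by
    have := (J ∘L V.subtypeL).le_opNorm ⟨y, hy⟩
    simpa using this
  have ht0 : 0 ≤ t := by positivity
  by_cases htz : t = 0
  · refine ⟨0, V.zero_mem, 0, le_rfl, by simp, by simp, by simp, fun y hy => ?_⟩
    have := hle y hy
    rw [htz, zero_mul] at this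
    have h0 : ‖J y‖ = 0 := le_antisymm this (norm_nonneg _)
    simp [h0]
  have htp : 0 < t := lt_of_le_of_ne ht0 (Ne.symm htz)
  have hseq : ∀ n : ℕ, ∃ x : V, ‖x‖ < 1 ∧ t - 1 / ((n : ℝ) + 1) < ‖J x‖ := fun n => by
    obtain ⟨x, hx, hx'⟩ := ContinuousLinearMap.exists_lt_apply_of_lt_opNorm (J ∘L V.subtypeL)
      (r := t - 1 / ((n : ℝ) + 1)) (by
        have : 0 < 1 / ((n : ℝ) + 1) := by positivity
        linarith)
    exact ⟨x, hx, hx'⟩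
  choose x hx1 hx2 using hseq
  obtain ⟨C, hC, hCT⟩ := hJ.image_closedBall_subset_compact 1
  have hmem : ∀ n, T (x n) ∈ C := fun n => hCT ⟨x n, by simpa using (hx1 n).le, rfl⟩
  obtain ⟨y, -, φ, hφ, hlim⟩ := hC.tendsto_subseq hmem
  have hJlim : Filter.Tendsto (fun n => ‖J (x n)‖) Filter.atTop (nhds t) := by
    refine tendsto_of_tendsto_of_tendsto_of_le_of_le (g := fun n : ℕ => t - 1 / ((n : ℝ) + 1))
      (h := fun _ => t) ?_ tendsto_const_nhds (fun n => (hx2 n).le) (fun n => ?_)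
    · simpa using tendsto_const_nhds.sub (tendsto_one_div_add_atTop_nhds_zero_nat (𝕜 := ℝ))
    · have := hle _ (x n).2
      have h1 : ‖(x n : H)‖ < 1 := hx1 n
      nlinarith
  -- Invariance of `V` allows the bound `t` to be used at `T z` as well: `‖T z‖² = ⟨J z, J T z⟩ ≤ t
  -- · t ‖T z‖`.
  have hTn : ∀ z ∈ V, ‖z‖ ≤ 1 → ‖T z‖ ≤ t ^ 2 := fun z hz hz1 => by
    have h1 : ‖T z‖ ^ 2 ≤ ‖J z‖ * ‖J (T z)‖ := by
      rw [← inner_self_eq_norm_sq (𝕜 := ℂ) (T z), hT, inner_adjoint_comp_left]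
      exact (Complex.re_le_norm _).trans (norm_inner_le_norm _ _)
    have h2 := hle _ (hV z hz)
    have h3 : ‖J z‖ ≤ t := (hle z hz).trans (by nlinarith)
    by_contra! hcon
    have h4 : ‖J z‖ * ‖J (T z)‖ ≤ t * (t * ‖T z‖) := by gcongr
    nlinarith [sq_nonneg t]
  -- Expanding the square gives `‖T x‖² - 2 t² ‖J x‖² + t⁴ ‖x‖²`, whose outer terms are at most
  -- `t⁴`.
  have hdiff : ∀ n, ‖T (x n) - ((t ^ 2 : ℝ) : ℂ) • (x n : H)‖ ^ 2 ≤
      2 * t ^ 2 * (t ^ 2 - ‖J (x n)‖ ^ 2) := fun n => by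
    have h1 : ‖(x n : H)‖ ≤ 1 := (hx1 n).le
    have h2 := hTn _ (x n).2 h1
    rw [norm_sub_sq (𝕜 := ℂ), inner_smul_right, hT, inner_adjoint_comp_left,
      inner_self_eq_norm_sq_to_K, norm_smul, ← hT]
    have h3 : RCLike.re (((t ^ 2 : ℝ) : ℂ) * ((‖J (x n)‖ : ℝ) : ℂ) ^ 2) =
        t ^ 2 * ‖J (x n)‖ ^ 2 := by
      rw [← Complex.ofReal_pow, ← Complex.ofReal_mul]
      exact Complex.ofReal_re _
    have h4 : ‖((t ^ 2 : ℝ) : ℂ)‖ = t ^ 2 := by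
      rw [Complex.norm_real, Real.norm_of_nonneg (sq_nonneg t)]
    have h3' : RCLike.re (((t ^ 2 : ℝ) : ℂ) * ((RCLike.ofReal ‖J (x n)‖ : ℂ)) ^ 2) =
        t ^ 2 * ‖J (x n)‖ ^ 2 := h3
    rw [h3', h4]
    have h5 : ‖T (x n)‖ ^ 2 ≤ (t ^ 2) ^ 2 := by gcongr
    have h6 : (t ^ 2 * ‖(x n : H)‖) ^ 2 ≤ (t ^ 2 * 1) ^ 2 := by gcongr
    nlinarith
  have hlim0 : Filter.Tendsto (fun n => T (x n) - ((t ^ 2 : ℝ) : ℂ) • (x n : H)) Filter.atTop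
      (nhds 0) := by
    rw [tendsto_zero_iff_norm_tendsto_zero]
    have h1 : Filter.Tendsto (fun n => 2 * t ^ 2 * (t ^ 2 - ‖J (x n)‖ ^ 2)) Filter.atTop
        (nhds 0) := by
      have := ((tendsto_const_nhds (x := t ^ 2)).sub (hJlim.pow 2)).const_mul (2 * t ^ 2)
      simpa using this
    have h2 := squeeze_zero (fun n => sq_nonneg _) hdiff h1
    have h3 := h2.sqrt
    simpa [Real.sqrt_sq] using h3
  have ht2 : ((t ^ 2 : ℝ) : ℂ) ≠ 0 := by
    rw [Complex.ofReal_ne_zero]; positivity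
  set u : H := ((t ^ 2 : ℝ) : ℂ)⁻¹ • y with hu
  have hxu : Filter.Tendsto (fun n => (x (φ n) : H)) Filter.atTop (nhds u) := by
    have h1 := (hlim.sub (hlim0.comp hφ.tendsto_atTop)).const_smul (((t ^ 2 : ℝ) : ℂ)⁻¹)
    rw [sub_zero] at h1
    refine h1.congr fun n => ?_
    simp only [Function.comp_apply, sub_sub_cancel]
    rw [smul_smul, inv_mul_cancel₀ ht2, one_smul]
  have huV : u ∈ V := hVc.mem_of_tendsto hxu (Filter.Eventually.of_forall fun n => (x (φ n)).2)
  have hTu : T u = y := tendsto_nhds_unique ((T.continuous.tendsto u).comp hxu) hlim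
  have hJu : ‖J u‖ = t :=
    tendsto_nhds_unique ((J.continuous.norm.tendsto u).comp hxu) (hJlim.comp hφ.tendsto_atTop)
  have hun : ‖u‖ = 1 := by
    refine le_antisymm ?_ ?_
    · exact le_of_tendsto hxu.norm (Filter.Eventually.of_forall fun n => (hx1 (φ n)).le)
    · have := hle u huV
      rw [hJu] at this
      by_contra! hcon
      nlinarith
  refine ⟨u, huV, t ^ 2, sq_nonneg t, ?_, fun _ => hun, fun h => ?_, fun z hz => ?_⟩
  · rw [hTu, hu, smul_smul, mul_inv_cancel₀ ht2, one_smul]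
  · exact absurd h (by positivity)
  · rw [← mul_pow]
    exact pow_le_pow_left₀ (norm_nonneg _) (hle z hz) 2

end Operators

end WeightedFock

namespace WeightedFock

/-! ### Canonical decomposition of `J† J` by deflation -/

section SingularValues

variable {H K : Type*} [NormedAddCommGroup H] [InnerProductSpace ℂ H]
  [NormedAddCommGroup K] [InnerProductSpace ℂ K]

/-- A decreasing sequence of invariant subspaces, each one obtained from its predecessor by
removing the direction `x V`. -/
noncomputable def deflation (x : Submodule ℂ H → H) : ℕ → Submodule ℂ H
  | 0 => ⊤
  | n + 1 => deflation x n ⊓ (ℂ ∙ x (deflation x n))ᗮ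

theorem inner_sum_smul_eq_zero {e : ℕ → H} (he : ∀ i j, i ≠ j → inner ℂ (e i) (e j) = 0)
    (F : Finset ℕ) {i : ℕ} (hi : i ∉ F) (c : ℕ → ℂ) :
    inner ℂ (e i) (∑ j ∈ F, c j • e j) = 0 := by
  rw [inner_sum]
  refine Finset.sum_eq_zero fun j hj => ?_
  rw [inner_smul_right, he i j (fun h => hi (h ▸ hj)), mul_zero]

/-- The `e i` are unit vectors or zero, as in an eigenvector sequence padded with zeros; removing
one component at a time never increases the norm. -/
theorem norm_sub_sum_le {e : ℕ → H} (he : ∀ i j, i ≠ j → inner ℂ (e i) (e j) = 0)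
    (hn : ∀ i, e i ≠ 0 → ‖e i‖ = 1) (x : H) (F : Finset ℕ) :
    ‖x - ∑ j ∈ F, inner ℂ (e j) x • e j‖ ≤ ‖x‖ := by
  classical
  induction F using Finset.induction_on with
  | empty => simp
  | insert i F hi ih =>
    refine le_trans ?_ ih
    set y := x - ∑ j ∈ F, inner ℂ (e j) x • e j with hy
    have h1 : inner ℂ (e i) y = inner ℂ (e i) x := by
      rw [hy, inner_sub_right, inner_sum_smul_eq_zero he F hi, sub_zero]
    have h2 : x - ∑ j ∈ insert i F, inner ℂ (e j) x • e j = y - inner ℂ (e i) y • e i := by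
      rw [Finset.sum_insert hi, h1, hy]; abel
    rw [h2]
    by_cases h0 : e i = 0
    · simp [h0]
    have h3 := hn i h0
    have h4 : ‖y - inner ℂ (e i) y • e i‖ ^ 2 = ‖y‖ ^ 2 - ‖inner ℂ (e i) y‖ ^ 2 := by
      rw [norm_sub_sq (𝕜 := ℂ), inner_smul_right, norm_smul, h3,
        ← inner_conj_symm y (e i)]
      have : RCLike.re (inner ℂ (e i) y * conj (inner ℂ (e i) y)) = ‖inner ℂ (e i) y‖ ^ 2 := by
        rw [RCLike.mul_conj, ← RCLike.ofReal_pow]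
        exact RCLike.ofReal_re _
      rw [this]
      ring
    refine le_of_sq_le_sq ?_ (norm_nonneg _)
    rw [h4]
    nlinarith [sq_nonneg ‖inner ℂ (e i) y‖]

variable [CompleteSpace H] [CompleteSpace K]

/-- Successive extremal eigenvectors give both orthonormal systems at once, since `J† J` is
positive. Their eigenvalues are the diagonal entries `‖J e_n‖²`, so the hypothesis bounds the sum of
their powers; extremality on `V n` bounds the remainder of the expansion. -/
theorem DiagonalSumLE.exists_isSingularValueSeq {J : H →L[ℂ] K} {p : ℝ} {M : ℝ≥0∞}
    (h : DiagonalSumLE J p M) (hp : 0 < p) (hM : M ≠ ∞) :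
    ∃ s, IsSingularValueSeq (J.adjoint ∘L J) s ∧ ∑' n, ENNReal.ofReal (s n) ^ p ≤ M := by
  classical
  have hmax := exists_maximal_eigenvector (h.isCompactOperator hp hM)
  set T := J.adjoint ∘L J with hT
  choose! x hxV s hs0 hTx hx1 hx0 hsup using hmax
  set V := deflation x with hVdef
  have hVsucc : ∀ n, V (n + 1) = V n ⊓ (ℂ ∙ x (V n))ᗮ := fun n => rfl
  have hinv : ∀ n, IsClosed (V n : Set H) ∧ ∀ y ∈ V n, T y ∈ V n := by
    intro n
    induction n with
    | zero => exact ⟨isClosed_univ, fun y _ => Submodule.mem_top⟩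
    | succ n ih =>
      refine ⟨?_, fun y hy => ?_⟩
      · rw [hVsucc]
        exact ih.1.inter (Submodule.isClosed_orthogonal _)
      · rw [hVsucc] at hy ⊢
        refine ⟨ih.2 y hy.1, ?_⟩
        rw [SetLike.mem_coe, Submodule.mem_orthogonal_singleton_iff_inner_right]
        have h1 := (Submodule.mem_orthogonal_singleton_iff_inner_right).1 hy.2
        have h2 : inner ℂ (x (V n)) (T y) = inner ℂ (T (x (V n))) y := by
          rw [hT, inner_adjoint_comp_left, ContinuousLinearMap.comp_apply,
            ContinuousLinearMap.adjoint_inner_right]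
        rw [h2, hTx _ ih.1 ih.2, inner_smul_left, h1, mul_zero]
  set e : ℕ → H := fun n => x (V n) with he
  set t : ℕ → ℝ := fun n => s (V n) with ht
  have heV : ∀ n, e n ∈ V n := fun n => hxV _ (hinv n).1 (hinv n).2
  have ht0 : ∀ n, 0 ≤ t n := fun n => hs0 _ (hinv n).1 (hinv n).2
  have hTe : ∀ n, T (e n) = (t n : ℂ) • e n := fun n => hTx _ (hinv n).1 (hinv n).2
  have he1 : ∀ n, t n ≠ 0 → ‖e n‖ = 1 := fun n => hx1 _ (hinv n).1 (hinv n).2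
  have he0 : ∀ n, t n = 0 → e n = 0 := fun n => hx0 _ (hinv n).1 (hinv n).2
  have hsupn : ∀ n, ∀ y ∈ V n, ‖J y‖ ^ 2 ≤ t n * ‖y‖ ^ 2 := fun n =>
    hsup _ (hinv n).1 (hinv n).2
  have hanti : Antitone V := antitone_nat_of_succ_le fun n => by
    rw [hVsucc]; exact inf_le_left
  have horth : ∀ i j, i < j → inner ℂ (e i) (e j) = 0 := fun i j hij => by
    have h1 : e j ∈ V (i + 1) := hanti hij (heV j)
    rw [hVsucc] at h1
    exact (Submodule.mem_orthogonal_singleton_iff_inner_right).1 h1.2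
  have horth' : ∀ i j, i ≠ j → inner ℂ (e i) (e j) = 0 := fun i j hij => by
    rcases lt_or_gt_of_ne hij with h1 | h1
    · exact horth i j h1
    · exact inner_eq_zero_symm.1 (horth j i h1)
  have hJe : ∀ n, ‖J (e n)‖ ^ 2 = t n := fun n => by
    have h1 : inner ℂ (T (e n)) (e n) = inner ℂ (J (e n)) (J (e n)) :=
      inner_adjoint_comp_left J _ _
    rw [hTe, inner_smul_left, inner_self_eq_norm_sq_to_K, inner_self_eq_norm_sq_to_K] at h1
    by_cases h0 : t n = 0
    · rw [h0, he0 n h0]; simp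
    · rw [he1 n h0] at h1
      simp only [Complex.conj_ofReal] at h1
      have h2 : ((t n : ℝ) : ℂ) = ((‖J (e n)‖ ^ 2 : ℝ) : ℂ) := by
        simpa using h1
      exact (Complex.ofReal_injective h2).symm
  have htanti : Antitone t := antitone_nat_of_succ_le fun n => by
    by_cases h0 : t (n + 1) = 0
    · rw [h0]; exact ht0 n
    · have h1 := hsupn n (e (n + 1)) (hanti (Nat.le_succ n) (heV (n + 1)))
      rw [hJe, he1 _ h0] at h1
      simpa using h1
  have honb : Orthonormal ℂ (fun n : {n // t n ≠ 0} => e n) :=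
    ⟨fun n => he1 _ n.2, fun i j hij => horth' _ _ fun h => hij (Subtype.ext h)⟩
  have hsum : ∑' n, ENNReal.ofReal (t n) ^ p ≤ M := by
    rw [ENNReal.tsum_eq_iSup_sum]
    refine iSup_le fun F => ?_
    -- Only the indices with `t n ≠ 0` carry unit vectors; the others contribute zero because `p >
    -- 0`.
    set G := F.filter fun n => t n ≠ 0 with hG
    have h1 : ∑ n ∈ F, ENNReal.ofReal (t n) ^ p = ∑ n ∈ G, ENNReal.ofReal (t n) ^ p := by
      rw [hG]
      symm
      apply Finset.sum_filter_of_ne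
      intro n _ hn h0
      rw [h0, ENNReal.ofReal_zero, ENNReal.zero_rpow_of_pos hp] at hn
      exact hn rfl
    have hGt : ∀ n : G, t n ≠ 0 := fun n => (Finset.mem_filter.1 n.2).2
    have h2 := h G (fun n => e n) (honb.comp (fun n : G => ⟨n.1, hGt n⟩) fun a b hab =>
      Subtype.ext (congrArg (fun z : {n // t n ≠ 0} => z.1) hab))
    simp only [hJe] at h2
    rw [h1, ← Finset.sum_coe_sort G]
    exact h2
  have hlim : Filter.Tendsto t Filter.atTop (nhds 0) := by
    have h1 := ENNReal.tendsto_atTop_zero_of_tsum_ne_top (ne_top_of_le_ne_top hM hsum)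
    have h2 := h1.ennrpow_const (1 / p)
    rw [ENNReal.zero_rpow_of_pos (by positivity)] at h2
    have h3 : ∀ n, (ENNReal.ofReal (t n) ^ p) ^ (1 / p) = ENNReal.ofReal (t n) := fun n => by
      rw [← ENNReal.rpow_mul, mul_one_div_cancel hp.ne', ENNReal.rpow_one]
    simp only [h3] at h2
    have h4 := (ENNReal.tendsto_toReal ENNReal.zero_ne_top).comp h2
    refine h4.congr fun n => ?_
    simp [ENNReal.toReal_ofReal (ht0 n)]
  have hne : ∀ i, e i ≠ 0 → ‖e i‖ = 1 := fun i hi => he1 i fun h => hi (he0 i h)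
  have hself : ∀ i y, inner ℂ (e i) (y - inner ℂ (e i) y • e i) = 0 := fun i y => by
    rw [inner_sub_right, inner_smul_right, inner_self_eq_norm_sq_to_K]
    by_cases h0 : e i = 0
    · simp [h0]
    · rw [hne i h0]; simp
  -- Allowing every finite `F ⊇ range n`, not only initial segments, is what unconditional summation
  -- requires.
  have hres : ∀ n (F : Finset ℕ), Finset.range n ⊆ F → ∀ y : H,
      y - ∑ j ∈ F, inner ℂ (e j) y • e j ∈ V n := by
    intro n
    induction n with
    | zero => exact fun _ _ _ => Submodule.mem_top
    | succ n ih =>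
      intro F hF y
      rw [hVsucc]
      refine ⟨ih F ((Finset.range_mono (Nat.le_succ n)).trans hF) y, ?_⟩
      rw [SetLike.mem_coe, Submodule.mem_orthogonal_singleton_iff_inner_right]
      have hnF : n ∈ F := hF (by simp)
      change inner ℂ (e n) _ = 0
      rw [← Finset.add_sum_erase F _ hnF, ← sub_sub, inner_sub_right, hself,
        inner_sum_smul_eq_zero horth' _ (Finset.notMem_erase n F), sub_zero]
  refine ⟨t, ⟨htanti, ht0, hlim, e, e, honb, honb, fun y => ?_⟩, hsum⟩
  rw [HasSum, SummationFilter.unconditional_filter, Metric.tendsto_atTop]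
  intro ε hε
  have hb : Filter.Tendsto (fun n => ‖J‖ * (Real.sqrt (t n) * ‖y‖)) Filter.atTop (nhds 0) := by
    have := ((hlim.sqrt).mul_const ‖y‖).const_mul ‖J‖
    simpa using this
  obtain ⟨n, hn⟩ := (hb.eventually (gt_mem_nhds hε)).exists
  refine ⟨Finset.range n, fun F hF => ?_⟩
  refine lt_of_le_of_lt ?_ hn
  have h1 : T y - ∑ j ∈ F, ((t j : ℂ) * inner ℂ (e j) y) • e j =
      T (y - ∑ j ∈ F, inner ℂ (e j) y • e j) := by
    rw [map_sub, map_sum]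
    congr 1
    refine Finset.sum_congr rfl fun j _ => ?_
    rw [map_smul, hTe, smul_smul, mul_comm]
  rw [dist_comm, dist_eq_norm, h1]
  set z := y - ∑ j ∈ F, inner ℂ (e j) y • e j with hz
  have h2 := hsupn n z (hres n F hF y)
  have h3 : ‖z‖ ≤ ‖y‖ := norm_sub_sum_le horth' hne y F
  have h4 : ‖J z‖ ≤ Real.sqrt (t n) * ‖y‖ := by
    refine le_of_sq_le_sq ?_ (by positivity)
    rw [mul_pow, Real.sq_sqrt (ht0 n)]
    exact h2.trans (mul_le_mul_of_nonneg_left (by gcongr) (ht0 n))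
  calc ‖T z‖ ≤ ‖J.adjoint‖ * ‖J z‖ := J.adjoint.le_opNorm _
    _ ≤ ‖J‖ * (Real.sqrt (t n) * ‖y‖) := by
      rw [LinearIsometryEquiv.norm_map]; gcongr

end SingularValues

end WeightedFock

namespace WeightedFock

/-! ### Absolute continuity of `A^res_∞` weights on squares -/

section Weights

theorem square_subset_closedBall (c : ℂ) (r : ℝ) :
    square c r ⊆ Metric.closedBall c r := by
  intro z hz
  rw [Metric.mem_closedBall, dist_eq_norm]
  refine (Complex.norm_le_abs_re_add_abs_im _).trans ?_
  have h1 := hz.1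
  have h2 := hz.2
  simp only [Complex.sub_re, Complex.sub_im]
  linarith

theorem ball_subset_square (c : ℂ) (r : ℝ) : Metric.ball c (r / 2) ⊆ square c r := by
  intro z hz
  rw [Metric.mem_ball, dist_eq_norm] at hz
  have h1 := Complex.abs_re_le_norm (z - c)
  have h2 := Complex.abs_im_le_norm (z - c)
  simp only [Complex.sub_re, Complex.sub_im] at h1 h2
  exact ⟨by linarith, by linarith⟩

theorem measurableSet_square (c : ℂ) (r : ℝ) : MeasurableSet (square c r) := by
  refine IsClosed.measurableSet ?_
  have h1 : IsClosed {z : ℂ | |z.re - c.re| ≤ r / 2} := isClosed_le (by fun_prop) (by fun_prop)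
  have h2 : IsClosed {z : ℂ | |z.im - c.im| ≤ r / 2} := isClosed_le (by fun_prop) (by fun_prop)
  exact h1.inter h2

theorem volume_square_le (c : ℂ) (r : ℝ) :
    volume (square c r) ≤ volume (Metric.closedBall (0 : ℂ) r) := by
  refine (measure_mono (square_subset_closedBall c r)).trans ?_
  rw [Complex.volume_closedBall, Complex.volume_closedBall]

theorem volume_square_ne_top (c : ℂ) (r : ℝ) : volume (square c r) ≠ ∞ :=
  ne_top_of_le_ne_top measure_closedBall_lt_top.ne (volume_square_le c r)

theorem volume_square_ne_zero (c : ℂ) {r : ℝ} (hr : 0 < r) : volume (square c r) ≠ 0 := by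
  have h1 : 0 < volume (Metric.ball c (r / 2)) := Metric.measure_ball_pos _ _ (by positivity)
  exact (h1.trans_le (measure_mono (ball_subset_square c r))).ne'

variable {w : ℂ → ℝ}

theorem IsWeight.aemeasurable (hw : IsWeight w) :
    AEMeasurable (fun z => ENNReal.ofReal (w z)) volume :=
  hw.locallyIntegrable.aestronglyMeasurable.aemeasurable.ennreal_ofReal

theorem weightMeasure_apply (w : ℂ → ℝ) {E : Set ℂ} (hE : MeasurableSet E) :
    weightMeasure w E = ∫⁻ z in E, ENNReal.ofReal (w z) :=
  withDensity_apply _ hE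

theorem mul_le_of_div_mul_div_le {a b q q' K : ℝ≥0∞} (hq : q ≠ 0) (hq' : q' ≠ 0)
    (hqt : q ≠ ∞) (hqt' : q' ≠ ∞) (h : a / q * (b / q') ≤ K) : a * b ≤ K * (q * q') := by
  calc a * b = (a / q * q) * (b / q' * q') := by
        rw [ENNReal.div_mul_cancel hq hqt, ENNReal.div_mul_cancel hq' hqt']
    _ = (a / q * (b / q')) * (q * q') := by ring
    _ ≤ K * (q * q') := by gcongr

/-- The quantitative absolute continuity of a weight on the squares of a fixed size. -/
theorem exists_square_bound_of_mem_AResOne (hw : w ∈ AResOne) :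
    ∃ R : ℝ, 0 < R ∧ ∃ (N : ℕ) (C : ℝ≥0∞), C ≠ ∞ ∧ ∀ c, ∀ E ⊆ square c R, MeasurableSet E →
      weightMeasure w (square c R) * volume E ^ N ≤ C * weightMeasure w E := by
  obtain ⟨hw, R, hR, hK⟩ := hw
  set K := ⨆ c : ℂ, squareAverage c R (fun z => ENNReal.ofReal (w z)) *
      essSup (fun z => (ENNReal.ofReal (w z))⁻¹) (volume.restrict (square c R)) with hKdef
  refine ⟨R, hR, 1, K * volume (Metric.closedBall (0 : ℂ) R),
    ENNReal.mul_ne_top hK.ne measure_closedBall_lt_top.ne, fun c E hE hEm => ?_⟩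
  have h1 : squareAverage c R (fun z => ENNReal.ofReal (w z)) *
      essSup (fun z => (ENNReal.ofReal (w z))⁻¹) (volume.restrict (square c R)) ≤ K :=
    le_iSup (fun c : ℂ => squareAverage c R (fun z => ENNReal.ofReal (w z)) *
      essSup (fun z => (ENNReal.ofReal (w z))⁻¹) (volume.restrict (square c R))) c
  set L := essSup (fun z => (ENNReal.ofReal (w z))⁻¹) (volume.restrict (square c R)) with hL
  rw [squareAverage, ← weightMeasure_apply w (measurableSet_square c R)] at h1
  set a := weightMeasure w (square c R) with ha
  by_cases ha0 : a = 0
  · simp [ha0]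
  have hq := volume_square_ne_zero c hR
  have hqt := volume_square_ne_top c R
  have h2 : a * L ≤ K * volume (Metric.closedBall (0 : ℂ) R) := by
    have := mul_le_of_div_mul_div_le (b := L) hq one_ne_zero hqt ENNReal.one_ne_top
      (by simpa using h1)
    rw [mul_one] at this
    exact this.trans (mul_le_mul_right (volume_square_le c R) K)
  have hLt : L ≠ ∞ := fun h => by
    rw [h, ENNReal.mul_top ha0, top_le_iff] at h2
    exact ENNReal.mul_ne_top hK.ne measure_closedBall_lt_top.ne h2
  -- As `L` is finite, `1 ≤ L w` almost everywhere on `E`; integration yields `A(E) ≤ L w(E)`, and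
  -- `w(Q) L` is bounded.
  have h3 : ∀ᵐ z ∂(volume.restrict E), (1 : ℝ≥0∞) ≤ L * ENNReal.ofReal (w z) := by
    have h4 : ∀ᵐ z ∂(volume.restrict (square c R)), (ENNReal.ofReal (w z))⁻¹ ≤ L :=
      ENNReal.ae_le_essSup _
    filter_upwards [ae_restrict_of_ae_restrict_of_subset hE h4] with z hz
    by_cases hz0 : ENNReal.ofReal (w z) = 0
    · rw [hz0, ENNReal.inv_zero, top_le_iff] at hz
      exact absurd hz hLt
    · calc (1 : ℝ≥0∞) = (ENNReal.ofReal (w z))⁻¹ * ENNReal.ofReal (w z) :=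
          (ENNReal.inv_mul_cancel hz0 ENNReal.ofReal_ne_top).symm
        _ ≤ L * ENNReal.ofReal (w z) := by gcongr
  have h5 : volume E ≤ L * weightMeasure w E := by
    rw [weightMeasure_apply w hEm, ← lintegral_const_mul' _ _ hLt]
    calc volume E = ∫⁻ _ in E, 1 := by simp
      _ ≤ _ := lintegral_mono_ae h3
  calc a * volume E ^ 1 ≤ a * (L * weightMeasure w E) := by rw [pow_one]; gcongr
    _ = a * L * weightMeasure w E := by ring
    _ ≤ _ := by gcongr

/-- Hölder's inequality for `1 = w^{1/p} w^{-1/p}` on `E` gives `A(E)^p ≤ w(E) (∫_Q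
w^{-p'/p})^{p/p'}`, and the weight condition controls the last factor times `w(Q)`. The exponent is
rounded up to `N = ⌈p⌉`, at the cost of a power of the bound `B` for `A(E)`. -/
theorem exists_square_bound_of_mem_ARes {p : ℝ} (hp : 1 < p) (hw : w ∈ ARes p) :
    ∃ R : ℝ, 0 < R ∧ ∃ (N : ℕ) (C : ℝ≥0∞), C ≠ ∞ ∧ ∀ c, ∀ E ⊆ square c R, MeasurableSet E →
      weightMeasure w (square c R) * volume E ^ N ≤ C * weightMeasure w E := by
  obtain ⟨hw, R, hR, hK⟩ := hw
  set q := p.conjExponent with hqdef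
  have hpq : p.HolderConjugate q := Real.HolderConjugate.conjExponent hp
  have hp0 : 0 < p := hpq.pos
  have hq0 : 0 < q := hpq.symm.pos
  have hr : 0 < p / q := by positivity
  set K := ⨆ c : ℂ, squareAverage c R (fun z => ENNReal.ofReal (w z)) *
      squareAverage c R (fun z => ENNReal.ofReal (w z) ^ (-(q / p))) ^ (p / q) with hKdef
  set B := volume (Metric.closedBall (0 : ℂ) R) with hB
  have hBt : B ≠ ∞ := measure_closedBall_lt_top.ne
  set N := ⌈p⌉₊ with hN
  have hNp : 0 ≤ (N : ℝ) - p := sub_nonneg.2 (Nat.le_ceil p)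
  set C := K * (B * B ^ (p / q)) with hC
  have hCt : C ≠ ∞ := ENNReal.mul_ne_top hK.ne
    (ENNReal.mul_ne_top hBt (ENNReal.rpow_ne_top_of_nonneg hr.le hBt))
  refine ⟨R, hR, N, C * B ^ ((N : ℝ) - p), ENNReal.mul_ne_top hCt
    (ENNReal.rpow_ne_top_of_nonneg hNp hBt), fun c E hE hEm => ?_⟩
  have h1 : squareAverage c R (fun z => ENNReal.ofReal (w z)) *
      squareAverage c R (fun z => ENNReal.ofReal (w z) ^ (-(q / p))) ^ (p / q) ≤ K :=
    le_iSup (fun c : ℂ => squareAverage c R (fun z => ENNReal.ofReal (w z)) *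
      squareAverage c R (fun z => ENNReal.ofReal (w z) ^ (-(q / p))) ^ (p / q)) c
  rw [squareAverage, squareAverage, ← weightMeasure_apply w (measurableSet_square c R)] at h1
  set a := weightMeasure w (square c R) with ha
  set b := ∫⁻ z in square c R, ENNReal.ofReal (w z) ^ (-(q / p)) with hb
  by_cases ha0 : a = 0
  · simp [ha0]
  have hv := volume_square_ne_zero c hR
  have hvt := volume_square_ne_top c R
  have hvB : volume (square c R) ≤ B := volume_square_le c R
  have h2 : a * b ^ (p / q) ≤ C := by
    rw [ENNReal.div_rpow_of_nonneg _ _ hr.le] at h1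
    refine (mul_le_of_div_mul_div_le hv ?_ hvt ?_ h1).trans ?_
    · exact (ENNReal.rpow_pos (pos_iff_ne_zero.2 hv) hvt).ne'
    · exact ENNReal.rpow_ne_top_of_nonneg hr.le hvt
    · rw [hC]; gcongr
  have hbt : b ≠ ∞ := fun h => by
    rw [h, ENNReal.top_rpow_of_pos hr, ENNReal.mul_top ha0, top_le_iff] at h2
    exact hCt h2
  have hmeas : AEMeasurable (fun z => ENNReal.ofReal (w z)) (volume.restrict E) :=
    hw.aemeasurable.restrict
  -- The negative power is `∞` where `w` vanishes, so finiteness of `b` makes `w` positive almost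
  -- everywhere on the square.
  have hpos : ∀ᵐ z ∂(volume.restrict E), ENNReal.ofReal (w z) ≠ 0 := by
    have h4 : ∀ᵐ z ∂(volume.restrict (square c R)), ENNReal.ofReal (w z) ^ (-(q / p)) < ∞ :=
      ae_lt_top' (hw.aemeasurable.restrict.pow_const _) hbt
    filter_upwards [ae_restrict_of_ae_restrict_of_subset hE h4] with z hz h0
    rw [h0, ENNReal.zero_rpow_of_neg (by rw [neg_lt_zero]; positivity)] at hz
    exact lt_irrefl _ hz
  have h5 : volume E ≤ weightMeasure w E ^ (1 / p) * b ^ (1 / q) := by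
    have h6 : ∀ᵐ z ∂(volume.restrict E), (1 : ℝ≥0∞) =
        ((fun z => ENNReal.ofReal (w z) ^ (1 / p)) * fun z => ENNReal.ofReal (w z) ^ (-(1 / p))) z := by
      filter_upwards [hpos] with z hz
      rw [Pi.mul_apply, ← ENNReal.rpow_add _ _ hz ENNReal.ofReal_ne_top, add_neg_cancel,
        ENNReal.rpow_zero]
    calc volume E = ∫⁻ _ in E, 1 := by simp
      _ = _ := lintegral_congr_ae h6
      _ ≤ _ := ENNReal.lintegral_mul_le_Lp_mul_Lq _ hpq (hmeas.pow_const _) (hmeas.pow_const _)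
      _ ≤ _ := by
        gcongr
        · rw [weightMeasure_apply w hEm]
          refine lintegral_mono fun z => ?_
          rw [← ENNReal.rpow_mul, one_div_mul_cancel hp0.ne', ENNReal.rpow_one]
        · rw [hb]
          refine (lintegral_mono fun z => ?_).trans (lintegral_mono_set hE)
          rw [← ENNReal.rpow_mul]
          apply le_of_eq
          congr 1
          ring
  have h7 : volume E ^ p ≤ weightMeasure w E * b ^ (p / q) := by
    calc volume E ^ p ≤ (weightMeasure w E ^ (1 / p) * b ^ (1 / q)) ^ p := by gcongr
      _ = _ := by
        rw [ENNReal.mul_rpow_of_nonneg _ _ hp0.le, ← ENNReal.rpow_mul, ← ENNReal.rpow_mul,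
          one_div_mul_cancel hp0.ne', ENNReal.rpow_one]
        congr 2
        ring
  have h8 : volume E ^ N ≤ volume E ^ p * B ^ ((N : ℝ) - p) := by
    have hEB : volume E ≤ B := (measure_mono hE).trans hvB
    calc volume E ^ N = volume E ^ (p + ((N : ℝ) - p)) := by
          rw [add_sub_cancel, ENNReal.rpow_natCast]
      _ = volume E ^ p * volume E ^ ((N : ℝ) - p) := ENNReal.rpow_add_of_nonneg _ _ hp0.le hNp
      _ ≤ _ := by gcongr
  calc a * volume E ^ N ≤ a * ((weightMeasure w E * b ^ (p / q)) * B ^ ((N : ℝ) - p)) := by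
        gcongr
        exact h8.trans (by gcongr)
    _ = (a * b ^ (p / q)) * B ^ ((N : ℝ) - p) * weightMeasure w E := by ring
    _ ≤ _ := by gcongr

theorem isWeight_of_mem_AResInfty (hw : w ∈ AResInfty) : IsWeight w := by
  rcases hw with hw | hw
  · exact hw.1
  · simp only [Set.mem_iUnion] at hw
    obtain ⟨p, _, hw⟩ := hw
    exact hw.1

theorem exists_square_bound (hw : w ∈ AResInfty) :
    ∃ R : ℝ, 0 < R ∧ ∃ (N : ℕ) (C : ℝ≥0∞), C ≠ ∞ ∧ ∀ c, ∀ E ⊆ square c R, MeasurableSet E →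
      weightMeasure w (square c R) * volume E ^ N ≤ C * weightMeasure w E := by
  rcases hw with hw | hw
  · exact exists_square_bound_of_mem_AResOne hw
  · simp only [Set.mem_iUnion] at hw
    obtain ⟨p, hp, hw⟩ := hw
    exact exists_square_bound_of_mem_ARes hp hw

theorem weightMeasure_ball_lt_top (hw : IsWeight w) (z : ℂ) (r : ℝ) :
    weightMeasure w (Metric.ball z r) < ∞ := by
  rw [weightMeasure_apply w measurableSet_ball]
  have h1 : IntegrableOn w (Metric.closedBall z r) volume :=
    hw.locallyIntegrable.integrableOn_isCompact (isCompact_closedBall z r)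
  have h2 := (h1.mono_set Metric.ball_subset_closedBall).hasFiniteIntegral
  refine lt_of_le_of_lt (lintegral_mono fun x => ?_) h2
  exact Real.ofReal_le_enorm (w x)

end Weights

end WeightedFock

/-! ### Local doubling of the measure `w dA` -/

namespace WeightedFock

/-- A measure on `ℂ` whose values on disks of a bounded size are comparable, with constants that
grow at most exponentially in the distance of the centres and polynomially in the ratio of the
radii. -/
structure LocallyDoubling (m : Measure ℂ) : Prop where
  pos : ∀ z : ℂ, ∀ r : ℝ, 0 < r → 0 < m (Metric.ball z r)
  lt_top : ∀ z : ℂ, ∀ r : ℝ, m (Metric.ball z r) < ∞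
  growth : ∃ M : ℝ, 0 ≤ M ∧ ∀ r : ℝ, 0 < r → ∀ s : ℝ, 0 < s → ∃ C : ℝ≥0, ∀ z ζ : ℂ,
    m (Metric.ball z r) ≤ C * ENNReal.ofReal (Real.exp (M * ‖z - ζ‖)) * m (Metric.ball ζ s)
  scale : ∃ N : ℕ, ∀ r : ℝ, 0 < r → ∃ C : ℝ≥0, ∀ z : ℂ, ∀ ζ ∈ Metric.ball z r, ∀ s : ℝ,
    0 < s → s ≤ r → m (Metric.ball z r) * ENNReal.ofReal s ^ N ≤ C * m (Metric.ball ζ s)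

section SquareBound

variable {m : Measure ℂ} {R : ℝ} {N : ℕ} {C : ℝ≥0∞}

/-- The hypothesis that the measure of a square of side length `R` is controlled by that of its
subsets. -/
def SquareBound (m : Measure ℂ) (R : ℝ) (N : ℕ) (C : ℝ≥0∞) : Prop :=
  ∀ c, ∀ E ⊆ square c R, MeasurableSet E → m (square c R) * volume E ^ N ≤ C * m E

theorem volume_ball_pow_ne_zero (c : ℂ) {s : ℝ} (hs : 0 < s) (N : ℕ) :
    volume (Metric.ball c s) ^ N ≠ 0 :=
  pow_ne_zero _ (Metric.measure_ball_pos volume c hs).ne'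

theorem volume_ball_pow_ne_top (c : ℂ) (s : ℝ) (N : ℕ) : volume (Metric.ball c s) ^ N ≠ ∞ :=
  ENNReal.pow_ne_top measure_ball_lt_top.ne

theorem volume_ball_eq (c : ℂ) (s : ℝ) :
    volume (Metric.ball c s) = volume (Metric.ball (0 : ℂ) s) := by
  rw [Complex.volume_ball, Complex.volume_ball]

/-- Both squares contain the disk `D(c', R/4)`, which carries a fixed proportion of the mass of the
first. -/
theorem SquareBound.exists_step (h : SquareBound m R N C) (hR : 0 < R) (hC : C ≠ ∞) :
    ∃ A : ℝ≥0, 1 ≤ A ∧ ∀ c c' : ℂ, ‖c - c'‖ ≤ R / 4 → m (square c R) ≤ A * m (square c' R) := by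
  set V := volume (Metric.ball (0 : ℂ) (R / 4)) ^ N with hV
  have hV0 : V ≠ 0 := volume_ball_pow_ne_zero _ (by positivity) _
  have hVt : V ≠ ∞ := volume_ball_pow_ne_top _ _ _
  refine ⟨max 1 (C / V).toNNReal, le_max_left _ _, fun c c' hcc => ?_⟩
  have hE : Metric.ball c' (R / 4) ⊆ square c R := by
    refine (Metric.ball_subset_ball' ?_).trans (ball_subset_square c R)
    rw [dist_comm, dist_eq_norm]; linarith
  have hE' : Metric.ball c' (R / 4) ⊆ square c' R :=
    (Metric.ball_subset_ball (by linarith)).trans (ball_subset_square c' R)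
  have h1 := h c _ hE measurableSet_ball
  rw [volume_ball_eq] at h1
  have h2 : m (square c R) ≤ C / V * m (square c' R) := by
    rw [← ENNReal.mul_div_right_comm, ENNReal.le_div_iff_mul_le (Or.inl hV0) (Or.inl hVt)]
    exact h1.trans (by gcongr)
  refine h2.trans ?_
  gcongr
  rw [← ENNReal.coe_toNNReal (ENNReal.div_ne_top hC hV0)]
  exact_mod_cast le_max_right _ _

/-- Going from `c` to `c'` takes about `4 ‖c - c'‖ / R` steps of length at most `R / 4`, each of
which costs a factor `A`. -/
theorem SquareBound.exists_exp (h : SquareBound m R N C) (hR : 0 < R) (hC : C ≠ ∞) :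
    ∃ (A : ℝ≥0) (M : ℝ), 0 ≤ M ∧ ∀ c c' : ℂ,
      m (square c R) ≤ A * ENNReal.ofReal (Real.exp (M * ‖c - c'‖)) * m (square c' R) := by
  obtain ⟨A, hA1, hA⟩ := h.exists_step hR hC
  have key : ∀ (n : ℕ) (c c' : ℂ), ‖c - c'‖ ≤ n * (R / 4) →
      m (square c R) ≤ (A : ℝ≥0∞) ^ n * m (square c' R) := by
    intro n
    induction n with
    | zero =>
      intro c c' hcc
      have : c = c' := by
        have h1 : ‖c - c'‖ ≤ 0 := by simpa using hcc
        exact sub_eq_zero.1 (norm_le_zero_iff.1 h1)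
      simp [this]
    | succ n ih =>
      intro c c' hcc
      push_cast at hcc
      have hn : (0 : ℝ) < n + 1 := by positivity
      -- One step out of `n + 1` equal ones along the segment; `n` steps of the same length remain.
      set d : ℂ := c + ((1 / ((n : ℝ) + 1) : ℝ) : ℂ) * (c' - c) with hd
      have h1 : ‖c - d‖ ≤ R / 4 := by
        have : c - d = ((1 / ((n : ℝ) + 1) : ℝ) : ℂ) * (c - c') := by rw [hd]; ring
        rw [this, norm_mul, Complex.norm_real, Real.norm_of_nonneg (by positivity),
          div_mul_eq_mul_div, one_mul, div_le_iff₀ hn]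
        linarith
      have h2 : ‖d - c'‖ ≤ n * (R / 4) := by
        have : d - c' = (((n : ℝ) / ((n : ℝ) + 1) : ℝ) : ℂ) * (c - c') := by
          have h3 : (((n : ℝ) / ((n : ℝ) + 1) : ℝ) : ℂ) = 1 - ((1 / ((n : ℝ) + 1) : ℝ) : ℂ) := by
            rw [← Complex.ofReal_one, ← Complex.ofReal_sub]
            congr 1
            field_simp
            ring
          rw [hd, h3]; ring
        rw [this, norm_mul, Complex.norm_real, Real.norm_of_nonneg (by positivity),
          div_mul_eq_mul_div, div_le_iff₀ hn]
        have := mul_le_mul_of_nonneg_left hcc (Nat.cast_nonneg (α := ℝ) n)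
        linarith
      calc m (square c R) ≤ A * m (square d R) := hA c d h1
        _ ≤ A * ((A : ℝ≥0∞) ^ n * m (square c' R)) := by gcongr; exact ih d c' h2
        _ = _ := by rw [pow_succ]; ring
  have hA0 : (0 : ℝ) < A := lt_of_lt_of_le one_pos (by exact_mod_cast hA1)
  have hA1' : (1 : ℝ) ≤ A := by exact_mod_cast hA1
  refine ⟨A, 4 * Real.log A / R, by have := Real.log_nonneg hA1'; positivity, fun c c' => ?_⟩
  set n := ⌈‖c - c'‖ / (R / 4)⌉₊ with hn
  have h1 : ‖c - c'‖ ≤ n * (R / 4) := by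
    rw [← div_le_iff₀ (by positivity)]; exact Nat.le_ceil _
  have h2 : (n : ℝ) ≤ 1 + ‖c - c'‖ / (R / 4) := by
    have := (Nat.ceil_lt_add_one (a := ‖c - c'‖ / (R / 4)) (by positivity)).le
    rwa [add_comm] at this
  refine (key n c c' h1).trans ?_
  gcongr
  have h3 : (A : ℝ) ^ n ≤ A * Real.exp (4 * Real.log A / R * ‖c - c'‖) := by
    calc (A : ℝ) ^ n = Real.exp (Real.log A * n) := by
          rw [← Real.rpow_natCast, Real.rpow_def_of_pos hA0]
      _ ≤ Real.exp (Real.log A + 4 * Real.log A / R * ‖c - c'‖) := by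
          apply Real.exp_le_exp.2
          calc Real.log A * n ≤ Real.log A * (1 + ‖c - c'‖ / (R / 4)) := by
                gcongr; exact Real.log_nonneg hA1'
            _ = _ := by field_simp
      _ = _ := by rw [Real.exp_add, Real.exp_log hA0]
  calc (A : ℝ≥0∞) ^ n = ENNReal.ofReal ((A : ℝ) ^ n) := by
        rw [ENNReal.ofReal_pow hA0.le, ENNReal.ofReal_coe_nnreal]
    _ ≤ ENNReal.ofReal (A * Real.exp (4 * Real.log A / R * ‖c - c'‖)) := by gcongr
    _ = _ := by rw [ENNReal.ofReal_mul hA0.le, ENNReal.ofReal_coe_nnreal]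

/-- Disks are covered by boundedly many squares for upper bounds, and small disks are inserted as
`E` in the square bound for lower bounds. -/
theorem SquareBound.locallyDoubling (h : SquareBound m R N C) (hR : 0 < R) (hC : C ≠ ∞)
    (hm : m ≠ 0) (hfin : ∀ z : ℂ, ∀ r : ℝ, m (Metric.ball z r) < ∞) : LocallyDoubling m := by
  obtain ⟨A, M, hM, hA⟩ := h.exists_exp hR hC
  have hlarge : ∀ r : ℝ, 0 < r → ∃ D : ℝ≥0, ∀ z ζ : ℂ,
      m (Metric.ball z r) ≤ D * ENNReal.ofReal (Real.exp (M * ‖z - ζ‖)) * m (square ζ R) := by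
    intro r hr
    -- A cover of the disk centred at `0` is translated to `z`, so that the number of squares does
    -- not depend on `z`.
    obtain ⟨t, ht, htf, hcov⟩ :=
      (isCompact_closedBall (0 : ℂ) r).finite_cover_balls (half_pos hR)
    refine ⟨htf.toFinset.card * (A * (Real.exp (M * r)).toNNReal), fun z ζ => ?_⟩
    have hsub : Metric.ball z r ⊆ ⋃ y ∈ htf.toFinset, square (z + y) R := by
      intro x hx
      have h1 : x - z ∈ Metric.closedBall (0 : ℂ) r := by
        rw [mem_closedBall_zero_iff, ← dist_eq_norm]; exact (Metric.mem_ball.1 hx).le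
      obtain ⟨y, hy, hxy⟩ := Set.mem_iUnion₂.1 (hcov h1)
      refine Set.mem_iUnion₂.2 ⟨y, htf.mem_toFinset.2 hy, ball_subset_square _ _ ?_⟩
      rw [Metric.mem_ball, dist_eq_norm]
      have h2 : dist (x - z) y < R / 2 := hxy
      rw [dist_eq_norm] at h2
      rwa [← sub_sub]
    calc m (Metric.ball z r) ≤ m (⋃ y ∈ htf.toFinset, square (z + y) R) := measure_mono hsub
      _ ≤ ∑ y ∈ htf.toFinset, m (square (z + y) R) := measure_biUnion_finset_le _ _
      _ ≤ ∑ y ∈ htf.toFinset, A * ENNReal.ofReal (Real.exp (M * r)) *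
            ENNReal.ofReal (Real.exp (M * ‖z - ζ‖)) * m (square ζ R) := by
          refine Finset.sum_le_sum fun y hy => (hA _ ζ).trans ?_
          rw [mul_assoc (A : ℝ≥0∞) (ENNReal.ofReal (Real.exp (M * r))), ← ENNReal.ofReal_mul (Real.exp_pos _).le, ← Real.exp_add]
          gcongr
          have h1 : ‖y‖ ≤ r := mem_closedBall_zero_iff.1 (ht (htf.mem_toFinset.1 hy))
          have h2 : ‖z + y - ζ‖ ≤ ‖z - ζ‖ + ‖y‖ := by
            rw [add_sub_right_comm]; exact norm_add_le _ _
          nlinarith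
      _ = _ := by
          rw [Finset.sum_const, nsmul_eq_mul]
          push_cast
          rw [ENNReal.ofReal]
          ring
  have hsmall : ∀ ζ : ℂ, ∀ s : ℝ, s ≤ R / 2 →
      m (square ζ R) * volume (Metric.ball ζ s) ^ N ≤ C * m (Metric.ball ζ s) := fun ζ s hs =>
    h ζ _ ((Metric.ball_subset_ball hs).trans (ball_subset_square ζ R)) measurableSet_ball
  have hgrowth : ∀ r : ℝ, 0 < r → ∀ s : ℝ, 0 < s → ∃ D : ℝ≥0, ∀ z ζ : ℂ,
      m (Metric.ball z r) ≤
        D * ENNReal.ofReal (Real.exp (M * ‖z - ζ‖)) * m (Metric.ball ζ s) := by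
    intro r hr s hs
    obtain ⟨D, hD⟩ := hlarge r hr
    set s' := min s (R / 2) with hs'
    have hs'0 : 0 < s' := lt_min hs (half_pos hR)
    set V := volume (Metric.ball (0 : ℂ) s') ^ N with hV
    have hV0 : V ≠ 0 := volume_ball_pow_ne_zero _ hs'0 _
    have hVt : V ≠ ∞ := volume_ball_pow_ne_top _ _ _
    refine ⟨D * (C / V).toNNReal, fun z ζ => (hD z ζ).trans ?_⟩
    have h1 := hsmall ζ s' (min_le_right _ _)
    rw [volume_ball_eq, ← ENNReal.le_div_iff_mul_le (Or.inl hV0) (Or.inl hVt),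
      ENNReal.mul_div_right_comm] at h1
    push_cast
    rw [ENNReal.coe_toNNReal (ENNReal.div_ne_top hC hV0)]
    calc (D : ℝ≥0∞) * ENNReal.ofReal (Real.exp (M * ‖z - ζ‖)) * m (square ζ R)
        ≤ D * ENNReal.ofReal (Real.exp (M * ‖z - ζ‖)) * (C / V * m (Metric.ball ζ s)) := by
          gcongr
          exact h1.trans (by gcongr; exact min_le_left _ _)
      _ = _ := by ring
  -- The exponent is `2 * N` because the area of a disk of radius `s` is at least `s²`. For
  -- positivity, a single null disk would by the growth bound make every disk null.
  refine ⟨fun z r hr => ?_, hfin, ⟨M, hM, hgrowth⟩, 2 * N, fun r hr => ?_⟩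
  · rw [pos_iff_ne_zero]
    intro h0
    refine hm (Measure.measure_univ_eq_zero.1 ?_)
    rw [← Metric.iUnion_ball_nat (0 : ℂ)]
    refine measure_iUnion_null fun n => ?_
    obtain ⟨D, hD⟩ := hgrowth (n + 1) (by positivity) r hr
    have h1 := hD 0 z
    rw [h0, mul_zero, nonpos_iff_eq_zero] at h1
    exact measure_mono_null (Metric.ball_subset_ball (by linarith)) h1
  · obtain ⟨D₁, hD₁⟩ := hlarge r hr
    obtain ⟨D₂, hD₂⟩ := hgrowth r hr (R / 2) (half_pos hR)
    set E := (Real.exp (M * r)).toNNReal with hE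
    have hexp : ∀ z : ℂ, ∀ ζ ∈ Metric.ball z r,
        ENNReal.ofReal (Real.exp (M * ‖z - ζ‖)) ≤ E := fun z ζ hζ => by
      rw [hE, ← ENNReal.ofReal]
      apply ENNReal.ofReal_le_ofReal
      rw [Real.exp_le_exp]
      have : ‖z - ζ‖ < r := by rw [← dist_eq_norm, dist_comm]; exact hζ
      gcongr
    refine ⟨D₁ * E * C.toNNReal + D₂ * E * r.toNNReal ^ (2 * N), fun z ζ hζ s hs hsr => ?_⟩
    push_cast
    have hEr : (r.toNNReal : ℝ≥0∞) = ENNReal.ofReal r := rfl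
    rw [add_mul, ENNReal.coe_toNNReal hC, hEr]
    -- A disk with `s ≤ R / 2` fits into a square of side `R`. Otherwise it contains `D(ζ, R/2)`,
    -- and bounding `s` by `r` suffices.
    rcases le_or_gt s (R / 2) with hsR | hsR
    · refine le_trans ?_ le_self_add
      have h1 : ENNReal.ofReal s ^ (2 * N) ≤ volume (Metric.ball ζ s) ^ N := by
        rw [pow_mul, Complex.volume_ball]
        gcongr
        refine le_mul_of_one_le_right' ?_
        have : (1 : ℝ≥0) ≤ NNReal.pi := by
          rw [← NNReal.coe_le_coe]
          have := Real.pi_gt_three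
          simp only [NNReal.coe_one, NNReal.coe_real_pi]
          linarith
        exact_mod_cast this
      calc m (Metric.ball z r) * ENNReal.ofReal s ^ (2 * N)
          ≤ (D₁ * E * m (square ζ R)) * volume (Metric.ball ζ s) ^ N := by
            gcongr
            refine (hD₁ z ζ).trans ?_
            gcongr
            exact hexp z ζ hζ
        _ = D₁ * E * (m (square ζ R) * volume (Metric.ball ζ s) ^ N) := by ring
        _ ≤ D₁ * E * (C * m (Metric.ball ζ s)) := mul_le_mul_right (hsmall ζ s hsR) _
        _ = _ := by ring
    · refine le_trans ?_ le_add_self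
      calc m (Metric.ball z r) * ENNReal.ofReal s ^ (2 * N)
          ≤ (D₂ * E * m (Metric.ball ζ s)) * ENNReal.ofReal r ^ (2 * N) := by
            gcongr
            refine (hD₂ z ζ).trans ?_
            gcongr
            exact hexp z ζ hζ
        _ = _ := by ring

end SquareBound

/-- Apart from `w` being a weight, this is all that the sequel takes from the `A^res_∞` condition.
-/
theorem locallyDoubling_weightMeasure {w : ℂ → ℝ} (hw : w ∈ AResInfty) :
    LocallyDoubling (weightMeasure w) := by
  obtain ⟨R, hR, N, C, hC, h⟩ := exists_square_bound hw
  have hw' := isWeight_of_mem_AResInfty hw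
  refine SquareBound.locallyDoubling (N := N) h hR hC (fun h0 => hw'.ne_zero ?_)
    (weightMeasure_ball_lt_top hw')
  rw [weightMeasure, withDensity_eq_zero_iff hw'.aemeasurable] at h0
  filter_upwards [h0] with z hz
  exact le_antisymm (ENNReal.ofReal_eq_zero.1 hz) (hw'.nonneg z)

end WeightedFock

namespace WeightedFock

/-! ### Disk averages, Jensen's inequality and Carleson estimates -/

section Averaging

theorem measurable_measure_ball (μ : Measure ℂ) [SFinite μ] (s : ℝ) :
    Measurable fun z : ℂ => μ (Metric.ball z s) := by
  have h1 : MeasurableSet {q : ℂ × ℂ | dist q.2 q.1 < s} :=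
    (isOpen_lt (by fun_prop) (by fun_prop)).measurableSet
  exact measurable_measure_prodMk_left (ν := μ) h1

/-- Tonelli's theorem with the symmetry of `dist x y < s`; this is how local inequalities are summed
to global ones. -/
theorem lintegral_lintegral_ball (μ ν : Measure ℂ) [SFinite μ] [SFinite ν] {g : ℂ → ℝ≥0∞}
    (hg : Measurable g) (s : ℝ) :
    ∫⁻ x, ∫⁻ y in Metric.ball x s, g y ∂ν ∂μ = ∫⁻ y, g y * μ (Metric.ball y s) ∂ν := by
  have h1 : MeasurableSet {q : ℂ × ℂ | dist q.2 q.1 < s} :=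
    (isOpen_lt (by fun_prop) (by fun_prop)).measurableSet
  have h2 : ∀ x y : ℂ, (Metric.ball x s).indicator g y =
      {q : ℂ × ℂ | dist q.2 q.1 < s}.indicator (fun q => g q.2) (x, y) := fun x y => by
    simp only [Set.indicator, Metric.mem_ball, Set.mem_ofPred_eq]
  have h3 : ∀ x y : ℂ, (Metric.ball x s).indicator g y =
      (Metric.ball y s).indicator (fun _ => g y) x := fun x y => by
    simp only [Set.indicator, Metric.mem_ball, dist_comm]
  calc ∫⁻ x, ∫⁻ y in Metric.ball x s, g y ∂ν ∂μ
      = ∫⁻ x, ∫⁻ y, (Metric.ball x s).indicator g y ∂ν ∂μ := by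
        congr 1; ext x
        rw [lintegral_indicator measurableSet_ball]
    _ = ∫⁻ y, ∫⁻ x, (Metric.ball x s).indicator g y ∂μ ∂ν := by
        apply lintegral_lintegral_swap
        have : Measurable (Function.uncurry fun x y : ℂ => (Metric.ball x s).indicator g y) := by
          have h4 : (Function.uncurry fun x y : ℂ => (Metric.ball x s).indicator g y) =
              {q : ℂ × ℂ | dist q.2 q.1 < s}.indicator (fun q => g q.2) := by
            ext ⟨x, y⟩
            exact h2 x y
          rw [h4]
          exact (hg.comp measurable_snd).indicator h1
        exact this.aemeasurable
    _ = ∫⁻ y, g y * μ (Metric.ball y s) ∂ν := by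
        congr 1; ext y
        simp only [h3]
        rw [lintegral_indicator measurableSet_ball, setLIntegral_const]

/-- Jensen's inequality for a density of total mass at most one. -/
theorem rpow_lintegral_mul_le {X : Type*} [MeasurableSpace X] (m : Measure X) {g u : X → ℝ≥0∞}
    (hg : Measurable g) (hu : Measurable u) (hu1 : ∫⁻ x, u x ∂m ≤ 1) {p : ℝ} (hp : 1 ≤ p) :
    (∫⁻ x, g x * u x ∂m) ^ p ≤ ∫⁻ x, g x ^ p * u x ∂m := by
  have hp0 : 0 < p := by linarith
  set ν := m.withDensity u with hν
  have hν1 : ν Set.univ ≤ 1 := by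
    rw [hν, withDensity_apply _ MeasurableSet.univ, setLIntegral_univ]; exact hu1
  have h1 := eLpNorm'_le_eLpNorm'_mul_rpow_measure_univ (μ := ν) (f := g) one_pos hp
    hg.aestronglyMeasurable
  simp only [eLpNorm', enorm_eq_self, ENNReal.rpow_one, one_div_one] at h1
  have h2 : ∫⁻ x, g x * u x ∂m = ∫⁻ x, g x ∂ν := by
    rw [hν, lintegral_withDensity_eq_lintegral_mul _ hu hg]
    simp [mul_comm]
  have h3 : ∫⁻ x, g x ^ p * u x ∂m = ∫⁻ x, g x ^ p ∂ν := by
    rw [hν, lintegral_withDensity_eq_lintegral_mul _ hu (hg.pow_const p)]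
    simp [mul_comm]
  rw [h2, h3]
  have h4 : ν Set.univ ^ (1 - 1 / p) ≤ 1 := ENNReal.rpow_le_one hν1 (by
    rw [sub_nonneg, div_le_one hp0]; exact hp)
  calc (∫⁻ x, g x ∂ν) ^ p ≤ ((∫⁻ x, g x ^ p ∂ν) ^ (1 / p) * 1) ^ p := by
        gcongr
        exact h1.trans (by gcongr)
    _ = _ := by rw [mul_one, ← ENNReal.rpow_mul, one_div_mul_cancel hp0.ne', ENNReal.rpow_one]

theorem rpow_tsum_mul_le {g u : ℕ → ℝ≥0∞} (hu1 : ∑' n, u n ≤ 1) {p : ℝ} (hp : 1 ≤ p) :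
    (∑' n, g n * u n) ^ p ≤ ∑' n, g n ^ p * u n := by
  have := rpow_lintegral_mul_le Measure.count (measurable_of_countable g)
    (measurable_of_countable u) (by rwa [lintegral_count]) hp
  simpa only [lintegral_count] using this

namespace LocallyDoubling

variable {m : Measure ℂ}

theorem sigmaFinite (hm : LocallyDoubling m) : SigmaFinite m := by
  have : IsLocallyFiniteMeasure m :=
    ⟨fun x => ⟨Metric.ball x 1, Metric.ball_mem_nhds x one_pos, hm.lt_top x 1⟩⟩
  infer_instance

theorem exists_comparable (hm : LocallyDoubling m) {d r s : ℝ} (hr : 0 < r) (hs : 0 < s) :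
    ∃ C : ℝ≥0, ∀ z ζ : ℂ, ‖z - ζ‖ ≤ d → m (Metric.ball z r) ≤ C * m (Metric.ball ζ s) := by
  obtain ⟨M, hM, h⟩ := hm.growth
  obtain ⟨C, hC⟩ := h r hr s hs
  refine ⟨C * (Real.exp (M * d)).toNNReal, fun z ζ hz => (hC z ζ).trans ?_⟩
  push_cast
  rw [ENNReal.ofReal]
  gcongr

theorem inv_ball_le (hm : LocallyDoubling m) {C : ℝ≥0} {z ζ : ℂ} {r s : ℝ} (hr : 0 < r)
    (h : m (Metric.ball z r) ≤ C * m (Metric.ball ζ s)) :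
    (m (Metric.ball ζ s))⁻¹ ≤ C * (m (Metric.ball z r))⁻¹ := by
  have h0 := (hm.pos z r hr).ne'
  have ht := (hm.lt_top z r).ne
  rw [← div_eq_mul_inv, ENNReal.le_div_iff_mul_le (Or.inl h0) (Or.inl ht)]
  calc (m (Metric.ball ζ s))⁻¹ * m (Metric.ball z r)
      ≤ (m (Metric.ball ζ s))⁻¹ * (C * m (Metric.ball ζ s)) := by gcongr
    _ = C * ((m (Metric.ball ζ s))⁻¹ * m (Metric.ball ζ s)) := by ring
    _ ≤ C * 1 := by gcongr; exact ENNReal.inv_mul_le_one _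
    _ = C := mul_one _

/-- A Carleson type estimate: a function with a local mean value property is integrated against
a measure by means of the disk averages of that measure. -/
theorem exists_lintegral_le (hm : LocallyDoubling m) {s : ℝ} (hs : 0 < s) (C : ℝ≥0) :
    ∃ D : ℝ≥0, ∀ (μ : Measure ℂ) [SFinite μ] (φ : ℂ → ℝ≥0∞), Measurable φ →
      (∀ z, φ z * m (Metric.ball z s) ≤ C * ∫⁻ ζ in Metric.ball z s, φ ζ ∂m) →
      ∫⁻ z, φ z ∂μ ≤ D * ∫⁻ ζ, μ (Metric.ball ζ s) / m (Metric.ball ζ s) * φ ζ ∂m := by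
  obtain ⟨D, hD⟩ := hm.exists_comparable (d := s) hs hs
  have := hm.sigmaFinite
  refine ⟨C * D, fun μ _ φ hφ h => ?_⟩
  have hmeas : Measurable fun ζ => (m (Metric.ball ζ s))⁻¹ * φ ζ :=
    (measurable_measure_ball m s).inv.mul hφ
  have h1 : ∀ z, φ z ≤ C * D * ∫⁻ ζ in Metric.ball z s, (m (Metric.ball ζ s))⁻¹ * φ ζ ∂m := by
    intro z
    have h0 := (hm.pos z s hs).ne'
    have ht := (hm.lt_top z s).ne
    calc φ z = φ z * m (Metric.ball z s) * (m (Metric.ball z s))⁻¹ := by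
          rw [mul_assoc, ENNReal.mul_inv_cancel h0 ht, mul_one]
      _ ≤ C * (∫⁻ ζ in Metric.ball z s, φ ζ ∂m) * (m (Metric.ball z s))⁻¹ :=
          mul_le_mul_left (h z) _
      _ = C * ∫⁻ ζ in Metric.ball z s, (m (Metric.ball z s))⁻¹ * φ ζ ∂m := by
          rw [lintegral_const_mul _ hφ]; ring
      _ ≤ C * ∫⁻ ζ in Metric.ball z s, D * ((m (Metric.ball ζ s))⁻¹ * φ ζ) ∂m := by
          gcongr C * ?_
          refine setLIntegral_mono' measurableSet_ball fun ζ hζ => ?_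
          rw [← mul_assoc]
          gcongr
          refine hm.inv_ball_le hs (hD ζ z ?_)
          rw [← dist_eq_norm]; exact (Metric.mem_ball.1 hζ).le
      _ = _ := by rw [lintegral_const_mul _ hmeas, mul_assoc]
  calc ∫⁻ z, φ z ∂μ
      ≤ ∫⁻ z, C * D * ∫⁻ ζ in Metric.ball z s, (m (Metric.ball ζ s))⁻¹ * φ ζ ∂m ∂μ :=
        lintegral_mono h1
    _ = C * D * ∫⁻ z, ∫⁻ ζ in Metric.ball z s, (m (Metric.ball ζ s))⁻¹ * φ ζ ∂m ∂μ :=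
        lintegral_const_mul' _ _ (ENNReal.mul_ne_top ENNReal.coe_ne_top ENNReal.coe_ne_top)
    _ = _ := by
        rw [lintegral_lintegral_ball μ m hmeas s]
        push_cast
        congr 1
        refine lintegral_congr fun ζ => ?_
        rw [div_eq_mul_inv]; ring

/-- `D(z,s) ⊆ D(ζ,2s)`, and the two `m`-masses are comparable. The doubling of the radius is why
later proofs work with `r / 2`. -/
theorem exists_average_le (hm : LocallyDoubling m) {s : ℝ} (hs : 0 < s) :
    ∃ D : ℝ≥0, ∀ (μ : Measure ℂ) (z ζ : ℂ), ‖z - ζ‖ < s →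
      μ (Metric.ball z s) / m (Metric.ball z s) ≤
        D * (μ (Metric.ball ζ (2 * s)) / m (Metric.ball ζ (2 * s))) := by
  obtain ⟨D, hD⟩ := hm.exists_comparable (d := s) (r := 2 * s) (s := s) (by positivity) hs
  refine ⟨D, fun μ z ζ hz => ?_⟩
  rw [div_eq_mul_inv, div_eq_mul_inv]
  calc μ (Metric.ball z s) * (m (Metric.ball z s))⁻¹
      ≤ μ (Metric.ball ζ (2 * s)) * (D * (m (Metric.ball ζ (2 * s)))⁻¹) := by
        gcongr
        · refine Metric.ball_subset_ball' ?_
          rw [dist_eq_norm]; linarith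
        · exact hm.inv_ball_le (by positivity) (hD ζ z (by rw [norm_sub_rev]; exact hz.le))
    _ = _ := by ring

/-- Averaging the previous comparison over `ζ ∈ D(z,s)` turns an `L^p` bound into a uniform one. -/
theorem exists_rpow_average_le (hm : LocallyDoubling m) {s p : ℝ} (hs : 0 < s) (hp : 0 ≤ p) :
    ∃ D : ℝ≥0, ∀ (μ : Measure ℂ) (z : ℂ),
      (μ (Metric.ball z s) / m (Metric.ball z s)) ^ p ≤
        D * ∫⁻ ζ, (μ (Metric.ball ζ (2 * s)) / m (Metric.ball ζ (2 * s))) ^ p := by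
  obtain ⟨D, hD⟩ := hm.exists_average_le hs
  set V := volume (Metric.ball (0 : ℂ) s) with hV
  have hV0 : V ≠ 0 := (Metric.measure_ball_pos _ _ hs).ne'
  have hVt : V ≠ ∞ := measure_ball_lt_top.ne
  refine ⟨D ^ p * V⁻¹.toNNReal, fun μ z => ?_⟩
  push_cast
  rw [ENNReal.coe_toNNReal (ENNReal.inv_ne_top.2 hV0), ENNReal.coe_rpow_of_nonneg _ hp]
  set X := (μ (Metric.ball z s) / m (Metric.ball z s)) ^ p with hX
  have h1 : X * V ≤ (D : ℝ≥0∞) ^ p *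
      ∫⁻ ζ, (μ (Metric.ball ζ (2 * s)) / m (Metric.ball ζ (2 * s))) ^ p := by
    rw [← lintegral_const_mul' _ _ (ENNReal.rpow_ne_top_of_nonneg hp ENNReal.coe_ne_top)]
    calc X * V = ∫⁻ _ in Metric.ball z s, X := by rw [setLIntegral_const, volume_ball_eq]
      _ ≤ ∫⁻ ζ in Metric.ball z s, (D : ℝ≥0∞) ^ p *
            (μ (Metric.ball ζ (2 * s)) / m (Metric.ball ζ (2 * s))) ^ p := by
          refine setLIntegral_mono' measurableSet_ball fun ζ hζ => ?_
          rw [← ENNReal.mul_rpow_of_nonneg _ _ hp]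
          refine ENNReal.rpow_le_rpow (hD μ z ζ ?_) hp
          rw [norm_sub_rev, ← dist_eq_norm]; exact hζ
      _ ≤ _ := setLIntegral_le_lintegral _ _
  calc X = X * V * V⁻¹ := by rw [mul_assoc, ENNReal.mul_inv_cancel hV0 hVt, mul_one]
    _ ≤ _ := by
        rw [mul_right_comm _ V⁻¹]
        exact mul_le_mul_left h1 _

/-- Up to constants, `dm(z) / m(D(z,s))` acts on averages like Lebesgue measure: each value is
spread over `D(z,s)`, and after Tonelli the factor `m(D(ζ,s))` cancels. -/
theorem exists_lintegral_average_le (hm : LocallyDoubling m) {s p : ℝ} (hs : 0 < s)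
    (hp : 0 ≤ p) :
    ∃ D : ℝ≥0, ∀ (μ : Measure ℂ) [SFinite μ],
      ∫⁻ z, (μ (Metric.ball z s) / m (Metric.ball z s)) ^ p * (m (Metric.ball z s))⁻¹ ∂m ≤
        D * ∫⁻ ζ, (μ (Metric.ball ζ (2 * s)) / m (Metric.ball ζ (2 * s))) ^ p := by
  have := hm.sigmaFinite
  obtain ⟨D, hD⟩ := hm.exists_average_le hs
  obtain ⟨D', hD'⟩ := hm.exists_comparable (d := s) hs hs
  set V := volume (Metric.ball (0 : ℂ) s) with hV
  have hV0 : V ≠ 0 := (Metric.measure_ball_pos _ _ hs).ne'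
  have hVt : V ≠ ∞ := measure_ball_lt_top.ne
  refine ⟨V⁻¹.toNNReal * (D ^ p * D'), fun μ _ => ?_⟩
  push_cast
  rw [ENNReal.coe_toNNReal (ENNReal.inv_ne_top.2 hV0), ENNReal.coe_rpow_of_nonneg _ hp]
  set E : ℝ≥0∞ := (D : ℝ≥0∞) ^ p * D' with hE
  have hEt : E ≠ ∞ := ENNReal.mul_ne_top
    (ENNReal.rpow_ne_top_of_nonneg hp ENNReal.coe_ne_top) ENNReal.coe_ne_top
  set Y : ℂ → ℝ≥0∞ := fun ζ => (μ (Metric.ball ζ (2 * s)) / m (Metric.ball ζ (2 * s))) ^ p with hY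
  have hYm : Measurable Y :=
    ((measurable_measure_ball μ _).div (measurable_measure_ball m _)).pow_const p
  have hYm' : Measurable fun ζ => Y ζ * (m (Metric.ball ζ s))⁻¹ :=
    hYm.mul (measurable_measure_ball m s).inv
  have h1 : ∀ z, (μ (Metric.ball z s) / m (Metric.ball z s)) ^ p * (m (Metric.ball z s))⁻¹ ≤
      V⁻¹ * E * ∫⁻ ζ in Metric.ball z s, Y ζ * (m (Metric.ball ζ s))⁻¹ := by
    intro z
    set X := (μ (Metric.ball z s) / m (Metric.ball z s)) ^ p * (m (Metric.ball z s))⁻¹ with hX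
    have h2 : X * V ≤ E * ∫⁻ ζ in Metric.ball z s, Y ζ * (m (Metric.ball ζ s))⁻¹ := by
      rw [← lintegral_const_mul' _ _ hEt]
      calc X * V = ∫⁻ _ in Metric.ball z s, X := by rw [setLIntegral_const, volume_ball_eq]
        _ ≤ _ := by
          refine setLIntegral_mono' measurableSet_ball fun ζ hζ => ?_
          have hz : ‖z - ζ‖ < s := by rw [norm_sub_rev, ← dist_eq_norm]; exact hζ
          calc X ≤ (D * (μ (Metric.ball ζ (2 * s)) / m (Metric.ball ζ (2 * s)))) ^ p *
                (D' * (m (Metric.ball ζ s))⁻¹) := by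
                rw [hX]
                gcongr
                · exact hD μ z ζ hz
                · exact hm.inv_ball_le hs (hD' ζ z (by rw [norm_sub_rev]; exact hz.le))
            _ = _ := by rw [ENNReal.mul_rpow_of_nonneg _ _ hp, hE, hY]; ring
    calc X = V⁻¹ * (X * V) := by
          rw [mul_comm X, ← mul_assoc, ENNReal.inv_mul_cancel hV0 hVt, one_mul]
      _ ≤ _ := by
          rw [mul_assoc V⁻¹ E]; exact mul_le_mul_right h2 _
  calc ∫⁻ z, (μ (Metric.ball z s) / m (Metric.ball z s)) ^ p * (m (Metric.ball z s))⁻¹ ∂m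
      ≤ ∫⁻ z, V⁻¹ * E * (∫⁻ ζ in Metric.ball z s, Y ζ * (m (Metric.ball ζ s))⁻¹) ∂m :=
        lintegral_mono h1
    _ = V⁻¹ * E * ∫⁻ z, (∫⁻ ζ in Metric.ball z s, Y ζ * (m (Metric.ball ζ s))⁻¹) ∂m :=
        lintegral_const_mul' _ _ (ENNReal.mul_ne_top (ENNReal.inv_ne_top.2 hV0) hEt)
    _ = V⁻¹ * E * ∫⁻ ζ, Y ζ := by
        rw [lintegral_lintegral_ball m volume hYm' s]
        congr 1
        refine lintegral_congr fun ζ => ?_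
        rw [mul_assoc, ENNReal.inv_mul_cancel (hm.pos ζ s hs).ne' (hm.lt_top ζ s).ne, mul_one]

theorem lintegral_mul_measure_ball_le (hm : LocallyDoubling m) {s : ℝ} {C : ℝ≥0}
    {φ : ℂ → ℝ≥0∞} (hφ : Measurable φ)
    (h : ∀ z, φ z * m (Metric.ball z s) ≤ C * ∫⁻ ζ in Metric.ball z s, φ ζ ∂m) :
    ∫⁻ z, φ z * m (Metric.ball z s) ≤
      C * volume (Metric.ball (0 : ℂ) s) * ∫⁻ ζ, φ ζ ∂m := by
  have := hm.sigmaFinite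
  calc ∫⁻ z, φ z * m (Metric.ball z s)
      ≤ ∫⁻ z, C * ∫⁻ ζ in Metric.ball z s, φ ζ ∂m := lintegral_mono h
    _ = C * ∫⁻ ζ, φ ζ * volume (Metric.ball ζ s) ∂m := by
        rw [lintegral_const_mul' _ _ ENNReal.coe_ne_top, lintegral_lintegral_ball _ _ hφ]
    _ = _ := by
        simp only [volume_ball_eq _ s]
        rw [lintegral_mul_const _ hφ]; ring

end LocallyDoubling

end Averaging

end WeightedFock

namespace WeightedFock

/-! ### Mean value and Gaussian estimates for locally doubling measures -/

section Holomorphic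

/-- The Schwarz lemma for `F - F z`, which is bounded by `(K + 2) ‖F z‖` on the disk, keeps `F`
within `‖F z‖ / 2` of `F z`. -/
theorem half_norm_le_of_norm_le {F : ℂ → ℂ} (hF : Differentiable ℂ F) {z : ℂ} {ρ K : ℝ}
    (hρ : 0 < ρ) (hK : 0 ≤ K) (h : ∀ ξ ∈ Metric.ball z ρ, ‖F ξ‖ ≤ K * ‖F z‖) {ξ : ℂ}
    (hξ : ‖ξ - z‖ ≤ ρ / (2 * (K + 2))) : ‖F z‖ / 2 ≤ ‖F ξ‖ := by
  rcases eq_or_lt_of_le (norm_nonneg (F z)) with h0 | h0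
  · rw [← h0]; simp
  have hξρ : ξ ∈ Metric.ball z ρ := by
    rw [Metric.mem_ball, dist_eq_norm]
    refine lt_of_le_of_lt hξ ?_
    rw [div_lt_iff₀ (by positivity)]
    nlinarith
  have h1 : Set.MapsTo F (Metric.ball z ρ) (Metric.closedBall (F z) ((K + 2) * ‖F z‖)) := by
    intro η hη
    rw [Metric.mem_closedBall, dist_eq_norm]
    have := (norm_sub_le (F η) (F z)).trans (add_le_add_left (h η hη) _)
    nlinarith
  have h2 := Complex.dist_le_div_mul_dist_of_mapsTo_ball hF.differentiableOn h1 hξρ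
  rw [dist_eq_norm, dist_eq_norm] at h2
  have h3 : (K + 2) * ‖F z‖ / ρ * ‖ξ - z‖ ≤ ‖F z‖ / 2 := by
    calc (K + 2) * ‖F z‖ / ρ * ‖ξ - z‖ ≤ (K + 2) * ‖F z‖ / ρ * (ρ / (2 * (K + 2))) := by gcongr
      _ = ‖F z‖ / 2 := by field_simp
  have h4 := norm_sub_norm_le (F z) (F ξ)
  rw [norm_sub_rev] at h4
  linarith

/-- The local mean value property of `|F|²` for a locally doubling measure. -/
theorem LocallyDoubling.exists_norm_sq_mul_le {m : Measure ℂ} (hm : LocallyDoubling m) {r : ℝ}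
    (hr : 0 < r) :
    ∃ C : ℝ≥0, ∀ F : ℂ → ℂ, Differentiable ℂ F → ∀ z,
      ENNReal.ofReal (‖F z‖ ^ 2) * m (Metric.ball z r) ≤
        C * ∫⁻ ξ in Metric.ball z r, ENNReal.ofReal (‖F ξ‖ ^ 2) ∂m := by
  obtain ⟨N, hN⟩ := hm.scale
  obtain ⟨C, hC⟩ := hN r hr
  set K : ℝ := 2 ^ (N + 1) with hK
  have hK0 : 0 < K := by positivity
  -- Half of the ratio `1 / (2 * (K + 2))` in `half_norm_le_of_norm_le`, which is applied on a disk
  -- of radius `d / 2`.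
  set ε : ℝ := 1 / (4 * (K + 2)) with hε
  have hε0 : 0 < ε := by positivity
  set A : ℝ := 4 / (ε * r) ^ N with hA
  have hA0 : 0 ≤ A := by positivity
  refine ⟨A.toNNReal * C, fun F hF z => ?_⟩
  rcases eq_or_lt_of_le (norm_nonneg (F z)) with h0 | h0
  · rw [← h0]; simp
  -- At a maximum `ζ` of `φ`, at distance `d` from the boundary circle, `‖F‖ ≤ K ‖F ζ‖` on `D(ζ,
  -- d/2)`, hence `‖F‖ ≥ ‖F ζ‖ / 2` on `D(ζ, εd)`. That disk may have mass smaller by a factor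
  -- `d^N`, which the power in `φ` compensates. The exponent `N + 1` is positive, so that `φ`
  -- vanishes on the boundary, and twice it is at least `N`.
  set φ : ℂ → ℝ := fun ξ => ‖F ξ‖ * (r - ‖ξ - z‖) ^ (N + 1) with hφ
  have hφc : Continuous φ := by
    have := hF.continuous
    fun_prop
  obtain ⟨ζ, hζ, hmax⟩ := (isCompact_closedBall z r).exists_isMaxOn
    ⟨z, Metric.mem_closedBall_self hr.le⟩ hφc.continuousOn
  have hφz : φ z = ‖F z‖ * r ^ (N + 1) := by simp [hφ]
  have hle : ‖F z‖ * r ^ (N + 1) ≤ φ ζ := by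
    rw [← hφz]; exact hmax (Metric.mem_closedBall_self hr.le)
  have hφpos : 0 < φ ζ := lt_of_lt_of_le (by positivity) hle
  set d := r - ‖ζ - z‖ with hd
  have hd0 : 0 ≤ d := by
    rw [hd, sub_nonneg, ← dist_eq_norm]; exact hζ
  have hdpos : 0 < d := by
    refine lt_of_le_of_ne hd0 fun h => ?_
    have : φ ζ = 0 := by
      change ‖F ζ‖ * d ^ (N + 1) = 0
      rw [← h]; simp
    linarith
  have hdr : d ≤ r := by rw [hd]; linarith [norm_nonneg (ζ - z)]
  have hφζ : φ ζ = ‖F ζ‖ * d ^ (N + 1) := rfl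
  have hbound : ∀ ξ ∈ Metric.ball ζ (d / 2), ‖F ξ‖ ≤ K * ‖F ζ‖ := by
    intro ξ hξ
    rw [Metric.mem_ball, dist_eq_norm] at hξ
    have h1 : ‖ξ - z‖ ≤ ‖ξ - ζ‖ + ‖ζ - z‖ := norm_sub_le_norm_sub_add_norm_sub _ _ _
    have h2 : d / 2 ≤ r - ‖ξ - z‖ := by rw [hd] at hξ ⊢; linarith
    have h3 : ξ ∈ Metric.closedBall z r := by
      rw [Metric.mem_closedBall, dist_eq_norm]; linarith
    have h4 : φ ξ ≤ φ ζ := hmax h3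
    have h5 : ‖F ξ‖ * (d / 2) ^ (N + 1) ≤ ‖F ζ‖ * d ^ (N + 1) := by
      refine le_trans ?_ h4
      change _ ≤ ‖F ξ‖ * (r - ‖ξ - z‖) ^ (N + 1)
      gcongr
    have h6 : ‖F ζ‖ * d ^ (N + 1) = K * ‖F ζ‖ * (d / 2) ^ (N + 1) := by
      rw [div_pow, hK]; field_simp
    rw [h6] at h5
    exact le_of_mul_le_mul_right h5 (by positivity)
  set s := ε * d with hs
  have hs0 : 0 < s := by positivity
  have hhalf : ∀ ξ ∈ Metric.ball ζ s, ‖F ζ‖ / 2 ≤ ‖F ξ‖ := by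
    intro ξ hξ
    refine half_norm_le_of_norm_le hF (half_pos hdpos) hK0.le hbound ?_
    rw [Metric.mem_ball, dist_eq_norm] at hξ
    refine hξ.le.trans (le_of_eq ?_)
    rw [hs, hε]; field_simp; norm_num
  have hε1 : ε ≤ 1 := by
    rw [hε, div_le_one (by positivity)]; linarith
  have hsd : s ≤ d := by rw [hs]; nlinarith
  have hsub : Metric.ball ζ s ⊆ Metric.ball z r := by
    refine Metric.ball_subset_ball' ?_
    rw [dist_eq_norm]; rw [hd] at hsd; linarith
  have hζr : ζ ∈ Metric.ball z r := by
    rw [Metric.mem_ball, dist_eq_norm]; rw [hd] at hdpos; linarith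
  have hmz := hC z ζ hζr s hs0 (hsd.trans hdr)
  have hFz : ‖F z‖ ^ 2 ≤ A * (‖F ζ‖ / 2) ^ 2 * s ^ N := by
    have h1 : ‖F z‖ ≤ ‖F ζ‖ * (d / r) ^ (N + 1) := by
      rw [div_pow, ← mul_div_assoc, le_div_iff₀ (by positivity)]
      exact hle
    have hdr1 : d / r ≤ 1 := by rw [div_le_one hr]; exact hdr
    have h2 : ((d / r) ^ (N + 1)) ^ 2 ≤ (d / r) ^ N := by
      rw [← pow_mul]
      exact pow_le_pow_of_le_one (by positivity) hdr1 (by omega)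
    calc ‖F z‖ ^ 2 ≤ (‖F ζ‖ * (d / r) ^ (N + 1)) ^ 2 := by gcongr
      _ = ‖F ζ‖ ^ 2 * ((d / r) ^ (N + 1)) ^ 2 := by ring
      _ ≤ ‖F ζ‖ ^ 2 * (d / r) ^ N := by gcongr
      _ = _ := by
        rw [hA, hs, div_pow, mul_pow, mul_pow]; field_simp; norm_num
  calc ENNReal.ofReal (‖F z‖ ^ 2) * m (Metric.ball z r)
      ≤ ENNReal.ofReal (A * (‖F ζ‖ / 2) ^ 2 * s ^ N) * m (Metric.ball z r) := by gcongr
    _ = ENNReal.ofReal A * ENNReal.ofReal ((‖F ζ‖ / 2) ^ 2) *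
          (m (Metric.ball z r) * ENNReal.ofReal s ^ N) := by
        rw [ENNReal.ofReal_mul (by positivity), ENNReal.ofReal_mul hA0,
          ENNReal.ofReal_pow hs0.le]
        ring
    _ ≤ ENNReal.ofReal A * ENNReal.ofReal ((‖F ζ‖ / 2) ^ 2) * (C * m (Metric.ball ζ s)) := by
        gcongr _ * ?_
    _ = ENNReal.ofReal A * C * (ENNReal.ofReal ((‖F ζ‖ / 2) ^ 2) * m (Metric.ball ζ s)) := by ring
    _ ≤ ENNReal.ofReal A * C * ∫⁻ ξ in Metric.ball z r, ENNReal.ofReal (‖F ξ‖ ^ 2) ∂m := by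
        gcongr _ * ?_
        refine le_trans ?_ (lintegral_mono_set hsub)
        rw [← setLIntegral_const]
        refine setLIntegral_mono' measurableSet_ball fun ξ hξ => ?_
        have := hhalf ξ hξ
        gcongr
    _ = _ := by rw [ENNReal.coe_mul]; rfl

/-- The density `|f(ξ)|² e^{-α|ξ|²}`. -/
noncomputable def fockDensity (α : ℝ) (f : ℂ → ℂ) (ξ : ℂ) : ℝ≥0∞ :=
  ENNReal.ofReal (‖f ξ‖ ^ 2 * Real.exp (-α * ‖ξ‖ ^ 2))

theorem measurable_fockDensity (α : ℝ) {f : ℂ → ℂ} (hf : Measurable f) :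
    Measurable (fockDensity α f) := by
  unfold fockDensity
  fun_prop

/-- The holomorphic function whose modulus is comparable to `|f(ξ)| e^{-α|ξ|²/2}` near `z`. -/
noncomputable def gaugeTwist (α : ℝ) (f : ℂ → ℂ) (z ξ : ℂ) : ℂ :=
  f ξ * Complex.exp (-α * conj z * ξ + α * ‖z‖ ^ 2 / 2)

theorem differentiable_gaugeTwist (α : ℝ) {f : ℂ → ℂ} (hf : Differentiable ℂ f) (z : ℂ) :
    Differentiable ℂ (gaugeTwist α f z) := by
  unfold gaugeTwist
  fun_prop

/-- Completing the square, with `|ξ - z|² = |ξ|² - 2 Re(conj z · ξ) + |z|²`. The twist is thus exact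
at `z` and off by at most `e^{αr²}` on `D(z,r)`. -/
theorem norm_gaugeTwist_sq (α : ℝ) (f : ℂ → ℂ) (z ξ : ℂ) :
    ‖gaugeTwist α f z ξ‖ ^ 2 =
      ‖f ξ‖ ^ 2 * Real.exp (-α * ‖ξ‖ ^ 2) * Real.exp (α * ‖ξ - z‖ ^ 2) := by
  rw [gaugeTwist, norm_mul, mul_pow, Complex.norm_exp, mul_assoc (‖f ξ‖ ^ 2), ← Real.exp_add,
    ← Real.exp_nat_mul]
  congr 2
  rw [← Complex.normSq_eq_norm_sq, ← Complex.normSq_eq_norm_sq]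
  have : (-(α : ℂ) * conj z * ξ + α * (‖z‖ : ℂ) ^ 2 / 2).re =
      -α * (z.re * ξ.re + z.im * ξ.im) + α * Complex.normSq z / 2 := by
    have h1 : (-(α : ℂ) * conj z * ξ).re = -α * (z.re * ξ.re + z.im * ξ.im) := by
      simp; ring
    have h2 : (α * (‖z‖ : ℂ) ^ 2 / 2 : ℂ) = ((α * Complex.normSq z / 2 : ℝ) : ℂ) := by
      rw [Complex.normSq_eq_norm_sq]; push_cast; rfl
    rw [Complex.add_re, h1, h2, Complex.ofReal_re]
  rw [this]
  simp only [Complex.normSq_apply, Complex.sub_re, Complex.sub_im]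
  push_cast
  ring

theorem LocallyDoubling.exists_fockDensity_mul_le {m : Measure ℂ} (hm : LocallyDoubling m)
    {α : ℝ} (hα : 0 < α) {r : ℝ} (hr : 0 < r) :
    ∃ C : ℝ≥0, ∀ f : ℂ → ℂ, Differentiable ℂ f → ∀ z,
      fockDensity α f z * m (Metric.ball z r) ≤
        C * ∫⁻ ξ in Metric.ball z r, fockDensity α f ξ ∂m := by
  obtain ⟨C, hC⟩ := hm.exists_norm_sq_mul_le hr
  refine ⟨C * (Real.exp (α * r ^ 2)).toNNReal, fun f hf z => ?_⟩
  have h1 := hC _ (differentiable_gaugeTwist α hf z) z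
  have h2 : fockDensity α f z = ENNReal.ofReal (‖gaugeTwist α f z z‖ ^ 2) := by
    rw [norm_gaugeTwist_sq, fockDensity]; simp
  rw [h2, ENNReal.coe_mul, mul_assoc]
  refine h1.trans ?_
  gcongr _ * ?_
  rw [← lintegral_const_mul _ (measurable_fockDensity α hf.continuous.measurable)]
  refine setLIntegral_mono' measurableSet_ball fun ξ hξ => ?_
  rw [norm_gaugeTwist_sq, ENNReal.ofReal_mul (by positivity), mul_comm]
  change _ * fockDensity α f ξ ≤ ENNReal.ofReal _ * _
  gcongr
  rw [← dist_eq_norm]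
  exact (Metric.mem_ball.1 hξ).le

/-- The Gaussian is dominated by unit disk averages of a wider one; Tonelli then produces
`m(D(η,1))`, whose exponential growth a Gaussian absorbs. -/
theorem LocallyDoubling.exists_lintegral_gaussian_le {m : Measure ℂ} (hm : LocallyDoubling m)
    {α : ℝ} (hα : 0 < α) {r : ℝ} (hr : 0 < r) :
    ∃ C : ℝ≥0, ∀ z, ∫⁻ ξ, ENNReal.ofReal (Real.exp (-α * ‖ξ - z‖ ^ 2)) ∂m ≤
      C * m (Metric.ball z r) := by
  have := hm.sigmaFinite
  obtain ⟨M, hM, hgrowth⟩ := hm.growth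
  obtain ⟨D, hD⟩ := hgrowth 1 one_pos r hr
  set V := volume (Metric.ball (0 : ℂ) 1) with hV
  have hV0 : V ≠ 0 := (Metric.measure_ball_pos _ _ one_pos).ne'
  have hVt : V ≠ ∞ := measure_ball_lt_top.ne
  -- From `‖η - z‖² ≤ 2 ‖ξ - z‖² + 2` for `η ∈ D(ξ,1)`.
  set g : ℂ → ℝ≥0∞ := fun η =>
    ENNReal.ofReal (Real.exp α) * ENNReal.ofReal (Real.exp (-(α / 2) * ‖η‖ ^ 2)) with hg
  have hgm : Measurable g := by rw [hg]; fun_prop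
  set I := ∫⁻ η : ℂ, ENNReal.ofReal (Real.exp (-(α / 4) * ‖η‖ ^ 2)) with hI
  have hIt : I ≠ ∞ := by
    have h1 : Integrable fun η : ℂ => Real.exp (-(α / 4) * ‖η‖ ^ 2) := by
      have h2 := (GaussianFourier.integrable_cexp_neg_mul_sq_norm_add (V := ℂ)
        (b := (α / 4 : ℝ)) (by simpa using hα) 0 0).norm
      refine h2.congr (Filter.Eventually.of_forall fun η => ?_)
      simp only [Complex.norm_exp]
      congr 1
      simp [← Complex.ofReal_pow]
    exact h1.lintegral_lt_top.ne
  set E : ℝ≥0∞ := ENNReal.ofReal (Real.exp α) * ENNReal.ofReal (Real.exp (M ^ 2 / α)) with hE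
  refine ⟨(V⁻¹ * E * D * I).toNNReal, fun z => ?_⟩
  have hC : V⁻¹ * E * D * I ≠ ∞ :=
    ENNReal.mul_ne_top (ENNReal.mul_ne_top (ENNReal.mul_ne_top (ENNReal.inv_ne_top.2 hV0)
      (ENNReal.mul_ne_top ENNReal.ofReal_ne_top ENNReal.ofReal_ne_top)) ENNReal.coe_ne_top) hIt
  rw [ENNReal.coe_toNNReal hC]
  have hgz : Measurable fun η => g (η - z) := hgm.comp (measurable_id.sub_const z)
  have h1 : ∀ ξ, ENNReal.ofReal (Real.exp (-α * ‖ξ - z‖ ^ 2)) ≤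
      V⁻¹ * ∫⁻ η in Metric.ball ξ 1, g (η - z) := by
    intro ξ
    set X := ENNReal.ofReal (Real.exp (-α * ‖ξ - z‖ ^ 2)) with hX
    have h2 : X * V ≤ ∫⁻ η in Metric.ball ξ 1, g (η - z) := by
      calc X * V = ∫⁻ _ in Metric.ball ξ 1, X := by rw [setLIntegral_const, volume_ball_eq]
        _ ≤ _ := by
          refine setLIntegral_mono' measurableSet_ball fun η hη => ?_
          rw [hX, hg]
          simp only
          rw [← ENNReal.ofReal_mul (Real.exp_pos _).le, ← Real.exp_add]
          gcongr
          have h3 : ‖η - z‖ ≤ ‖ξ - z‖ + 1 := by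
            have h4 : ‖η - z‖ ≤ ‖η - ξ‖ + ‖ξ - z‖ := norm_sub_le_norm_sub_add_norm_sub _ _ _
            rw [Metric.mem_ball, dist_eq_norm] at hη
            linarith
          have h5 : ‖η - z‖ ^ 2 ≤ 2 * ‖ξ - z‖ ^ 2 + 2 := by
            have : ‖η - z‖ ^ 2 ≤ (‖ξ - z‖ + 1) ^ 2 := by gcongr
            nlinarith [sq_nonneg (‖ξ - z‖ - 1)]
          nlinarith
    calc X = V⁻¹ * (X * V) := by
          rw [mul_comm X, ← mul_assoc, ENNReal.inv_mul_cancel hV0 hVt, one_mul]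
      _ ≤ _ := mul_le_mul_right h2 _
  have h2 : ∀ η, g (η - z) * m (Metric.ball η 1) ≤
      E * D * ENNReal.ofReal (Real.exp (-(α / 4) * ‖η - z‖ ^ 2)) * m (Metric.ball z r) := by
    intro η
    -- Half of the remaining Gaussian decay pays for the growth: `M t ≤ M² / α + α t² / 4`.
    have h3 : Real.exp (-(α / 2) * ‖η - z‖ ^ 2) * Real.exp (M * ‖η - z‖) ≤
        Real.exp (M ^ 2 / α) * Real.exp (-(α / 4) * ‖η - z‖ ^ 2) := by
      rw [← Real.exp_add, ← Real.exp_add, Real.exp_le_exp]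
      have h4 : M * ‖η - z‖ ≤ M ^ 2 / α + α / 4 * ‖η - z‖ ^ 2 := by
        have h5 : M ^ 2 / α + α / 4 * ‖η - z‖ ^ 2 - M * ‖η - z‖ =
            (M - α / 2 * ‖η - z‖) ^ 2 / α := by field_simp; ring
        have h6 : 0 ≤ (M - α / 2 * ‖η - z‖) ^ 2 / α := by positivity
        linarith
      linarith
    calc g (η - z) * m (Metric.ball η 1)
        ≤ g (η - z) * (D * ENNReal.ofReal (Real.exp (M * ‖η - z‖)) * m (Metric.ball z r)) :=
          mul_le_mul_right (hD η z) _
      _ = ENNReal.ofReal (Real.exp α) * D *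
            ENNReal.ofReal (Real.exp (-(α / 2) * ‖η - z‖ ^ 2) * Real.exp (M * ‖η - z‖)) *
            m (Metric.ball z r) := by
          rw [hg, ENNReal.ofReal_mul (Real.exp_pos _).le]; ring
      _ ≤ ENNReal.ofReal (Real.exp α) * D *
            ENNReal.ofReal (Real.exp (M ^ 2 / α) * Real.exp (-(α / 4) * ‖η - z‖ ^ 2)) *
            m (Metric.ball z r) := by gcongr
      _ = _ := by rw [hE, ENNReal.ofReal_mul (Real.exp_pos _).le]; ring
  calc ∫⁻ ξ, ENNReal.ofReal (Real.exp (-α * ‖ξ - z‖ ^ 2)) ∂m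
      ≤ ∫⁻ ξ, V⁻¹ * (∫⁻ η in Metric.ball ξ 1, g (η - z)) ∂m := lintegral_mono h1
    _ = V⁻¹ * ∫⁻ η, g (η - z) * m (Metric.ball η 1) := by
        rw [lintegral_const_mul' _ _ (ENNReal.inv_ne_top.2 hV0), lintegral_lintegral_ball _ _ hgz]
    _ ≤ V⁻¹ * ∫⁻ η, E * D * m (Metric.ball z r) *
          ENNReal.ofReal (Real.exp (-(α / 4) * ‖η - z‖ ^ 2)) := by
        gcongr _ * ?_
        refine lintegral_mono fun η => (h2 η).trans (le_of_eq ?_)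
        ring
    _ = V⁻¹ * (E * D * m (Metric.ball z r) * I) := by
        rw [lintegral_const_mul _ (by fun_prop)]
        rw [lintegral_sub_right_eq_self (fun η : ℂ =>
          ENNReal.ofReal (Real.exp (-(α / 4) * ‖η‖ ^ 2))) z]
    _ = _ := by ring

end Holomorphic

end WeightedFock

namespace WeightedFock

/-! ### The weighted Fock space as a reproducing kernel Hilbert space -/

namespace FockSpace

variable {α : ℝ} {w : ℂ → ℝ}

theorem differentiable (f : FockSpace α w) : Differentiable ℂ f := f.2.1

theorem measurable_fockDensity (f : FockSpace α w) : Measurable (fockDensity α f) :=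
  WeightedFock.measurable_fockDensity α f.differentiable.continuous.measurable

/-- The element of `F²_{α,w}` given by an entire function. -/
def mk (f : ℂ → ℂ) (hf : Differentiable ℂ f) (hf' : MemLp f 2 (fockMeasure α w)) :
    FockSpace α w :=
  (⟨f, hf, hf'⟩ : fockSubmodule α w)

theorem sub_apply (f g : FockSpace α w) (z : ℂ) : (f - g) z = f z - g z := rfl

theorem smul_apply (c : ℂ) (f : FockSpace α w) (z : ℂ) : (c • f) z = c * f z := rfl

theorem fockMeasure_eq (α : ℝ) (hw : IsWeight w) :
    fockMeasure α w =
      (weightMeasure w).withDensity fun z => ENNReal.ofReal (Real.exp (-α * ‖z‖ ^ 2)) := by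
  have h1 : Measurable fun z : ℂ => ENNReal.ofReal (Real.exp (-α * ‖z‖ ^ 2)) := by fun_prop
  rw [fockMeasure, weightMeasure, ← withDensity_mul₀ hw.aemeasurable h1.aemeasurable]
  congr 1
  ext z
  rw [Pi.mul_apply, ENNReal.ofReal_mul (Real.exp_pos _).le, mul_comm]

theorem lintegral_fockMeasure (α : ℝ) (hw : IsWeight w) {f : ℂ → ℂ} (hf : Measurable f) :
    ∫⁻ z, ENNReal.ofReal (‖f z‖ ^ 2) ∂(fockMeasure α w) =
      ∫⁻ z, fockDensity α f z ∂(weightMeasure w) := by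
  rw [fockMeasure_eq α hw, lintegral_withDensity_eq_lintegral_mul _ (by fun_prop) (by fun_prop)]
  refine lintegral_congr fun z => ?_
  rw [Pi.mul_apply, fockDensity, ENNReal.ofReal_mul (by positivity), mul_comm]

theorem memLp_iff (α : ℝ) (hw : IsWeight w) {f : ℂ → ℂ} (hf : Differentiable ℂ f) :
    MemLp f 2 (fockMeasure α w) ↔ ∫⁻ z, fockDensity α f z ∂(weightMeasure w) < ∞ := by
  rw [MemLp, ← lintegral_fockMeasure α hw hf.continuous.measurable,
    eLpNorm_lt_top_iff_lintegral_rpow_enorm_lt_top (by norm_num) (by norm_num)]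
  have h1 : ∀ z, ENNReal.ofReal (‖f z‖ ^ 2) = ‖f z‖ₑ ^ (2 : ℝ≥0∞).toReal := fun z => by
    rw [ENNReal.ofReal_pow (norm_nonneg _), ofReal_norm]
    simp
  simp only [h1]
  exact and_iff_right hf.continuous.aestronglyMeasurable

theorem ofReal_norm_sq (hw : IsWeight w) (f : FockSpace α w) :
    ENNReal.ofReal (‖f‖ ^ 2) = ∫⁻ z, fockDensity α f z ∂(weightMeasure w) := by
  rw [← lintegral_fockMeasure α hw f.differentiable.continuous.measurable]
  have h1 : ‖f‖ ^ 2 = ∫ z, ‖f z‖ ^ 2 ∂(fockMeasure α w) := by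
    rw [← inner_self_eq_norm_sq (𝕜 := ℂ) f, inner_def]
    have h2 : ∀ z, f z * conj (f z) = ((‖f z‖ ^ 2 : ℝ) : ℂ) := fun z => by
      rw [Complex.mul_conj, Complex.normSq_eq_norm_sq]
    simp only [h2]
    rw [integral_complex_ofReal]
    exact Complex.ofReal_re _
  rw [h1, ofReal_integral_eq_lintegral_ofReal]
  · exact (memLp_two_iff_integrable_sq_norm f.2.2.1).1 f.2.2
  · exact Filter.Eventually.of_forall fun z => by positivity

theorem exists_fockDensity_mul_le (hα : 0 < α) (hw : w ∈ AResInfty) {r : ℝ} (hr : 0 < r) :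
    ∃ C : ℝ≥0, ∀ (f : FockSpace α w) (z : ℂ),
      fockDensity α f z * weightMeasure w (Metric.ball z r) ≤ C * ENNReal.ofReal (‖f‖ ^ 2) := by
  obtain ⟨C, hC⟩ := (locallyDoubling_weightMeasure hw).exists_fockDensity_mul_le hα hr
  refine ⟨C, fun f z => (hC f f.differentiable z).trans ?_⟩
  rw [ofReal_norm_sq (isWeight_of_mem_AResInfty hw)]
  exact mul_le_mul_right (setLIntegral_le_lintegral _ _) _

/-- The evaluation functionals are bounded, locally uniformly in the point. -/
theorem exists_norm_apply_le (hα : 0 < α) (hw : w ∈ AResInfty) (R : ℝ) :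
    ∃ K : ℝ, 0 ≤ K ∧ ∀ (f : FockSpace α w), ∀ z ∈ Metric.ball (0 : ℂ) R, ‖f z‖ ≤ K * ‖f‖ := by
  have hm := locallyDoubling_weightMeasure hw
  obtain ⟨C, hC⟩ := exists_fockDensity_mul_le hα hw (r := 1) one_pos
  obtain ⟨D, hD⟩ := hm.exists_comparable (d := R) (r := 1) (s := 1) one_pos one_pos
  set v := weightMeasure w (Metric.ball 0 1) with hv
  have hv0 : v ≠ 0 := (hm.pos 0 1 one_pos).ne'
  have hvt : v ≠ ∞ := (hm.lt_top 0 1).ne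
  have hvr : 0 < v.toReal := ENNReal.toReal_pos hv0 hvt
  set A : ℝ := C * D / v.toReal * Real.exp (α * R ^ 2) with hA
  have hA0 : 0 ≤ A := by positivity
  refine ⟨Real.sqrt A, Real.sqrt_nonneg _, fun f z hz => ?_⟩
  have hzR : ‖z‖ < R := by simpa using hz
  have h1 : fockDensity α f z * v ≤ C * D * ENNReal.ofReal (‖f‖ ^ 2) := by
    calc fockDensity α f z * v ≤ fockDensity α f z * (D * weightMeasure w (Metric.ball z 1)) := by
          gcongr; exact hD 0 z (by rw [zero_sub, norm_neg]; exact hzR.le)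
      _ = D * (fockDensity α f z * weightMeasure w (Metric.ball z 1)) := by ring
      _ ≤ D * (C * ENNReal.ofReal (‖f‖ ^ 2)) := mul_le_mul_right (hC f z) _
      _ = _ := by ring
  have h2 : ‖f z‖ ^ 2 * Real.exp (-α * ‖z‖ ^ 2) * v.toReal ≤ C * D * ‖f‖ ^ 2 := by
    have h3 := ENNReal.toReal_mono (by
      exact ENNReal.mul_ne_top (ENNReal.mul_ne_top ENNReal.coe_ne_top ENNReal.coe_ne_top)
        ENNReal.ofReal_ne_top) h1
    have h3' : 0 ≤ ‖f z‖ ^ 2 * Real.exp (-α * ‖z‖ ^ 2) := by positivity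
    rw [fockDensity, ENNReal.toReal_mul, ENNReal.toReal_ofReal h3', ENNReal.toReal_mul,
      ENNReal.toReal_mul, ENNReal.toReal_ofReal (sq_nonneg _)] at h3
    exact h3
  have h4 : ‖f z‖ ^ 2 ≤ A * ‖f‖ ^ 2 := by
    have h5 : Real.exp (-(α * R ^ 2)) ≤ Real.exp (-α * ‖z‖ ^ 2) := by
      rw [Real.exp_le_exp]
      have : ‖z‖ ^ 2 ≤ R ^ 2 := by gcongr
      nlinarith
    have h6 : ‖f z‖ ^ 2 * Real.exp (-(α * R ^ 2)) * v.toReal ≤ C * D * ‖f‖ ^ 2 :=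
      le_trans (by gcongr) h2
    rw [Real.exp_neg] at h6
    have h7 : 0 < Real.exp (α * R ^ 2) := Real.exp_pos _
    rw [hA, div_mul_eq_mul_div, div_mul_eq_mul_div, le_div_iff₀ hvr]
    have h8 := mul_le_mul_of_nonneg_left h6 h7.le
    calc ‖f z‖ ^ 2 * v.toReal = Real.exp (α * R ^ 2) *
          (‖f z‖ ^ 2 * (Real.exp (α * R ^ 2))⁻¹ * v.toReal) := by field_simp
      _ ≤ _ := h8
      _ = _ := by ring
  refine le_of_sq_le_sq ?_ (by positivity)
  rwa [mul_pow, Real.sq_sqrt hA0]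

/-- The global instance is only a seminorm; bounded point evaluations make it separating, which
opens the way to Hilbert space theory. -/
theorem eq_zero_of_norm_eq_zero (hα : 0 < α) (hw : w ∈ AResInfty) (f : FockSpace α w)
    (hf : ‖f‖ = 0) : f = 0 := by
  refine Subtype.ext (funext fun z => ?_)
  obtain ⟨K, _, hK⟩ := exists_norm_apply_le hα hw (‖z‖ + 1)
  have h1 := hK f z (by rw [mem_ball_zero_iff]; linarith)
  rw [hf, mul_zero] at h1
  exact norm_le_zero_iff.1 h1

/-- Norm Cauchy sequences are uniformly Cauchy on disks, so they have an entire pointwise limit;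
Fatou's lemma shows that it is also the limit in norm. -/
theorem completeSpace (hα : 0 < α) (hw : w ∈ AResInfty) : CompleteSpace (FockSpace α w) := by
  have hw' := isWeight_of_mem_AResInfty hw
  refine Metric.complete_of_cauchySeq_tendsto fun u hu => ?_
  rw [Metric.cauchySeq_iff] at hu
  have hbound : ∀ R : ℝ, UniformCauchySeqOn (fun n => (u n : ℂ → ℂ)) Filter.atTop
      (Metric.ball 0 R) := by
    intro R
    obtain ⟨K, hK0, hK⟩ := exists_norm_apply_le hα hw R
    rw [Metric.uniformCauchySeqOn_iff]
    intro ε hε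
    obtain ⟨N, hN⟩ := hu (ε / (K + 1)) (by positivity)
    refine ⟨N, fun j hj k hk z hz => ?_⟩
    have h1 := hK (u j - u k) z hz
    rw [sub_apply, ← dist_eq_norm] at h1
    have h2 := hN j hj k hk
    rw [dist_eq_norm, lt_div_iff₀ (by positivity)] at h2
    nlinarith [norm_nonneg (u j - u k)]
  have hpt : ∀ z : ℂ, ∃ y, Filter.Tendsto (fun n => u n z) Filter.atTop (nhds y) := fun z =>
    cauchySeq_tendsto_of_complete ((hbound (‖z‖ + 1)).cauchySeq (by
      rw [mem_ball_zero_iff]; linarith))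
  choose f hf using hpt
  have hunif : ∀ R : ℝ, TendstoUniformlyOn (fun n => (u n : ℂ → ℂ)) f Filter.atTop
      (Metric.ball 0 R) := fun R =>
    (hbound R).tendstoUniformlyOn_of_tendsto fun z _ => hf z
  have hloc : TendstoLocallyUniformlyOn (fun n => (u n : ℂ → ℂ)) f Filter.atTop Set.univ := by
    intro s hs z _
    refine ⟨Metric.ball 0 (‖z‖ + 1), ?_, hunif _ s hs⟩
    rw [nhdsWithin_univ]
    exact Metric.isOpen_ball.mem_nhds (by rw [mem_ball_zero_iff]; linarith)
  have hfd : Differentiable ℂ f := by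
    rw [← differentiableOn_univ]
    exact hloc.differentiableOn (Filter.Eventually.of_forall fun n =>
      (u n).differentiable.differentiableOn) isOpen_univ
  have hlim : ∀ ε : ℝ, 0 < ε → ∃ N, ∀ n ≥ N,
      ∫⁻ z, fockDensity α (fun z => f z - u n z) z ∂(weightMeasure w) ≤ ENNReal.ofReal (ε ^ 2) := by
    intro ε hε
    obtain ⟨N, hN⟩ := hu ε hε
    refine ⟨N, fun n hn => ?_⟩
    have h1 : ∀ z, fockDensity α (fun z => f z - u n z) z =
        Filter.liminf (fun k => fockDensity α (u k - u n : FockSpace α w) z) Filter.atTop := by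
      intro z
      symm
      apply Filter.Tendsto.liminf_eq
      have h2 : Filter.Tendsto (fun k => ‖u k z - u n z‖ ^ 2 * Real.exp (-α * ‖z‖ ^ 2))
          Filter.atTop (nhds (‖f z - u n z‖ ^ 2 * Real.exp (-α * ‖z‖ ^ 2))) :=
        ((((hf z).sub_const _).norm).pow 2).mul_const _
      exact ENNReal.tendsto_ofReal h2
    simp only [h1]
    refine (lintegral_liminf_le fun k => measurable_fockDensity _).trans ?_
    refine Filter.liminf_le_of_frequently_le' (Filter.Eventually.frequently ?_)
    filter_upwards [Filter.eventually_ge_atTop N] with k hk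
    rw [← ofReal_norm_sq hw', ← dist_eq_norm]
    have := (hN k hk n hn).le
    gcongr
  obtain ⟨N, hN⟩ := hlim 1 one_pos
  have hsub : ∀ n, Differentiable ℂ fun z => f z - u n z := fun n => hfd.sub (u n).differentiable
  have hmemN : MemLp (fun z => f z - u N z) 2 (fockMeasure α w) :=
    (memLp_iff α hw' (hsub N)).2 (lt_of_le_of_lt (hN N le_rfl) ENNReal.ofReal_lt_top)
  have hmem : MemLp f 2 (fockMeasure α w) := by
    have := hmemN.add (u N).2.2
    refine this.ae_eq (Filter.Eventually.of_forall fun z => ?_)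
    exact sub_add_cancel _ _
  refine ⟨mk f hfd hmem, ?_⟩
  rw [Metric.tendsto_atTop]
  intro ε hε
  obtain ⟨N, hN⟩ := hlim (ε / 2) (by positivity)
  refine ⟨N, fun n hn => ?_⟩
  rw [dist_comm, dist_eq_norm]
  set g : FockSpace α w := mk f hfd hmem with hg
  have h1 : ENNReal.ofReal (‖g - u n‖ ^ 2) ≤ ENNReal.ofReal ((ε / 2) ^ 2) := by
    rw [ofReal_norm_sq hw']
    exact hN n hn
  rw [ENNReal.ofReal_le_ofReal_iff (by positivity)] at h1
  have h2 := le_of_sq_le_sq h1 (by positivity)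
  linarith

/-- The norm of the weighted Fock space is separating. -/
@[reducible]
noncomputable def normedAddCommGroup (hα : 0 < α) (hw : w ∈ AResInfty) :
    NormedAddCommGroup (FockSpace α w) :=
  NormedAddCommGroup.ofSeparation (eq_zero_of_norm_eq_zero hα hw)

theorem exists_evaluation (hα : 0 < α) (hw : w ∈ AResInfty) (z : ℂ) :
    ∃ ℓ : FockSpace α w →L[ℂ] ℂ, ∀ f, ℓ f = f z := by
  obtain ⟨K, _, hK⟩ := exists_norm_apply_le hα hw (‖z‖ + 1)
  let ℓ : FockSpace α w →ₗ[ℂ] ℂ :=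
    { toFun := fun f => f z
      map_add' := fun _ _ => rfl
      map_smul' := fun _ _ => rfl }
  exact ⟨ℓ.mkContinuous K fun f => hK f z (by rw [mem_ball_zero_iff]; linarith), fun f => rfl⟩

theorem exists_kernel (hα : 0 < α) (hw : w ∈ AResInfty) (z : ℂ) :
    ∃ B : FockSpace α w, ∀ f : FockSpace α w, f z = inner ℂ B f := by
  obtain ⟨ℓ, hℓ⟩ := exists_evaluation hα hw z
  let := normedAddCommGroup hα hw
  have := completeSpace hα hw
  refine ⟨(InnerProductSpace.toDual ℂ (FockSpace α w)).symm ℓ, fun f => ?_⟩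
  rw [← hℓ f]
  exact (InnerProductSpace.toDual_symm_apply).symm

/-- The default branch of `kernel` never occurs here. -/
theorem apply_eq_inner (hα : 0 < α) (hw : w ∈ AResInfty) (f : FockSpace α w) (z : ℂ) :
    f z = inner ℂ (kernel α w z) f := by
  have h := exists_kernel hα hw z
  rw [kernel, dif_pos h]
  exact h.choose_spec f

end FockSpace

end WeightedFock

/-! ### Size of the reproducing kernel on and near the diagonal -/

namespace WeightedFock

open FockSpace

variable {α : ℝ} {w : ℂ → ℝ}

/-- The quantity `‖B^w_z‖² e^{-α|z|²}`. -/
noncomputable def kernelDiag (α : ℝ) (w : ℂ → ℝ) (z : ℂ) : ℝ≥0∞ :=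
  ENNReal.ofReal (‖kernel α w z‖ ^ 2 * Real.exp (-α * ‖z‖ ^ 2))

theorem kernelDiag_ne_top (z : ℂ) : kernelDiag α w z ≠ ∞ := ENNReal.ofReal_ne_top

theorem kernel_self (hα : 0 < α) (hw : w ∈ AResInfty) (z : ℂ) :
    kernel α w z z = ((‖kernel α w z‖ ^ 2 : ℝ) : ℂ) := by
  rw [apply_eq_inner hα hw, inner_self_eq_norm_sq_to_K]
  simp

theorem kernel_conj (hα : 0 < α) (hw : w ∈ AResInfty) (z ξ : ℂ) :
    kernel α w z ξ = conj (kernel α w ξ z) := by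
  rw [apply_eq_inner hα hw (kernel α w z) ξ, apply_eq_inner hα hw (kernel α w ξ) z]
  exact (inner_conj_symm _ _).symm

/-- The mean value estimate for `f = B_z` at `z`: since `B_z(z) = ‖B_z‖²`, one factor `‖B_z‖²`
cancels. -/
theorem exists_kernelDiag_mul_le (hα : 0 < α) (hw : w ∈ AResInfty) {r : ℝ} (hr : 0 < r) :
    ∃ C : ℝ≥0, ∀ z, kernelDiag α w z * weightMeasure w (Metric.ball z r) ≤ C := by
  obtain ⟨C, hC⟩ := exists_fockDensity_mul_le hα hw hr
  refine ⟨C, fun z => ?_⟩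
  set B := kernel α w z with hB
  rcases eq_or_lt_of_le (norm_nonneg B) with h0 | h0
  · rw [kernelDiag, ← hB, ← h0]; simp
  have h1 := hC B z
  set P := ENNReal.ofReal (‖B‖ ^ 2) with hP
  have hP0 : P ≠ 0 := by rw [hP, Ne, ENNReal.ofReal_eq_zero, not_le]; positivity
  have hPt : P ≠ ∞ := ENNReal.ofReal_ne_top
  have h2 : fockDensity α B z = P * kernelDiag α w z := by
    rw [fockDensity, hB, kernel_self hα hw, ← hB, kernelDiag, hP,
      ← ENNReal.ofReal_mul (sq_nonneg _), ← hB]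
    congr 1
    rw [Complex.norm_real, Real.norm_of_nonneg (sq_nonneg _)]
    ring
  rw [h2, mul_assoc, mul_comm (C : ℝ≥0∞)] at h1
  exact (ENNReal.mul_le_mul_iff_right hP0 hPt).1 h1

/-- The entire function with `|f(ξ)|² e^{-α|ξ|²} = e^{-α|ξ-z|²}`. -/
theorem fockDensity_exp (α : ℝ) (z ξ : ℂ) :
    fockDensity α (fun ξ => Complex.exp (α * conj z * ξ - α * ‖z‖ ^ 2 / 2)) ξ =
      ENNReal.ofReal (Real.exp (-α * ‖ξ - z‖ ^ 2)) := by
  set f : ℂ → ℂ := fun ξ => Complex.exp (α * conj z * ξ - α * ‖z‖ ^ 2 / 2) with hf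
  have h1 : gaugeTwist α f z ξ = 1 := by
    rw [gaugeTwist, hf, ← Complex.exp_add]
    have : (α * conj z * ξ - α * ‖z‖ ^ 2 / 2 + (-α * conj z * ξ + α * ‖z‖ ^ 2 / 2) : ℂ) = 0 := by
      ring
    simp only [this, Complex.exp_zero]
  have h2 := norm_gaugeTwist_sq α f z ξ
  rw [h1, norm_one, one_pow] at h2
  rw [fockDensity]
  congr 1
  rw [neg_mul α (‖ξ - z‖ ^ 2), Real.exp_neg]
  exact eq_inv_of_mul_eq_one_left h2.symm

/-- The test function has density `1` at `z`, while its squared norm, a Gaussian integral, is at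
most a multiple of `w(D(z,r))`. Together with the upper bound, `kernelDiag α w z ≍ 1 / w(D(z,r))`.
-/
theorem exists_one_le_kernelDiag_mul (hα : 0 < α) (hw : w ∈ AResInfty) {r : ℝ} (hr : 0 < r) :
    ∃ C : ℝ≥0, ∀ z, 1 ≤ C * (kernelDiag α w z * weightMeasure w (Metric.ball z r)) := by
  obtain ⟨C, hC⟩ := (locallyDoubling_weightMeasure hw).exists_lintegral_gaussian_le hα hr
  have hw' := isWeight_of_mem_AResInfty hw
  have hm := locallyDoubling_weightMeasure hw
  refine ⟨C, fun z => ?_⟩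
  set f : ℂ → ℂ := fun ξ => Complex.exp (α * conj z * ξ - α * ‖z‖ ^ 2 / 2) with hf
  have hfd : Differentiable ℂ f := by rw [hf]; fun_prop
  have hfi : ∫⁻ ξ, fockDensity α f ξ ∂(weightMeasure w) ≤
      C * weightMeasure w (Metric.ball z r) := by
    simp only [hf, fockDensity_exp]; exact hC z
  set g : FockSpace α w := FockSpace.mk f hfd ((memLp_iff α hw' hfd).2
    (lt_of_le_of_lt hfi (ENNReal.mul_lt_top ENNReal.coe_lt_top (hm.lt_top z r)))) with hg
  have h1 : ENNReal.ofReal (‖g‖ ^ 2) ≤ C * weightMeasure w (Metric.ball z r) := by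
    rw [ofReal_norm_sq hw']; exact hfi
  have h2 : ‖f z‖ ^ 2 ≤ ‖kernel α w z‖ ^ 2 * ‖g‖ ^ 2 := by
    have h3 : f z = inner ℂ (kernel α w z) g := apply_eq_inner hα hw g z
    rw [h3, ← mul_pow]
    gcongr
    exact norm_inner_le_norm _ _
  have h4 : fockDensity α f z = 1 := by simp only [hf, fockDensity_exp]; simp
  calc 1 = fockDensity α f z := h4.symm
    _ ≤ ENNReal.ofReal (‖kernel α w z‖ ^ 2 * ‖g‖ ^ 2 * Real.exp (-α * ‖z‖ ^ 2)) := by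
        rw [fockDensity]; gcongr
    _ = kernelDiag α w z * ENNReal.ofReal (‖g‖ ^ 2) := by
        rw [kernelDiag, ← ENNReal.ofReal_mul (by positivity)]; congr 1; ring
    _ ≤ kernelDiag α w z * (C * weightMeasure w (Metric.ball z r)) := mul_le_mul_right h1 _
    _ = _ := by ring

theorem kernelDiag_ne_zero (hα : 0 < α) (hw : w ∈ AResInfty) (z : ℂ) : kernelDiag α w z ≠ 0 := by
  obtain ⟨C, hC⟩ := exists_one_le_kernelDiag_mul hα hw one_pos
  intro h
  have := hC z
  rw [h] at this
  simp at this

theorem norm_kernel_pos (hα : 0 < α) (hw : w ∈ AResInfty) (z : ℂ) : 0 < ‖kernel α w z‖ := by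
  refine lt_of_le_of_ne (norm_nonneg _) fun h => kernelDiag_ne_zero hα hw z ?_
  rw [kernelDiag, ← h]; simp

theorem norm_normKernel (hα : 0 < α) (hw : w ∈ AResInfty) (z : ℂ) : ‖normKernel α w z‖ = 1 := by
  have h := norm_kernel_pos hα hw z
  rw [normKernel, norm_smul, Complex.norm_real, norm_inv, norm_norm, inv_mul_cancel₀ h.ne']

theorem ofReal_norm_inner_normKernel_sq (hα : 0 < α) (hw : w ∈ AResInfty) (f : FockSpace α w)
    (z : ℂ) : ENNReal.ofReal (‖inner ℂ (normKernel α w z) f‖ ^ 2) =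
      fockDensity α f z * (kernelDiag α w z)⁻¹ := by
  have h := norm_kernel_pos hα hw z
  rw [normKernel, inner_smul_left, ← apply_eq_inner hα hw, fockDensity, kernelDiag,
    ← ENNReal.ofReal_inv_of_pos (by positivity), ← ENNReal.ofReal_mul (by positivity)]
  congr 1
  rw [Complex.conj_ofReal, norm_mul, Complex.norm_real, norm_inv, norm_norm, mul_pow]
  have := Real.exp_pos (-α * ‖z‖ ^ 2)
  field_simp

/-- The symmetry of the kernel. -/
theorem fockDensity_normKernel (hα : 0 < α) (hw : w ∈ AResInfty) (z ζ : ℂ) :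
    fockDensity α (normKernel α w z) ζ = ENNReal.ofReal (Real.exp (-α * ‖ζ‖ ^ 2)) *
      (fockDensity α (kernel α w ζ) z * (kernelDiag α w z)⁻¹) := by
  have h := norm_kernel_pos hα hw z
  rw [fockDensity, fockDensity, normKernel, smul_apply, kernel_conj hα hw z ζ, kernelDiag,
    ← ENNReal.ofReal_inv_of_pos (by positivity), ← ENNReal.ofReal_mul (by positivity),
    ← ENNReal.ofReal_mul (by positivity)]
  congr 1
  rw [norm_mul, Complex.norm_real, norm_inv, norm_norm, mul_pow, RCLike.norm_conj]
  have := Real.exp_pos (-α * ‖z‖ ^ 2)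
  field_simp

/-- The kernel is continuous in `ζ`, and by conjugate symmetry in `z` too, hence jointly measurable;
the norm of `B_z` is read off from `B_z(z)`. -/
theorem measurable_kernelDiag_and_kernel (hα : 0 < α) (hw : w ∈ AResInfty) :
    Measurable (kernelDiag α w) ∧ Measurable (Function.uncurry fun z ζ : ℂ => kernel α w z ζ) := by
  have h1 : Measurable (Function.uncurry fun ζ z : ℂ => kernel α w z ζ) := by
    refine measurable_uncurry_of_continuous_of_measurable
      (fun z => (kernel α w z).differentiable.continuous) fun ζ => ?_
    simp only [kernel_conj hα hw _ ζ]
    have := (kernel α w ζ).differentiable.continuous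
    fun_prop
  have h2 : Measurable (Function.uncurry fun z ζ : ℂ => kernel α w z ζ) :=
    h1.comp measurable_swap
  refine ⟨?_, h2⟩
  have h3 : Measurable fun z : ℂ => kernel α w z z :=
    h2.comp (measurable_id.prodMk measurable_id)
  have h4 : kernelDiag α w =
      fun z => ENNReal.ofReal ((kernel α w z z).re * Real.exp (-α * ‖z‖ ^ 2)) := by
    ext z
    rw [kernel_self hα hw, Complex.ofReal_re, kernelDiag]
  rw [h4]
  fun_prop

theorem measurable_fockDensity_normKernel (hα : 0 < α) (hw : w ∈ AResInfty) :
    Measurable (Function.uncurry fun z ζ : ℂ => fockDensity α (normKernel α w z) ζ) := by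
  obtain ⟨h1, h2⟩ := measurable_kernelDiag_and_kernel hα hw
  have h3 : (Function.uncurry fun z ζ : ℂ => fockDensity α (normKernel α w z) ζ) = fun q =>
      ENNReal.ofReal (Real.exp (-α * ‖q.2‖ ^ 2)) *
      (ENNReal.ofReal (‖Function.uncurry (fun z ζ : ℂ => kernel α w z ζ) q.swap‖ ^ 2 *
        Real.exp (-α * ‖q.1‖ ^ 2)) * (kernelDiag α w q.1)⁻¹) := by
    ext ⟨z, ζ⟩
    exact fockDensity_normKernel hα hw z ζ
  rw [h3]
  have h4 := h2.comp (measurable_swap (α := ℂ) (β := ℂ))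
  have h5 : Measurable fun q : ℂ × ℂ => kernelDiag α w q.1 := h1.comp measurable_fst
  have h6 : Measurable fun q : ℂ × ℂ =>
      ‖Function.uncurry (fun z ζ : ℂ => kernel α w z ζ) q.swap‖ := h4.norm
  refine Measurable.mul (by fun_prop) (Measurable.mul ?_ h5.inv)
  fun_prop

/-- The integrand is `|⟨f, b_z⟩|²`, so this is a Bessel type bound for the continuous family `b_z`.
It follows from `1 / kernelDiag ≲ w(D(z,1))` and the mean value property. -/
theorem exists_lintegral_div_kernelDiag_le (hα : 0 < α) (hw : w ∈ AResInfty) :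
    ∃ C : ℝ≥0, ∀ f : FockSpace α w,
      ∫⁻ z, fockDensity α f z * (kernelDiag α w z)⁻¹ ≤ C * ENNReal.ofReal (‖f‖ ^ 2) := by
  have hm := locallyDoubling_weightMeasure hw
  obtain ⟨C, hC⟩ := exists_one_le_kernelDiag_mul hα hw one_pos
  obtain ⟨D, hD⟩ := hm.exists_fockDensity_mul_le hα one_pos
  set V := volume (Metric.ball (0 : ℂ) 1) with hV
  have hVt : V ≠ ∞ := measure_ball_lt_top.ne
  refine ⟨C * (D * V.toNNReal), fun f => ?_⟩
  push_cast
  rw [ENNReal.coe_toNNReal hVt]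
  calc ∫⁻ z, fockDensity α f z * (kernelDiag α w z)⁻¹
      ≤ ∫⁻ z, C * (fockDensity α f z * weightMeasure w (Metric.ball z 1)) := by
        refine lintegral_mono fun z => ?_
        calc fockDensity α f z * (kernelDiag α w z)⁻¹
            ≤ fockDensity α f z * (kernelDiag α w z)⁻¹ *
                (C * (kernelDiag α w z * weightMeasure w (Metric.ball z 1))) :=
              le_mul_of_one_le_right' (hC z)
          _ = C * (fockDensity α f z * weightMeasure w (Metric.ball z 1)) *
                ((kernelDiag α w z)⁻¹ * kernelDiag α w z) := by ring
          _ = _ := by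
              rw [ENNReal.inv_mul_cancel (kernelDiag_ne_zero hα hw z) (kernelDiag_ne_top z),
                mul_one]
    _ = C * ∫⁻ z, fockDensity α f z * weightMeasure w (Metric.ball z 1) :=
        lintegral_const_mul' _ _ ENNReal.coe_ne_top
    _ ≤ C * (D * V * ∫⁻ ζ, fockDensity α f ζ ∂(weightMeasure w)) :=
        mul_le_mul_right (hm.lintegral_mul_measure_ball_le f.measurable_fockDensity
          (hD f f.differentiable)) _
    _ = _ := by rw [ofReal_norm_sq (isWeight_of_mem_AResInfty hw)]; ring

/-- By the symmetry of the kernel this is the preceding bound for `f = B_ζ`, which produces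
`kernelDiag α w ζ`. -/
theorem exists_lintegral_fockDensity_normKernel_le (hα : 0 < α) (hw : w ∈ AResInfty) {s : ℝ}
    (hs : 0 < s) : ∃ C : ℝ≥0, ∀ ζ, ∫⁻ z, fockDensity α (normKernel α w z) ζ ≤
      C * (weightMeasure w (Metric.ball ζ s))⁻¹ := by
  have hm := locallyDoubling_weightMeasure hw
  obtain ⟨C, hC⟩ := exists_lintegral_div_kernelDiag_le hα hw
  obtain ⟨D, hD⟩ := exists_kernelDiag_mul_le hα hw hs
  refine ⟨C * D, fun ζ => ?_⟩
  simp only [fockDensity_normKernel hα hw]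
  rw [lintegral_const_mul' _ _ ENNReal.ofReal_ne_top]
  calc ENNReal.ofReal (Real.exp (-α * ‖ζ‖ ^ 2)) *
        ∫⁻ z, fockDensity α (kernel α w ζ) z * (kernelDiag α w z)⁻¹
      ≤ ENNReal.ofReal (Real.exp (-α * ‖ζ‖ ^ 2)) *
          (C * ENNReal.ofReal (‖kernel α w ζ‖ ^ 2)) := mul_le_mul_right (hC _) _
    _ = C * kernelDiag α w ζ := by
        rw [kernelDiag, ENNReal.ofReal_mul (sq_nonneg _)]; ring
    _ ≤ C * (D * (weightMeasure w (Metric.ball ζ s))⁻¹) := by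
        refine mul_le_mul_right ?_ _
        rw [← div_eq_mul_inv, ENNReal.le_div_iff_mul_le (Or.inl (hm.pos ζ s hs).ne')
          (Or.inl (hm.lt_top ζ s).ne)]
        exact hD ζ
    _ = _ := by push_cast; ring

/-- The lower bound for the kernel near the diagonal. -/
theorem exists_kernelDiag_le_fockDensity (hα : 0 < α) (hw : w ∈ AResInfty) :
    ∃ δ ∈ Set.Ioo (0 : ℝ) 1, ∃ C : ℝ≥0, ∀ z ξ : ℂ, ‖ξ - z‖ ≤ δ →
      kernelDiag α w z ≤ C * fockDensity α (normKernel α w z) ξ := by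
  have hm := locallyDoubling_weightMeasure hw
  obtain ⟨C₁, hC₁⟩ := exists_fockDensity_mul_le hα hw one_pos
  obtain ⟨C₂, hC₂⟩ := exists_one_le_kernelDiag_mul hα hw one_pos
  obtain ⟨D, hD⟩ := hm.exists_comparable (d := 1) (r := 1) (s := 1) one_pos one_pos
  -- Chosen so that the twisted `b_z` is bounded on `D(z,1)` by `K` times its modulus at `z`: the
  -- factor `C₂ * D * C₁` comes from `hup`, and `e^α` from the twist.
  set K : ℝ := Real.sqrt (C₂ * D * C₁ * Real.exp α) with hK
  have hK0 : 0 ≤ K := Real.sqrt_nonneg _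
  have hdiag : ∀ z, fockDensity α (normKernel α w z) z = kernelDiag α w z := by
    intro z
    have h := norm_kernel_pos hα hw z
    rw [fockDensity, kernelDiag, normKernel, smul_apply, kernel_self hα hw]
    congr 2
    rw [norm_mul, Complex.norm_real, Complex.norm_real, norm_inv, norm_norm, norm_pow, norm_norm]
    field_simp
  have hup : ∀ z ξ : ℂ, ‖ξ - z‖ ≤ 1 → fockDensity α (normKernel α w z) ξ ≤
      C₂ * D * C₁ * kernelDiag α w z := by
    intro z ξ hξ
    set X := fockDensity α (normKernel α w z) ξ with hX
    calc X ≤ X * (C₂ * (kernelDiag α w z * weightMeasure w (Metric.ball z 1))) :=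
          le_mul_of_one_le_right' (hC₂ z)
      _ ≤ X * (C₂ * (kernelDiag α w z * (D * weightMeasure w (Metric.ball ξ 1)))) := by
          gcongr X * (_ * (_ * ?_))
          exact hD z ξ (by rwa [norm_sub_rev])
      _ = C₂ * D * kernelDiag α w z * (X * weightMeasure w (Metric.ball ξ 1)) := by ring
      _ ≤ C₂ * D * kernelDiag α w z * (C₁ * ENNReal.ofReal (‖normKernel α w z‖ ^ 2)) :=
          mul_le_mul_right (hC₁ _ _) _
      _ = _ := by rw [norm_normKernel hα hw]; simp; ring
  have hδ : 1 / (2 * (K + 2)) < 1 := by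
    rw [div_lt_one (by positivity)]; linarith
  -- The radius `δ` is that of `half_norm_le_of_norm_le` with `ρ = 1`. In the constant, `4` comes
  -- from squaring one half and `e^α` from undoing the twist.
  refine ⟨1 / (2 * (K + 2)), ⟨by positivity, hδ⟩, (4 * Real.exp α).toNNReal, fun z ξ hξ => ?_⟩
  set G := gaugeTwist α (normKernel α w z) z with hG
  have hGd : Differentiable ℂ G := differentiable_gaugeTwist α (normKernel α w z).differentiable z
  have hGle : ∀ η : ℂ, ‖η - z‖ ≤ 1 →
      ‖G η‖ ^ 2 ≤ ‖normKernel α w z η‖ ^ 2 * Real.exp (-α * ‖η‖ ^ 2) * Real.exp α := by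
    intro η hη
    rw [hG, norm_gaugeTwist_sq]
    gcongr
    have : ‖η - z‖ ^ 2 ≤ 1 := pow_le_one₀ (norm_nonneg _) hη
    nlinarith
  have hGz : ‖G z‖ ^ 2 = ‖kernel α w z‖ ^ 2 * Real.exp (-α * ‖z‖ ^ 2) := by
    have h1 := hdiag z
    rw [fockDensity, kernelDiag, ENNReal.ofReal_eq_ofReal_iff (by positivity) (by positivity)] at h1
    rw [hG, norm_gaugeTwist_sq, h1]
    simp
  have hbound : ∀ η ∈ Metric.ball z 1, ‖G η‖ ≤ K * ‖G z‖ := by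
    intro η hη
    have hη' : ‖η - z‖ ≤ 1 := by rw [← dist_eq_norm]; exact (Metric.mem_ball.1 hη).le
    refine le_of_sq_le_sq ?_ (by positivity)
    rw [mul_pow, hK, Real.sq_sqrt (by positivity), hGz]
    refine (hGle η hη').trans ?_
    have h1 : ‖normKernel α w z η‖ ^ 2 * Real.exp (-α * ‖η‖ ^ 2) ≤
        C₂ * D * C₁ * (‖kernel α w z‖ ^ 2 * Real.exp (-α * ‖z‖ ^ 2)) := by
      have h2 := hup z η hη'
      rw [fockDensity, kernelDiag] at h2
      have h3 : (C₂ * D * C₁ : ℝ≥0∞) = ENNReal.ofReal (C₂ * D * C₁ : ℝ) := by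
        rw [ENNReal.ofReal_mul (by positivity), ENNReal.ofReal_mul (by positivity)]
        simp
      rw [h3, ← ENNReal.ofReal_mul (by positivity),
        ENNReal.ofReal_le_ofReal_iff (by positivity)] at h2
      exact h2
    have := mul_le_mul_of_nonneg_right h1 (Real.exp_pos α).le
    linarith
  have hhalf := half_norm_le_of_norm_le hGd one_pos hK0 hbound hξ
  have h1 : ‖G z‖ ^ 2 ≤ 4 * ‖G ξ‖ ^ 2 := by
    have : (‖G z‖ / 2) ^ 2 ≤ ‖G ξ‖ ^ 2 := by gcongr
    linarith
  have h2 := hGle ξ (hξ.trans hδ.le)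
  change _ ≤ ENNReal.ofReal _ * _
  rw [kernelDiag, fockDensity, ← ENNReal.ofReal_mul (by positivity), ← hGz]
  apply ENNReal.ofReal_le_ofReal
  linarith

end WeightedFock

/-! ### Berezin transforms, averages and diagonal sums -/

namespace WeightedFock

open FockSpace

variable {α : ℝ} {w : ℂ → ℝ}

/-- The disk averages are dominated by the Berezin transform. -/
theorem exists_average_le_berezin (hα : 0 < α) (hw : w ∈ AResInfty) :
    ∃ δ ∈ Set.Ioo (0 : ℝ) 1, ∀ r ∈ Set.Ioo 0 δ, ∃ C : ℝ≥0, ∀ (μ : Measure ℂ) (z : ℂ),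
      average w r μ z ≤ C * berezin α w μ z := by
  have hm := locallyDoubling_weightMeasure hw
  obtain ⟨δ, hδ, C, hC⟩ := exists_kernelDiag_le_fockDensity hα hw
  refine ⟨δ, hδ, fun r hr => ?_⟩
  obtain ⟨D, hD⟩ := exists_one_le_kernelDiag_mul hα hw hr.1
  refine ⟨D * C, fun μ z => ?_⟩
  set X := weightMeasure w (Metric.ball z r) with hX
  have hX0 : X ≠ 0 := (hm.pos z r hr.1).ne'
  have hXt : X ≠ ∞ := (hm.lt_top z r).ne
  have h1 : kernelDiag α w z * μ (Metric.ball z r) ≤ C * berezin α w μ z := by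
    calc kernelDiag α w z * μ (Metric.ball z r)
        = ∫⁻ _ in Metric.ball z r, kernelDiag α w z ∂μ := (setLIntegral_const _ _).symm
      _ ≤ ∫⁻ ξ in Metric.ball z r, C * fockDensity α (normKernel α w z) ξ ∂μ := by
          refine setLIntegral_mono' measurableSet_ball fun ξ hξ => hC z ξ ?_
          rw [← dist_eq_norm]
          exact (Metric.mem_ball.1 hξ).le.trans hr.2.le
      _ ≤ ∫⁻ ξ, C * fockDensity α (normKernel α w z) ξ ∂μ := setLIntegral_le_lintegral _ _
      _ = _ := lintegral_const_mul' _ _ ENNReal.coe_ne_top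
  rw [average, ENNReal.div_le_iff hX0 hXt]
  calc μ (Metric.ball z r) ≤ μ (Metric.ball z r) * (D * (kernelDiag α w z * X)) :=
        le_mul_of_one_le_right' (hD z)
    _ = D * (kernelDiag α w z * μ (Metric.ball z r)) * X := by ring
    _ ≤ D * (C * berezin α w μ z) * X := by gcongr D * ?_ * X
    _ = _ := by push_cast; ring

theorem measurable_berezin (hα : 0 < α) (hw : w ∈ AResInfty) (μ : Measure ℂ) [SFinite μ] :
    Measurable (berezin α w μ) :=
  (measurable_fockDensity_normKernel hα hw).lintegral_prod_right'

theorem measurable_average (hw : w ∈ AResInfty) (r : ℝ) (μ : Measure ℂ) [SFinite μ] :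
    Measurable (average w r μ) := by
  have := (locallyDoubling_weightMeasure hw).sigmaFinite
  exact (measurable_measure_ball μ r).div (measurable_measure_ball (weightMeasure w) r)

/-- If `μ` is infinite on all neighbourhoods of `x`, the averages are infinite on all of `D(x,r)`.
This supplies the s-finiteness that Tonelli and measurability need, for an arbitrary Borel measure
`μ`. -/
theorem isLocallyFiniteMeasure_of_lintegral_average (hw : w ∈ AResInfty) {r p : ℝ} (hr : 0 < r)
    (hp : 0 < p) {μ : Measure ℂ} (h : ∫⁻ z, average w r μ z ^ p ≠ ∞) :
    IsLocallyFiniteMeasure μ := by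
  have hm := locallyDoubling_weightMeasure hw
  refine ⟨fun x => ?_⟩
  by_contra hcon
  have h1 : ∀ z ∈ Metric.ball x r, average w r μ z ^ p = ∞ := by
    intro z hz
    have h2 : μ (Metric.ball z r) = ∞ := by
      by_contra h3
      exact hcon ⟨Metric.ball z r, Metric.isOpen_ball.mem_nhds
        (by rw [Metric.mem_ball, dist_comm]; exact hz), lt_top_iff_ne_top.2 h3⟩
    rw [average, h2, ENNReal.top_div_of_ne_top (hm.lt_top z r).ne, ENNReal.top_rpow_of_pos hp]
  refine h (top_le_iff.1 ?_)
  calc ∞ = ∞ * volume (Metric.ball x r) :=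
        (ENNReal.top_mul (Metric.measure_ball_pos volume x hr).ne').symm
    _ = ∫⁻ _ in Metric.ball x r, ∞ := (setLIntegral_const _ _).symm
    _ ≤ ∫⁻ z in Metric.ball x r, average w r μ z ^ p :=
        setLIntegral_mono' measurableSet_ball fun z hz => (h1 z hz).ge
    _ ≤ _ := setLIntegral_le_lintegral _ _

theorem exists_carleson (hα : 0 < α) (hw : w ∈ AResInfty) {s : ℝ} (hs : 0 < s) :
    ∃ D : ℝ≥0, ∀ (μ : Measure ℂ) [SFinite μ] (f : FockSpace α w),
      ∫⁻ z, fockDensity α f z ∂μ ≤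
        D * ∫⁻ ζ, average w s μ ζ * fockDensity α f ζ ∂(weightMeasure w) := by
  have hm := locallyDoubling_weightMeasure hw
  obtain ⟨C, hC⟩ := hm.exists_fockDensity_mul_le hα hs
  obtain ⟨D, hD⟩ := hm.exists_lintegral_le hs C
  exact ⟨D, fun μ _ f => hD μ _ f.measurable_fockDensity (hC f f.differentiable)⟩

/-- For a unit vector, `|f|² e^{-α|·|²} w dA` is a probability measure, so Jensen moves the power
inside the Carleson estimate. -/
theorem exists_rpow_carleson (hα : 0 < α) (hw : w ∈ AResInfty) {s p : ℝ} (hs : 0 < s)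
    (hp : 1 ≤ p) :
    ∃ D : ℝ≥0, ∀ (μ : Measure ℂ) [SFinite μ] (f : FockSpace α w), ‖f‖ = 1 →
      (∫⁻ z, fockDensity α f z ∂μ) ^ p ≤
        D * ∫⁻ ζ, average w s μ ζ ^ p * fockDensity α f ζ ∂(weightMeasure w) := by
  have hp0 : 0 ≤ p := by linarith
  obtain ⟨D, hD⟩ := exists_carleson hα hw hs
  refine ⟨D ^ p, fun μ _ f hf => ?_⟩
  rw [ENNReal.coe_rpow_of_nonneg _ hp0]
  calc (∫⁻ z, fockDensity α f z ∂μ) ^ p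
      ≤ (D * ∫⁻ ζ, average w s μ ζ * fockDensity α f ζ ∂(weightMeasure w)) ^ p :=
        ENNReal.rpow_le_rpow (hD μ f) hp0
    _ = (D : ℝ≥0∞) ^ p *
          (∫⁻ ζ, average w s μ ζ * fockDensity α f ζ ∂(weightMeasure w)) ^ p :=
        ENNReal.mul_rpow_of_nonneg _ _ hp0
    _ ≤ _ := by
        refine mul_le_mul_right (rpow_lintegral_mul_le _ (measurable_average hw s μ)
          f.measurable_fockDensity ?_ hp) _
        rw [← ofReal_norm_sq (isWeight_of_mem_AResInfty hw), hf]
        simp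

/-- The Berezin transform is dominated in `L^p` by the disk averages. -/
theorem exists_lintegral_berezin_le (hα : 0 < α) (hw : w ∈ AResInfty) {r p : ℝ} (hr : 0 < r)
    (hp : 1 ≤ p) :
    ∃ C : ℝ≥0, ∀ (μ : Measure ℂ) [SFinite μ],
      ∫⁻ z, berezin α w μ z ^ p ≤ C * ∫⁻ z, average w r μ z ^ p := by
  have hm := locallyDoubling_weightMeasure hw
  have := hm.sigmaFinite
  have hp0 : 0 ≤ p := by linarith
  -- `exists_lintegral_average_le` doubles the radius, so starting from `r / 2` ends at `r`.
  have hs : 0 < r / 2 := by positivity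
  obtain ⟨C₁, hC₁⟩ := exists_rpow_carleson hα hw hs hp
  obtain ⟨C₂, hC₂⟩ := exists_lintegral_fockDensity_normKernel_le hα hw hs
  obtain ⟨C₃, hC₃⟩ := hm.exists_lintegral_average_le hs hp0
  rw [mul_div_cancel₀ r two_ne_zero] at hC₃
  refine ⟨C₁ * C₂ * C₃, fun μ _ => ?_⟩
  have hmeas : Measurable (Function.uncurry fun z ζ : ℂ =>
      average w (r / 2) μ ζ ^ p * fockDensity α (normKernel α w z) ζ) :=
    (((measurable_average hw (r / 2) μ).pow_const p).comp measurable_snd).mul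
      (measurable_fockDensity_normKernel hα hw)
  calc ∫⁻ z, berezin α w μ z ^ p
      ≤ ∫⁻ z, C₁ * (∫⁻ ζ, average w (r / 2) μ ζ ^ p * fockDensity α (normKernel α w z) ζ
          ∂(weightMeasure w)) :=
        lintegral_mono fun z => hC₁ μ _ (norm_normKernel hα hw z)
    _ = C₁ * ∫⁻ ζ, ∫⁻ z, average w (r / 2) μ ζ ^ p * fockDensity α (normKernel α w z) ζ
          ∂volume ∂(weightMeasure w) := by
        rw [lintegral_const_mul' _ _ ENNReal.coe_ne_top,
          lintegral_lintegral_swap hmeas.aemeasurable]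
    _ = C₁ * ∫⁻ ζ, average w (r / 2) μ ζ ^ p * (∫⁻ z, fockDensity α (normKernel α w z) ζ)
          ∂(weightMeasure w) := by
        congr 1
        refine lintegral_congr fun ζ => ?_
        have h1 : Measurable fun z : ℂ => fockDensity α (normKernel α w z) ζ :=
          (measurable_fockDensity_normKernel hα hw).of_uncurry_right
        rw [lintegral_const_mul _ h1]
    _ ≤ C₁ * ∫⁻ ζ, C₂ * (average w (r / 2) μ ζ ^ p *
          (weightMeasure w (Metric.ball ζ (r / 2)))⁻¹) ∂(weightMeasure w) := by
        gcongr C₁ * ?_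
        refine lintegral_mono fun ζ => ?_
        calc average w (r / 2) μ ζ ^ p * (∫⁻ z, fockDensity α (normKernel α w z) ζ)
            ≤ average w (r / 2) μ ζ ^ p * (C₂ * (weightMeasure w (Metric.ball ζ (r / 2)))⁻¹) :=
              mul_le_mul_right (hC₂ ζ) _
          _ = _ := by ring
    _ ≤ C₁ * (C₂ * (C₃ * ∫⁻ z, average w r μ z ^ p)) := by
        rw [lintegral_const_mul' _ _ ENNReal.coe_ne_top]
        exact mul_le_mul_right (mul_le_mul_right (hC₃ μ) _) _
    _ = _ := by push_cast; ring

/-- The estimate of the diagonal entries of a Toeplitz operator. -/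
theorem exists_sum_rpow_le (hα : 0 < α) (hw : w ∈ AResInfty) {r p : ℝ} (hr : 0 < r)
    (hp : 1 ≤ p) :
    ∃ C : ℝ≥0, ∀ (μ : Measure ℂ) [SFinite μ] (ι : Type) [Fintype ι] (e : ι → FockSpace α w),
      Orthonormal ℂ e → ∑ i, (∫⁻ z, fockDensity α (e i) z ∂μ) ^ p ≤
        C * ∫⁻ z, average w r μ z ^ p := by
  have hm := locallyDoubling_weightMeasure hw
  have := hm.sigmaFinite
  have hp0 : 0 ≤ p := by linarith
  have hs : 0 < r / 2 := by positivity
  obtain ⟨C₁, hC₁⟩ := exists_rpow_carleson hα hw hs hp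
  obtain ⟨C₂, hC₂⟩ := exists_kernelDiag_mul_le hα hw hs
  obtain ⟨C₃, hC₃⟩ := hm.exists_lintegral_average_le hs hp0
  rw [mul_div_cancel₀ r two_ne_zero] at hC₃
  refine ⟨C₁ * C₂ * C₃, fun μ _ ι _ e he => ?_⟩
  -- `e_i(ζ) = ⟨e_i, B_ζ⟩`, so Bessel's inequality bounds the sum by `‖B_ζ‖² e^{-α|ζ|²}`.
  have hbessel : ∀ ζ, ∑ i, fockDensity α (e i) ζ ≤
      C₂ * (weightMeasure w (Metric.ball ζ (r / 2)))⁻¹ := by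
    intro ζ
    have h1 : ∑ i, fockDensity α (e i) ζ ≤ kernelDiag α w ζ := by
      unfold fockDensity kernelDiag
      rw [← ENNReal.ofReal_sum_of_nonneg fun i _ => by positivity, ← Finset.sum_mul]
      gcongr
      have h2 := he.sum_inner_products_le (x := kernel α w ζ) (s := Finset.univ)
      refine le_trans (le_of_eq (Finset.sum_congr rfl fun i _ => ?_)) h2
      rw [apply_eq_inner hα hw, norm_inner_symm]
    refine h1.trans ?_
    rw [← div_eq_mul_inv, ENNReal.le_div_iff_mul_le (Or.inl (hm.pos ζ _ hs).ne')
      (Or.inl (hm.lt_top ζ _).ne)]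
    exact hC₂ ζ
  calc ∑ i, (∫⁻ z, fockDensity α (e i) z ∂μ) ^ p
      ≤ ∑ i, C₁ * ∫⁻ ζ, average w (r / 2) μ ζ ^ p * fockDensity α (e i) ζ ∂(weightMeasure w) :=
        Finset.sum_le_sum fun i _ => hC₁ μ _ (he.1 i)
    _ = C₁ * ∫⁻ ζ, average w (r / 2) μ ζ ^ p * (∑ i, fockDensity α (e i) ζ)
          ∂(weightMeasure w) := by
        rw [← Finset.mul_sum, ← lintegral_finsetSum]
        · simp only [Finset.mul_sum]
        · exact fun i _ => ((measurable_average hw _ μ).pow_const p).mul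
            (e i).measurable_fockDensity
    _ ≤ C₁ * ∫⁻ ζ, C₂ * (average w (r / 2) μ ζ ^ p *
          (weightMeasure w (Metric.ball ζ (r / 2)))⁻¹) ∂(weightMeasure w) := by
        gcongr C₁ * ?_
        refine lintegral_mono fun ζ => ?_
        calc average w (r / 2) μ ζ ^ p * (∑ i, fockDensity α (e i) ζ)
            ≤ average w (r / 2) μ ζ ^ p * (C₂ * (weightMeasure w (Metric.ball ζ (r / 2)))⁻¹) :=
              mul_le_mul_right (hbessel ζ) _
          _ = _ := by ring
    _ ≤ C₁ * (C₂ * (C₃ * ∫⁻ z, average w r μ z ^ p)) := by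
        rw [lintegral_const_mul' _ _ ENNReal.coe_ne_top]
        exact mul_le_mul_right (mul_le_mul_right (hC₃ μ) _) _
    _ = _ := by push_cast; ring

/-- Averages in `L^p` are uniformly bounded at half the radius, so `μ` is a Carleson measure. The
bound `S` depends on `μ`; it serves only to define the embedding and does not enter the norm
estimates. -/
theorem exists_lintegral_fockDensity_le (hα : 0 < α) (hw : w ∈ AResInfty) {r p : ℝ} (hr : 0 < r)
    (hp : 1 ≤ p) {μ : Measure ℂ} [SFinite μ] (h : ∫⁻ z, average w r μ z ^ p ≠ ∞) :
    ∃ S : ℝ≥0, ∀ f : FockSpace α w,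
      ∫⁻ z, fockDensity α f z ∂μ ≤ S * ENNReal.ofReal (‖f‖ ^ 2) := by
  have hm := locallyDoubling_weightMeasure hw
  have hp0 : 0 < p := by linarith
  have hs : 0 < r / 2 := by positivity
  obtain ⟨C, hC⟩ := exists_carleson hα hw hs
  obtain ⟨D, hD⟩ := hm.exists_rpow_average_le hs hp0.le
  rw [mul_div_cancel₀ r two_ne_zero] at hD
  set A : ℝ≥0∞ := (D * ∫⁻ z, average w r μ z ^ p) ^ (1 / p) with hA
  have hAt : A ≠ ∞ :=
    ENNReal.rpow_ne_top_of_nonneg (by positivity) (ENNReal.mul_ne_top ENNReal.coe_ne_top h)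
  have hle : ∀ ζ, average w (r / 2) μ ζ ≤ A := fun ζ => by
    rw [hA, one_div, ENNReal.le_rpow_inv_iff hp0]
    exact hD μ ζ
  refine ⟨C * A.toNNReal, fun f => (hC μ f).trans ?_⟩
  push_cast
  rw [ENNReal.coe_toNNReal hAt, mul_assoc, ofReal_norm_sq (isWeight_of_mem_AResInfty hw),
    ← lintegral_const_mul' _ _ hAt]
  gcongr
  exact hle _

end WeightedFock

/-! ### Toeplitz operators and their singular values -/

namespace WeightedFock

open FockSpace

variable {α : ℝ} {w : ℂ → ℝ}

/-- The measure `e^{-α|ξ|²} dμ(ξ)`. -/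
noncomputable def gaussMeasure (α : ℝ) (μ : Measure ℂ) : Measure ℂ :=
  μ.withDensity fun ξ => ENNReal.ofReal (Real.exp (-α * ‖ξ‖ ^ 2))

theorem lintegral_gaussMeasure (α : ℝ) (μ : Measure ℂ) {f : ℂ → ℂ} (hf : Measurable f) :
    ∫⁻ z, ‖f z‖ₑ ^ (2 : ℝ) ∂(gaussMeasure α μ) = ∫⁻ z, fockDensity α f z ∂μ := by
  rw [gaussMeasure, lintegral_withDensity_eq_lintegral_mul _ (by fun_prop) (by fun_prop)]
  refine lintegral_congr fun z => ?_
  rw [Pi.mul_apply, fockDensity, ENNReal.ofReal_mul (by positivity), mul_comm,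
    ENNReal.ofReal_pow (norm_nonneg _), ofReal_norm]
  norm_cast

theorem memLp_gaussMeasure {μ : Measure ℂ} {f : ℂ → ℂ} (hf : Continuous f)
    (h : ∫⁻ z, fockDensity α f z ∂μ < ∞) : MemLp f 2 (gaussMeasure α μ) := by
  refine ⟨hf.aestronglyMeasurable, ?_⟩
  rw [eLpNorm_lt_top_iff_lintegral_rpow_enorm_lt_top (by norm_num) (by norm_num)]
  rw [ENNReal.toReal_ofNat, lintegral_gaussMeasure α μ hf.measurable]
  exact h

/-- The embedding of the weighted Fock space into `L²(e^{-α|ξ|²} dμ)`. -/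
theorem exists_embedding {μ : Measure ℂ} {S : ℝ≥0}
    (hS : ∀ f : FockSpace α w, ∫⁻ z, fockDensity α f z ∂μ ≤ S * ENNReal.ofReal (‖f‖ ^ 2)) :
    ∃ J : FockSpace α w →L[ℂ] Lp ℂ 2 (gaussMeasure α μ),
      (∀ f, ENNReal.ofReal (‖J f‖ ^ 2) = ∫⁻ z, fockDensity α f z ∂μ) ∧
      ∀ f g : FockSpace α w, inner ℂ (J g) (J f) =
        ∫ ξ, f ξ * conj (g ξ) ∂(gaussMeasure α μ) := by
  have hmem : ∀ f : FockSpace α w, MemLp f 2 (gaussMeasure α μ) := fun f =>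
    memLp_gaussMeasure f.differentiable.continuous (lt_of_le_of_lt (hS f)
      (ENNReal.mul_lt_top ENNReal.coe_lt_top ENNReal.ofReal_lt_top))
  have hnorm : ∀ f : FockSpace α w,
      ENNReal.ofReal (‖(hmem f).toLp f‖ ^ 2) = ∫⁻ z, fockDensity α f z ∂μ := by
    intro f
    rw [← lintegral_gaussMeasure α μ f.differentiable.continuous.measurable, Lp.norm_toLp,
      ENNReal.ofReal_pow ENNReal.toReal_nonneg, ENNReal.ofReal_toReal (hmem f).2.ne,
      eLpNorm_eq_lintegral_rpow_enorm_toReal (by norm_num) (by norm_num), ← ENNReal.rpow_natCast,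
      ← ENNReal.rpow_mul]
    simp
  let J : FockSpace α w →ₗ[ℂ] Lp ℂ 2 (gaussMeasure α μ) :=
    { toFun := fun f => (hmem f).toLp f
      map_add' := fun f g => MemLp.toLp_add (hmem f) (hmem g)
      map_smul' := fun c f => MemLp.toLp_const_smul c (hmem f) }
  refine ⟨J.mkContinuous (Real.sqrt S) fun f => ?_, hnorm, fun f g => ?_⟩
  · have h1 : ENNReal.ofReal (‖J f‖ ^ 2) ≤ ENNReal.ofReal (S * ‖f‖ ^ 2) := by
      rw [ENNReal.ofReal_mul S.coe_nonneg, ENNReal.ofReal_coe_nnreal]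
      exact (hnorm f).le.trans (hS f)
    rw [ENNReal.ofReal_le_ofReal_iff (by positivity)] at h1
    refine le_of_sq_le_sq ?_ (by positivity)
    rwa [mul_pow, Real.sq_sqrt S.coe_nonneg]
  · change inner ℂ ((hmem g).toLp g) ((hmem f).toLp f) = _
    rw [L2.inner_def]
    refine integral_congr_ae ?_
    filter_upwards [(hmem f).coeFn_toLp, (hmem g).coeFn_toLp] with ξ h1 h2
    rw [h1, h2]
    rfl

theorem integral_gaussMeasure (μ : Measure ℂ) (F : ℂ → ℂ) :
    ∫ ξ, F ξ ∂(gaussMeasure α μ) = ∫ ξ, F ξ * (Real.exp (-α * ‖ξ‖ ^ 2) : ℂ) ∂μ := by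
  rw [gaussMeasure, integral_withDensity_eq_integral_toReal_smul (by fun_prop)
    (Filter.Eventually.of_forall fun _ => ENNReal.ofReal_lt_top)]
  refine integral_congr_ae (Filter.Eventually.of_forall fun ξ => ?_)
  simp only
  rw [ENNReal.toReal_ofReal (Real.exp_pos _).le, Complex.real_smul, mul_comm]

theorem integrable_gaussMeasure (μ : Measure ℂ) {F : ℂ → ℂ}
    (h : Integrable F (gaussMeasure α μ)) :
    Integrable (fun ξ => F ξ * (Real.exp (-α * ‖ξ‖ ^ 2) : ℂ)) μ := by
  rw [gaussMeasure, integrable_withDensity_iff_integrable_smul' (by fun_prop)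
    (Filter.Eventually.of_forall fun _ => ENNReal.ofReal_lt_top)] at h
  refine h.congr (Filter.Eventually.of_forall fun ξ => ?_)
  simp only
  rw [ENNReal.toReal_ofReal (Real.exp_pos _).le, Complex.real_smul, mul_comm]

/-- The Toeplitz operator of a measure with averages in `L^p`. -/
theorem exists_isToeplitz (hα : 0 < α) (hw : w ∈ AResInfty) {r p : ℝ} (hr : 0 < r)
    (hp : 1 ≤ p) :
    ∃ C : ℝ≥0, ∀ μ : Measure ℂ, ∫⁻ z, average w r μ z ^ p ≠ ∞ →
      ∃ T : FockSpace α w →L[ℂ] FockSpace α w, IsToeplitz μ T ∧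
        ∃ s, IsSingularValueSeq T s ∧
          ∑' n, ENNReal.ofReal (s n) ^ p ≤ C * ∫⁻ z, average w r μ z ^ p := by
  have hp0 : 0 < p := by linarith
  obtain ⟨C, hC⟩ := exists_sum_rpow_le hα hw hr hp
  refine ⟨C, fun μ hμ => ?_⟩
  have := isLocallyFiniteMeasure_of_lintegral_average hw hr hp0 hμ
  obtain ⟨S, hS⟩ := exists_lintegral_fockDensity_le hα hw hr hp hμ
  obtain ⟨J, hJn, hJi⟩ := exists_embedding hS
  let := normedAddCommGroup hα hw
  have := completeSpace hα hw
  have hdiag : DiagonalSumLE J p (C * ∫⁻ z, average w r μ z ^ p) := by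
    intro ι _ e he
    simp only [hJn]
    exact hC μ ι e he
  obtain ⟨s, hs, hsum⟩ := hdiag.exists_isSingularValueSeq hp0
    (ENNReal.mul_ne_top ENNReal.coe_ne_top hμ)
  -- The value of `J† J f` at `z` is `⟨J f, J B_z⟩`, which is the defining integral of `T_μ f(z)`.
  refine ⟨J.adjoint ∘L J, fun f z => ⟨?_, ?_⟩, s, hs, hsum⟩
  · have h1 : ∀ g : FockSpace α w, MemLp g 2 (gaussMeasure α μ) := fun g =>
      memLp_gaussMeasure g.differentiable.continuous (lt_of_le_of_lt (hS g)
        (ENNReal.mul_lt_top ENNReal.coe_lt_top ENNReal.ofReal_lt_top))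
    exact integrable_gaussMeasure μ ((h1 f).integrable_mul (h1 (kernel α w z)).star)
  · rw [apply_eq_inner hα hw, ContinuousLinearMap.comp_apply,
      ContinuousLinearMap.adjoint_inner_right, hJi, integral_gaussMeasure]
    rfl

/-- Since `b_z` is a multiple of `B_z`, pairing `T b_z` with `b_z` evaluates `T b_z` at `z` and
gives back the Berezin integral. -/
theorem IsToeplitz.berezin_le (hα : 0 < α) (hw : w ∈ AResInfty) {μ : Measure ℂ}
    {T : FockSpace α w →L[ℂ] FockSpace α w} (hT : IsToeplitz μ T) (z : ℂ) :
    berezin α w μ z ≤ ENNReal.ofReal ‖inner ℂ (normKernel α w z) (T (normKernel α w z))‖ := by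
  set b := normKernel α w z with hb
  obtain ⟨h1, h2⟩ := hT b z
  set c : ℝ := ‖kernel α w z‖⁻¹ with hc
  have hb' : ∀ ξ, b ξ = (c : ℂ) * kernel α w z ξ := fun ξ => rfl
  have h3 : inner ℂ b (T b) = (c : ℂ) * T b z := by
    rw [hb, normKernel, inner_smul_left, ← hc, Complex.conj_ofReal, ← normKernel,
      ← apply_eq_inner hα hw]
  have h4 : ∀ ξ, (c : ℂ) * toeplitzIntegrand b z ξ =
      ((‖b ξ‖ ^ 2 * Real.exp (-α * ‖ξ‖ ^ 2) : ℝ) : ℂ) := by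
    intro ξ
    have h5 : (c : ℂ) * toeplitzIntegrand b z ξ =
        (b ξ * conj (b ξ)) * (Real.exp (-α * ‖ξ‖ ^ 2) : ℂ) := by
      rw [toeplitzIntegrand, hb' ξ, map_mul, Complex.conj_ofReal]; ring
    rw [h5, Complex.mul_conj, Complex.normSq_eq_norm_sq]
    push_cast; rfl
  have h6 : inner ℂ b (T b) =
      ((∫ ξ, ‖b ξ‖ ^ 2 * Real.exp (-α * ‖ξ‖ ^ 2) ∂μ : ℝ) : ℂ) := by
    rw [h3, h2, ← integral_const_mul, ← integral_complex_ofReal]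
    simp only [h4]
  have h7 : Integrable (fun ξ => ‖b ξ‖ ^ 2 * Real.exp (-α * ‖ξ‖ ^ 2)) μ := by
    have h8 := (h1.const_mul (c : ℂ)).re
    refine h8.congr (Filter.Eventually.of_forall fun ξ => ?_)
    simp only
    rw [h4]
    exact Complex.ofReal_re _
  rw [berezin, ← ofReal_integral_eq_lintegral_ofReal h7
    (Filter.Eventually.of_forall fun ξ => by positivity), h6, Complex.norm_real]
  exact ENNReal.ofReal_le_ofReal (Real.le_norm_self _)

/-- `|⟨x, e_n⟩ ⟨x, σ_n⟩|` is at most half the sum of the squares, so no positivity of `T` and no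
relation between the two systems is needed. Where `s n = 0` the vectors are arbitrary, and the
weight is set to zero. -/
theorem ofReal_norm_inner_le_tsum {T : FockSpace α w →L[ℂ] FockSpace α w} {s : ℕ → ℝ}
    {e σ : ℕ → FockSpace α w} (hs : ∀ n, 0 ≤ s n)
    (hT : ∀ x, HasSum (fun n => ((s n : ℂ) * inner ℂ (e n) x) • σ n) (T x))
    (x : FockSpace α w) :
    ENNReal.ofReal ‖inner ℂ x (T x)‖ ≤ ∑' n, ENNReal.ofReal (s n) *
      ENNReal.ofReal (if s n = 0 then 0 else
        (‖inner ℂ x (e n)‖ ^ 2 + ‖inner ℂ x (σ n)‖ ^ 2) / 2) := by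
  have h1 := (hT x).mapL (innerSL ℂ x)
  rw [ofReal_norm, ← innerSL_apply_apply ℂ x (T x), ← h1.tsum_eq]
  refine (enorm_tsum_le_tsum_enorm).trans (ENNReal.tsum_le_tsum fun n => ?_)
  rw [innerSL_apply_apply, inner_smul_right, ← ofReal_norm, ← ENNReal.ofReal_mul (hs n)]
  apply ENNReal.ofReal_le_ofReal
  rw [norm_mul, norm_mul, Complex.norm_real, Real.norm_of_nonneg (hs n), mul_assoc]
  by_cases h0 : s n = 0
  · simp [h0]
  · rw [if_neg h0, norm_inner_symm (e n) x]
    refine mul_le_mul_of_nonneg_left ?_ (hs n)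
    nlinarith [sq_nonneg (‖inner ℂ x (e n)‖ - ‖inner ℂ x (σ n)‖)]

/-- Bessel's inequality for each of the two systems; total mass at most one is what Jensen's
inequality requires. -/
theorem tsum_weights_le {s : ℕ → ℝ} {e σ : ℕ → FockSpace α w}
    (he : Orthonormal ℂ (fun n : {n // s n ≠ 0} => e n))
    (hσ : Orthonormal ℂ (fun n : {n // s n ≠ 0} => σ n)) {x : FockSpace α w} (hx : ‖x‖ = 1) :
    ∑' n, ENNReal.ofReal (if s n = 0 then 0 else
      (‖inner ℂ x (e n)‖ ^ 2 + ‖inner ℂ x (σ n)‖ ^ 2) / 2) ≤ 1 := by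
  rw [ENNReal.tsum_eq_iSup_sum]
  refine iSup_le fun F => ?_
  rw [← ENNReal.ofReal_sum_of_nonneg fun n _ => by split_ifs <;> positivity,
    ← ENNReal.ofReal_one]
  apply ENNReal.ofReal_le_ofReal
  have hbessel : ∀ g : ℕ → FockSpace α w, Orthonormal ℂ (fun n : {n // s n ≠ 0} => g n) →
      ∑ n ∈ F, (if s n = 0 then 0 else ‖inner ℂ x (g n)‖ ^ 2) ≤ 1 := by
    intro g hg
    have h1 := hg.sum_inner_products_le (x := x) (s := F.subtype fun n => s n ≠ 0)
    rw [hx, one_pow] at h1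
    refine le_trans (le_of_eq ?_) h1
    rw [Finset.sum_subtype_eq_sum_filter (f := fun n => ‖inner ℂ (g n) x‖ ^ 2),
      Finset.sum_filter]
    refine Finset.sum_congr rfl fun n _ => ?_
    by_cases h0 : s n = 0 <;> simp [h0, norm_inner_symm x (g n)]
  have h2 := hbessel e he
  have h3 := hbessel σ hσ
  calc ∑ n ∈ F, (if s n = 0 then 0 else (‖inner ℂ x (e n)‖ ^ 2 + ‖inner ℂ x (σ n)‖ ^ 2) / 2)
      = (∑ n ∈ F, (if s n = 0 then 0 else ‖inner ℂ x (e n)‖ ^ 2) +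
          ∑ n ∈ F, (if s n = 0 then 0 else ‖inner ℂ x (σ n)‖ ^ 2)) / 2 := by
        rw [← Finset.sum_add_distrib, Finset.sum_div]
        refine Finset.sum_congr rfl fun n _ => ?_
        split_ifs <;> simp
    _ ≤ 1 := by linarith

/-- The Berezin transform is dominated in `L^p` by the singular values. -/
theorem exists_lintegral_berezin_le_tsum (hα : 0 < α) (hw : w ∈ AResInfty) {p : ℝ}
    (hp : 1 ≤ p) :
    ∃ C : ℝ≥0, ∀ (μ : Measure ℂ) (T : FockSpace α w →L[ℂ] FockSpace α w) (s : ℕ → ℝ),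
      IsToeplitz μ T → IsSingularValueSeq T s →
        ∫⁻ z, berezin α w μ z ^ p ≤ C * ∑' n, ENNReal.ofReal (s n) ^ p := by
  have hp0 : 0 ≤ p := by linarith
  obtain ⟨C, hC⟩ := exists_lintegral_div_kernelDiag_le hα hw
  refine ⟨C, fun μ T s hT hs => ?_⟩
  obtain ⟨-, hs0, -, e, σ, he, hσ, hsum⟩ := hs
  set u : ℕ → ℂ → ℝ≥0∞ := fun n z => ENNReal.ofReal (if s n = 0 then 0 else
    (‖inner ℂ (normKernel α w z) (e n)‖ ^ 2 + ‖inner ℂ (normKernel α w z) (σ n)‖ ^ 2) / 2) with hu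
  have hform : ∀ n, s n ≠ 0 → ∀ z, u n z =
      (fockDensity α (e n) z * (kernelDiag α w z)⁻¹ +
        fockDensity α (σ n) z * (kernelDiag α w z)⁻¹) / 2 := by
    intro n hn z
    rw [hu]
    simp only
    rw [if_neg hn, ENNReal.ofReal_div_of_pos two_pos, ENNReal.ofReal_add (by positivity)
      (by positivity), ofReal_norm_inner_normKernel_sq hα hw,
      ofReal_norm_inner_normKernel_sq hα hw, ENNReal.ofReal_ofNat]
  have hm : ∀ g : FockSpace α w, Measurable fun z =>
      fockDensity α g z * (kernelDiag α w z)⁻¹ := fun g =>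
    g.measurable_fockDensity.mul (measurable_kernelDiag_and_kernel hα hw).1.inv
  have hum : ∀ n, Measurable (u n) := by
    intro n
    by_cases hn : s n = 0
    · have : u n = fun _ => 0 := by
        ext z; rw [hu]; simp [hn]
      rw [this]; exact measurable_const
    · have : u n = _ := funext (hform n hn)
      rw [this]
      exact ((hm _).add (hm _)).div_const 2
  have hui : ∀ n, ∫⁻ z, u n z ≤ C := by
    intro n
    by_cases hn : s n = 0
    · have : u n = fun _ => 0 := by
        ext z; rw [hu]; simp [hn]
      rw [this]; simp
    · simp only [hform n hn, div_eq_mul_inv]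
      rw [lintegral_mul_const' _ _ (by simp), lintegral_add_left (hm _)]
      have h1 := hC (e n)
      have h2 := hC (σ n)
      rw [he.1 ⟨n, hn⟩] at h1
      rw [hσ.1 ⟨n, hn⟩] at h2
      simp only [one_pow, ENNReal.ofReal_one, mul_one] at h1 h2
      rw [← div_eq_mul_inv]
      refine ENNReal.div_le_of_le_mul ?_
      rw [mul_two]
      exact add_le_add h1 h2
  have hpt : ∀ z, berezin α w μ z ^ p ≤ ∑' n, ENNReal.ofReal (s n) ^ p * u n z := by
    intro z
    calc berezin α w μ z ^ p ≤ (∑' n, ENNReal.ofReal (s n) * u n z) ^ p :=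
          ENNReal.rpow_le_rpow ((hT.berezin_le hα hw z).trans
            (ofReal_norm_inner_le_tsum hs0 hsum _)) hp0
      _ ≤ _ := rpow_tsum_mul_le (tsum_weights_le he hσ (norm_normKernel hα hw z)) hp
  calc ∫⁻ z, berezin α w μ z ^ p ≤ ∫⁻ z, ∑' n, ENNReal.ofReal (s n) ^ p * u n z :=
        lintegral_mono hpt
    _ = ∑' n, ∫⁻ z, ENNReal.ofReal (s n) ^ p * u n z :=
        lintegral_tsum fun n => ((hum n).const_mul _).aemeasurable
    _ ≤ ∑' n, ENNReal.ofReal (s n) ^ p * C := by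
        refine ENNReal.tsum_le_tsum fun n => ?_
        rw [lintegral_const_mul _ (hum n)]
        exact mul_le_mul_right (hui n) _
    _ = _ := by rw [ENNReal.tsum_mul_right, mul_comm]

end WeightedFock

/-! ### From integrals of powers to norms, and the equivalences -/

namespace WeightedFock

variable {α : ℝ} {w : ℂ → ℝ}

theorem eLpNorm_ofReal_eq {f : ℂ → ℝ≥0∞} {p : ℝ} (hp : 0 < p) :
    eLpNorm f (ENNReal.ofReal p) volume = (∫⁻ z, f z ^ p) ^ (1 / p) := by
  rw [eLpNorm_eq_lintegral_rpow_enorm_toReal (by simpa using hp) ENNReal.ofReal_ne_top,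
    ENNReal.toReal_ofReal hp.le]
  simp only [enorm_eq_self]

theorem eLpNorm_ofReal_lt_top_iff {f : ℂ → ℝ≥0∞} {p : ℝ} (hp : 0 < p) :
    eLpNorm f (ENNReal.ofReal p) volume < ∞ ↔ ∫⁻ z, f z ^ p ≠ ∞ := by
  rw [eLpNorm_ofReal_eq hp, ENNReal.rpow_lt_top_iff_of_pos (by positivity), lt_top_iff_ne_top]

/-- A positive constant that bounds the `p`-th root of a quantity at most `C * Y`. -/
noncomputable def rootConst (C : ℝ≥0) (p : ℝ) : ℝ≥0 := (C + 1) ^ (1 / p)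

theorem rootConst_pos (C : ℝ≥0) (p : ℝ) : 0 < rootConst C p := NNReal.rpow_pos (by positivity)

theorem rpow_le_rootConst_mul {X Y : ℝ≥0∞} {C : ℝ≥0} {p : ℝ} (hp : 0 < p) (h : X ≤ C * Y) :
    X ^ (1 / p) ≤ rootConst C p * Y ^ (1 / p) := by
  have hp' : 0 ≤ 1 / p := by positivity
  rw [rootConst, ENNReal.coe_rpow_of_nonneg _ hp', ← ENNReal.mul_rpow_of_nonneg _ _ hp']
  refine ENNReal.rpow_le_rpow (h.trans ?_) hp'
  gcongr
  exact le_self_add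

theorem toeplitzSchattenNorm_le {p : ℝ} {μ : Measure ℂ}
    {T : FockSpace α w →L[ℂ] FockSpace α w} {s : ℕ → ℝ} (hT : IsToeplitz μ T)
    (hs : IsSingularValueSeq T s) :
    toeplitzSchattenNorm α w p μ ≤ (∑' n, ENNReal.ofReal (s n) ^ p) ^ (1 / p) :=
  (iInf₂_le T hT).trans (iInf₂_le s hs)

theorem summable_rpow_iff {s : ℕ → ℝ} (hs : ∀ n, 0 ≤ s n) {p : ℝ} (hp : 0 ≤ p) :
    (Summable fun n => s n ^ p) ↔ ∑' n, ENNReal.ofReal (s n) ^ p ≠ ∞ := by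
  have h1 : ∀ n, ENNReal.ofReal (s n) ^ p = ENNReal.ofReal (s n ^ p) := fun n =>
    ENNReal.ofReal_rpow_of_nonneg (hs n) hp
  simp only [h1]
  constructor
  · exact fun h => h.tsum_ofReal_ne_top
  · intro h
    have h2 := ENNReal.summable_toReal h
    refine h2.congr fun n => ?_
    rw [ENNReal.toReal_ofReal (Real.rpow_nonneg (hs n) p)]

/-- The two integrals of the Berezin transform and of the disk averages are comparable. -/
theorem exists_lintegral_comparison (hα : 0 < α) (hw : w ∈ AResInfty) :
    ∃ δ ∈ Set.Ioo (0 : ℝ) 1, ∀ p : ℝ, 1 ≤ p → ∀ r ∈ Set.Ioo 0 δ, ∃ C : ℝ≥0, ∀ μ : Measure ℂ,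
      ∫⁻ z, berezin α w μ z ^ p ≤ C * ∫⁻ z, average w r μ z ^ p ∧
      ∫⁻ z, average w r μ z ^ p ≤ C * ∫⁻ z, berezin α w μ z ^ p := by
  obtain ⟨δ, hδ, h⟩ := exists_average_le_berezin hα hw
  refine ⟨δ, hδ, fun p hp r hr => ?_⟩
  have hp0 : 0 < p := by linarith
  obtain ⟨C₁, hC₁⟩ := exists_lintegral_berezin_le hα hw hr.1 hp
  obtain ⟨C₂, hC₂⟩ := h r hr
  -- The summand `1` makes the constant nonzero, so that the first bound is trivial when the
  -- averages have infinite integral; in that case `μ` need not be s-finite.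
  refine ⟨C₁ + 1 + C₂ ^ p, fun μ => ⟨?_, ?_⟩⟩
  · by_cases hμ : ∫⁻ z, average w r μ z ^ p = ∞
    · rw [hμ, ENNReal.mul_top]
      · exact le_top
      · have : 0 < C₁ + 1 + C₂ ^ p := by positivity
        exact_mod_cast this.ne'
    · have := isLocallyFiniteMeasure_of_lintegral_average hw hr.1 hp0 hμ
      refine (hC₁ μ).trans ?_
      gcongr
      rw [add_assoc]
      exact le_self_add
  · calc ∫⁻ z, average w r μ z ^ p ≤ ∫⁻ z, (C₂ * berezin α w μ z) ^ p :=
          lintegral_mono fun z => ENNReal.rpow_le_rpow (hC₂ μ z) hp0.le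
      _ = (C₂ ^ p : ℝ≥0) * ∫⁻ z, berezin α w μ z ^ p := by
          simp only [ENNReal.mul_rpow_of_nonneg _ _ hp0.le]
          rw [lintegral_const_mul' _ _
            (ENNReal.rpow_ne_top_of_nonneg hp0.le ENNReal.coe_ne_top),
            ENNReal.coe_rpow_of_nonneg _ hp0.le]
      _ ≤ _ := by
          gcongr
          exact le_add_self

end WeightedFock

theorem theorem1p4 (α : ℝ) (hα : 0 < α) (w : ℂ → ℝ) (hw : w ∈ WeightedFock.AResInfty) :
    ∃ δ ∈ Set.Ioo (0 : ℝ) 1, ∀ p : ℝ, 1 ≤ p →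
      (∀ μ : Measure ℂ, List.TFAE [
        WeightedFock.ToeplitzMemSchatten α w p μ,
        MemLp (WeightedFock.berezin α w μ) (ENNReal.ofReal p) volume,
        ∃ r ∈ Set.Ioo 0 δ, MemLp (WeightedFock.average w r μ) (ENNReal.ofReal p) volume,
        ∀ r ∈ Set.Ioo 0 δ, MemLp (WeightedFock.average w r μ) (ENNReal.ofReal p) volume]) ∧
      (∃ C : ℝ≥0, 0 < C ∧ ∀ μ : Measure ℂ,
        WeightedFock.toeplitzSchattenNorm α w p μ ≤
          C * eLpNorm (WeightedFock.berezin α w μ) (ENNReal.ofReal p) volume ∧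
        eLpNorm (WeightedFock.berezin α w μ) (ENNReal.ofReal p) volume ≤
          C * WeightedFock.toeplitzSchattenNorm α w p μ) ∧
      (∀ r ∈ Set.Ioo 0 δ, ∃ C : ℝ≥0, 0 < C ∧ ∀ μ : Measure ℂ,
        eLpNorm (WeightedFock.berezin α w μ) (ENNReal.ofReal p) volume ≤
          C * eLpNorm (WeightedFock.average w r μ) (ENNReal.ofReal p) volume ∧
        eLpNorm (WeightedFock.average w r μ) (ENNReal.ofReal p) volume ≤
          C * eLpNorm (WeightedFock.berezin α w μ) (ENNReal.ofReal p) volume) := by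
  obtain ⟨δ, hδ, hcomp⟩ := WeightedFock.exists_lintegral_comparison hα hw
  refine ⟨δ, hδ, fun p hp => ?_⟩
  have hp0 : 0 < p := by linarith
  -- Fixing one radius keeps the constants of the Schatten comparison independent of `r`.
  have hr₀ : δ / 2 ∈ Set.Ioo 0 δ := ⟨half_pos hδ.1, half_lt_self hδ.1⟩
  obtain ⟨C₀, hC₀⟩ := hcomp p hp _ hr₀
  obtain ⟨C₁, hC₁⟩ := WeightedFock.exists_isToeplitz hα hw hr₀.1 hp
  obtain ⟨C₂, hC₂⟩ := WeightedFock.exists_lintegral_berezin_le_tsum hα hw hp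
  have havg : ∀ r ∈ Set.Ioo 0 δ, ∀ μ : Measure ℂ, ∫⁻ z, WeightedFock.average w r μ z ^ p ≠ ∞ ↔
      ∫⁻ z, WeightedFock.berezin α w μ z ^ p ≠ ∞ := by
    intro r hr μ
    obtain ⟨C, hC⟩ := hcomp p hp r hr
    exact ⟨fun h => ne_top_of_le_ne_top (ENNReal.mul_ne_top ENNReal.coe_ne_top h) (hC μ).1,
      fun h => ne_top_of_le_ne_top (ENNReal.mul_ne_top ENNReal.coe_ne_top h) (hC μ).2⟩
  have hber : ∀ μ : Measure ℂ, ∫⁻ z, WeightedFock.berezin α w μ z ^ p ≠ ∞ →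
      IsLocallyFiniteMeasure μ := fun μ h =>
    WeightedFock.isLocallyFiniteMeasure_of_lintegral_average hw hr₀.1 hp0 ((havg _ hr₀ μ).2 h)
  have hberMem : ∀ μ : Measure ℂ, MemLp (WeightedFock.berezin α w μ) (ENNReal.ofReal p) volume ↔
      ∫⁻ z, WeightedFock.berezin α w μ z ^ p ≠ ∞ := by
    intro μ
    -- The measurability part of `MemLp` follows from finiteness of the integral, which makes `μ`
    -- locally finite.
    rw [MemLp, WeightedFock.eLpNorm_ofReal_lt_top_iff hp0, and_iff_right_of_imp]
    intro h
    have := hber μ h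
    exact (WeightedFock.measurable_berezin hα hw μ).aestronglyMeasurable
  have havgMem : ∀ r ∈ Set.Ioo 0 δ, ∀ μ : Measure ℂ,
      MemLp (WeightedFock.average w r μ) (ENNReal.ofReal p) volume ↔
      ∫⁻ z, WeightedFock.berezin α w μ z ^ p ≠ ∞ := by
    intro r hr μ
    rw [MemLp, WeightedFock.eLpNorm_ofReal_lt_top_iff hp0, havg r hr μ, and_iff_right_of_imp]
    intro h
    have := hber μ h
    exact (WeightedFock.measurable_average hw r μ).aestronglyMeasurable
  refine ⟨fun μ => ?_, ?_, fun r hr => ?_⟩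
  · tfae_have 1 → 2 := by
      rintro ⟨T, hT, s, hs, hsum⟩
      rw [hberMem]
      exact ne_top_of_le_ne_top (ENNReal.mul_ne_top ENNReal.coe_ne_top
        ((WeightedFock.summable_rpow_iff hs.2.1 hp0.le).1 hsum)) (hC₂ μ T s hT hs)
    tfae_have 2 → 4 := fun h r hr => (havgMem r hr μ).2 ((hberMem μ).1 h)
    tfae_have 4 → 3 := fun h => ⟨_, hr₀, h _ hr₀⟩
    tfae_have 3 → 1 := by
      rintro ⟨r, hr, h⟩
      have h1 := (havg _ hr₀ μ).2 ((havgMem r hr μ).1 h)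
      obtain ⟨T, hT, s, hs, hsum⟩ := hC₁ μ h1
      exact ⟨T, hT, s, hs, (WeightedFock.summable_rpow_iff hs.2.1 hp0.le).2
        (ne_top_of_le_ne_top (ENNReal.mul_ne_top ENNReal.coe_ne_top h1) hsum)⟩
    tfae_finish
  · refine ⟨WeightedFock.rootConst (C₁ * C₀) p + WeightedFock.rootConst C₂ p,
      add_pos (WeightedFock.rootConst_pos _ _) (WeightedFock.rootConst_pos _ _),
      fun μ => ⟨?_, ?_⟩⟩
    · rw [WeightedFock.eLpNorm_ofReal_eq hp0]
      by_cases h : ∫⁻ z, WeightedFock.berezin α w μ z ^ p = ∞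
      · rw [h, ENNReal.top_rpow_of_pos (by positivity), ENNReal.mul_top]
        · exact le_top
        · have := add_pos (WeightedFock.rootConst_pos (C₁ * C₀) p)
            (WeightedFock.rootConst_pos C₂ p)
          exact_mod_cast this.ne'
      · obtain ⟨T, hT, s, hs, hsum⟩ := hC₁ μ ((havg _ hr₀ μ).2 h)
        have h1 : ∑' n, ENNReal.ofReal (s n) ^ p ≤
            (C₁ * C₀ : ℝ≥0) * ∫⁻ z, WeightedFock.berezin α w μ z ^ p := by
          rw [ENNReal.coe_mul, mul_assoc]
          exact hsum.trans (mul_le_mul_right (hC₀ μ).2 _)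
        refine (WeightedFock.toeplitzSchattenNorm_le hT hs).trans
          ((WeightedFock.rpow_le_rootConst_mul hp0 h1).trans ?_)
        gcongr
        exact_mod_cast le_self_add
    · rw [WeightedFock.eLpNorm_ofReal_eq hp0]
      have hpos := add_pos (WeightedFock.rootConst_pos (C₁ * C₀) p)
        (WeightedFock.rootConst_pos C₂ p)
      -- Dividing by the constant turns the claim into a lower bound for an infimum; it also covers
      -- the empty infimum `∞`, when no Toeplitz operator exists.
      rw [mul_comm _ (WeightedFock.toeplitzSchattenNorm α w p μ),
        ← ENNReal.div_le_iff_le_mul (Or.inl (by exact_mod_cast hpos.ne'))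
        (Or.inl ENNReal.coe_ne_top)]
      refine le_iInf₂ fun T hT => le_iInf₂ fun s hs => ?_
      rw [ENNReal.div_le_iff_le_mul (Or.inl (by exact_mod_cast hpos.ne'))
        (Or.inl ENNReal.coe_ne_top)]
      refine (WeightedFock.rpow_le_rootConst_mul hp0 (hC₂ μ T s hT hs)).trans ?_
      rw [mul_comm]
      gcongr
      exact_mod_cast le_add_self
  · obtain ⟨C, hC⟩ := hcomp p hp r hr
    refine ⟨WeightedFock.rootConst C p, WeightedFock.rootConst_pos _ _, fun μ => ?_⟩
    rw [WeightedFock.eLpNorm_ofReal_eq hp0, WeightedFock.eLpNorm_ofReal_eq hp0]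
    exact ⟨WeightedFock.rpow_le_rootConst_mul hp0 (hC μ).1,
      WeightedFock.rpow_le_rootConst_mul hp0 (hC μ).2⟩
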